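/- **Theorem 3.1.** Let $(Y^3,g_Y)$ be an oriented Riemannian $3$-manifold of constant sectional curvature $\kappa$, and let $g=dt^2+g_Y$ on $M=\mathbb{R}\times Y$, oriented by $dt\wedge dV_{g_Y}$. Write a symmetric $2$-tensor on $M$ as $$\tilde h=\{h_{00},\alpha,h\}=h_{00}\,dt\otimes dt+(\alpha\otimes dt+dt\otimes\alpha)+h ,$$ where $h_{00}$, $\alpha$ and $h$ are a $t$-dependent function, $1$-form and symmetric $2$-tensor on $Y$, and assume that $\mathrm{tr}_g\tilde h=0$. Let $g_\epsilon$ be any smooth path of Riemannian metrics on $M$ with $g_0=g$ and $\frac{\partial}{\partial\epsilon}g_\epsilon|_{\epsilon=0}=\tilde h$, let $W^-(g_\epsilon)=\pi_-W\pi_-$ be the anti-self-dual Weyl tensor as a $(0,4)$-tensor, and let $\mathcal{D}\tilde h=(W^-)'_g(\tilde h)=\frac{\partial}{\partial\epsilon}W^-(g_\epsilon)|_{\epsilon=0}$. Regard $\mathcal{D}\tilde h$ as a bilinear form on $TY$ by $$(v,w)\mapsto\langle \mathcal{D}\tilde h\,(\omega_v),\omega_w\rangle,\qquad \omega_v=dt\wedge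 v^\flat-*v^\flat,$$ where $*$ is the Hodge star of $(Y,g_Y)$, a $(0,4)$-tensor $P$ acts on $2$-forms by $(P\omega)_{ab}=\tfrac12P_{abcd}\omega^{cd}$, and $\langle\omega,\omega'\rangle=\tfrac12\omega_{ab}\omega'^{ab}$ (curvature convention: $R_{abab}>0$ on round spheres). Then this derivative exists and $$\mathcal{D}\{h_{00},\alpha,h\}=\tfrac12\mathcal{K}_{g_Y}\!\left(-\tfrac12dh_{00}+\dot\alpha-*d\alpha\right)-\tfrac12\mathrm{tf}(\ddot h)+\tfrac12\,\check{d}\,\dot h-E'(h),$$ where $E'(h)$ is the linearization at $g_Y$, in the direction $h$, of the traceless Ricci tensor of metrics on $Y$ (its derivative along any smooth path of metrics through $g_Y$ with velocity $h$). Equivalently, $$\mathcal{D}\{h_{00},\alpha,h\}=\tfrac12\mathcal{K}_{g_Y}\!\left(-\tfrac12dh_{00}-\delta_Yh+\dot\alpha-*d\alpha+\tfrac12\,d\,\mathrm{tr}_Y h\right)-\tfrac12\mathrm{tf}(\ddot h)-\kappa\,\mathrm{tf}(h)+\tfrac12\,\check{d}\,\dot h+\tfrac12\Delta_{g_Y}\mathrm{tf}(h).$$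 Here dots are $t$-derivatives, $d$ and all other operators act on $Y$ for fixed $t$, $\mathrm{tf}$ is the trace-free part with respect to $g_Y$, $(\delta_Yh)_j=\nabla^ih_{ij}$, $\Delta_{g_Y}=\nabla^k\nabla_k$ is the rough Laplacian on symmetric $2$-tensors, $(\mathcal{K}_{g_Y}\omega)_{ij}=\nabla_i\omega_j+\nabla_j\omega_i-\tfrac23(\nabla^k\omega_k)(g_Y)_{ij}$, and $\check{d}$ is the Dirac-type operator given in a positively oriented orthonormal frame by $(\check{d}h)_{ij}=\mathrm{Sym}_{ij}\sum_{k,l}\epsilon_{ikl}(\nabla_kh_{lj}-\nabla_lh_{kj})$, with $\mathrm{Sym}_{ij}F=\tfrac12(F_{ij}+F_{ji})$. -/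

import Mathlib

open scoped Manifold ContDiff Topology

noncomputable section

namespace Cyl

/-! ### Riemannian geometry in local coordinates

Tensor fields on a coordinate domain of `ℝⁿ` are given by their components: a `1`-form is
`θ x i`, a symmetric `2`-tensor is `h x i j`, a curvature-type tensor is `P a b c d`. -/

section Coordinates

variable {n : ℕ}

/-- The partial derivative `∂ᵢ f`. -/
def pd (i : Fin n) (f : (Fin n → ℝ) → ℝ) (x : Fin n → ℝ) : ℝ :=
  fderiv ℝ f x (Pi.single i 1)

/-- Christoffel symbols `Γᵏᵢⱼ` of the metric `g`. -/
def christoffel (g : (Fin n → ℝ) → Matrix (Fin n) (Fin n) ℝ) (x : Fin n → ℝ)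
    (k i j : Fin n) : ℝ :=
  (1 / 2) * ∑ l, (g x)⁻¹ k l *
    (pd i (fun y => g y j l) x + pd j (fun y => g y i l) x - pd l (fun y => g y i j) x)

/-- `Rᵃ_{bcd}`, where `R(∂_c, ∂_d) ∂_b = Rᵃ_{bcd} ∂_a`. -/
def riemannUp (g : (Fin n → ℝ) → Matrix (Fin n) (Fin n) ℝ) (x : Fin n → ℝ)
    (a b c d : Fin n) : ℝ :=
  pd c (fun y => christoffel g y a d b) x - pd d (fun y => christoffel g y a c b) x
    + ∑ f, (christoffel g x a c f * christoffel g x f d b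
        - christoffel g x a d f * christoffel g x f c b)

/-- The curvature tensor `R_{abcd}`, normalized so that `R_{abab} > 0` on round spheres. -/
def riemann (g : (Fin n → ℝ) → Matrix (Fin n) (Fin n) ℝ) (x : Fin n → ℝ)
    (a b c d : Fin n) : ℝ :=
  ∑ e, g x a e * riemannUp g x e b c d

/-- The Ricci tensor. -/
def ricci (g : (Fin n → ℝ) → Matrix (Fin n) (Fin n) ℝ) (x : Fin n → ℝ) :
    Matrix (Fin n) (Fin n) ℝ :=
  Matrix.of fun b d => ∑ a, riemannUp g x a b a d

/-- The trace `g^{ij} h_{ij}` of a `2`-tensor at a point. -/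
def tr (g h : Matrix (Fin n) (Fin n) ℝ) : ℝ := ∑ i, ∑ j, g⁻¹ i j * h i j

/-- The trace-free part of a `2`-tensor at a point. -/
def tf (g h : Matrix (Fin n) (Fin n) ℝ) : Matrix (Fin n) (Fin n) ℝ :=
  h - ((1 / (n : ℝ)) * tr g h) • g

/-- The scalar curvature. -/
def scalar (g : (Fin n → ℝ) → Matrix (Fin n) (Fin n) ℝ) (x : Fin n → ℝ) : ℝ :=
  tr (g x) (ricci g x)

/-- The traceless Ricci tensor `E`. -/
def tracelessRicci (g : (Fin n → ℝ) → Matrix (Fin n) (Fin n) ℝ) (x : Fin n → ℝ) :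
    Matrix (Fin n) (Fin n) ℝ :=
  ricci g x - ((1 / (n : ℝ)) * scalar g x) • g x

/-- The Kulkarni-Nomizu product. -/
def kulkarniNomizu (h k : Matrix (Fin n) (Fin n) ℝ) (a b c d : Fin n) : ℝ :=
  h a c * k b d + h b d * k a c - h a d * k b c - h b c * k a d

/-- The symbol `[i₁ … iₙ]`: the sign of `i` if `i` is a permutation, and `0` otherwise. -/
def altSymbol (i : Fin n → Fin n) : ℝ :=
  Matrix.det (Matrix.of fun r s => if i r = s then (1 : ℝ) else 0)

/-- `(∇θ)_{ij} = ∇ᵢ θⱼ`. -/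
def covOne (g : (Fin n → ℝ) → Matrix (Fin n) (Fin n) ℝ) (θ : (Fin n → ℝ) → Fin n → ℝ)
    (x : Fin n → ℝ) : Matrix (Fin n) (Fin n) ℝ :=
  Matrix.of fun i j => pd i (fun y => θ y j) x - ∑ m, christoffel g x m i j * θ x m

/-- `∇ₖ h_{ij}`. -/
def covTwo (g h : (Fin n → ℝ) → Matrix (Fin n) (Fin n) ℝ) (x : Fin n → ℝ)
    (k i j : Fin n) : ℝ :=
  pd k (fun y => h y i j) x
    - ∑ m, (christoffel g x m k i * h x m j + christoffel g x m k j * h x i m)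

/-- `∇ₖ∇ₗ h_{ij}` (second covariant derivative, `k` being the last differentiation). -/
def covCovTwo (g h : (Fin n → ℝ) → Matrix (Fin n) (Fin n) ℝ) (x : Fin n → ℝ)
    (k l i j : Fin n) : ℝ :=
  pd k (fun y => covTwo g h y l i j) x
    - ∑ m, (christoffel g x m k l * covTwo g h x m i j
        + christoffel g x m k i * covTwo g h x l m j
        + christoffel g x m k j * covTwo g h x l i m)

/-- The rough Laplacian `g^{kl} ∇ₖ∇ₗ h_{ij}`. -/
def roughLaplacian (g h : (Fin n → ℝ) → Matrix (Fin n) (Fin n) ℝ) (x : Fin n → ℝ) :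
    Matrix (Fin n) (Fin n) ℝ :=
  Matrix.of fun i j => ∑ k, ∑ l, (g x)⁻¹ k l * covCovTwo g h x k l i j

/-- The divergence `(δh)ⱼ = ∇ⁱ h_{ij}`. -/
def divTwo (g h : (Fin n → ℝ) → Matrix (Fin n) (Fin n) ℝ) (x : Fin n → ℝ) (j : Fin n) : ℝ :=
  ∑ i, ∑ k, (g x)⁻¹ i k * covTwo g h x i k j

/-- The conformal Killing operator
`(𝒦 θ)_{ij} = ∇ᵢ θⱼ + ∇ⱼ θᵢ - (2 / n) (∇ᵏ θₖ) g_{ij}`. -/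
def confKilling (g : (Fin n → ℝ) → Matrix (Fin n) (Fin n) ℝ) (θ : (Fin n → ℝ) → Fin n → ℝ)
    (x : Fin n → ℝ) : Matrix (Fin n) (Fin n) ℝ :=
  Matrix.of fun i j => covOne g θ x i j + covOne g θ x j i
    - (2 / (n : ℝ)) * tr (g x) (covOne g θ x) * g x i j

end Coordinates

/-! ### Dimension three -/

/-- `ε_i^{kl}`: the Riemannian volume form with the last two indices raised. -/
def epsUp (g : Matrix (Fin 3) (Fin 3) ℝ) (i k l : Fin 3) : ℝ :=
  ∑ p, ∑ q, Real.sqrt g.det * altSymbol ![i, p, q] * g⁻¹ p k * g⁻¹ q l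

/-- The `2`-form `*ξ` of a `1`-form `ξ`, `(*ξ)_{kl} = ε_{kl}^m ξₘ`. -/
def starOne (g : Matrix (Fin 3) (Fin 3) ℝ) (ξ : Fin 3 → ℝ) (k l : Fin 3) : ℝ :=
  ∑ m, ∑ p, Real.sqrt g.det * altSymbol ![k, l, m] * g⁻¹ m p * ξ p

/-- The `1`-form `*dα`, `(*dα)ᵢ = ½ ε_i^{kl} (∂ₖ αₗ - ∂ₗ αₖ)`. -/
def starD (g : (Fin 3 → ℝ) → Matrix (Fin 3) (Fin 3) ℝ) (α : (Fin 3 → ℝ) → Fin 3 → ℝ)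
    (x : Fin 3 → ℝ) (i : Fin 3) : ℝ :=
  (1 / 2) * ∑ k, ∑ l, epsUp (g x) i k l
    * (pd k (fun y => α y l) x - pd l (fun y => α y k) x)

/-- The Dirac-type operator
`(đh)_{ij} = Sym_{ij} (ε_i^{kl} (d^∇ h)_{klj})`, `(d^∇ h)_{klj} = ∇ₖ h_{lj} - ∇ₗ h_{kj}`. -/
def dslash (g h : (Fin 3 → ℝ) → Matrix (Fin 3) (Fin 3) ℝ) (x : Fin 3 → ℝ) :
    Matrix (Fin 3) (Fin 3) ℝ :=
  let F : Fin 3 → Fin 3 → ℝ := fun i j =>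
    ∑ k, ∑ l, epsUp (g x) i k l * (covTwo g h x k l j - covTwo g h x l k j)
  Matrix.of fun i j => (1 / 2) * (F i j + F j i)

/-- The linearization `E'(h)` at `g` of the traceless Ricci tensor in the direction `h`. -/
def linTracelessRicci (g h : (Fin 3 → ℝ) → Matrix (Fin 3) (Fin 3) ℝ) (x : Fin 3 → ℝ) :
    Matrix (Fin 3) (Fin 3) ℝ :=
  Matrix.of fun i j => deriv (fun s : ℝ => tracelessRicci (fun y => g y + s • h y) x i j) 0

/-! ### Dimension four: the anti-self-dual Weyl tensor -/

/-- The Weyl tensor `W = Rm - ½ E ⊚ g - (R / 24) g ⊚ g` of a four-dimensional metric. -/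
def weyl (g : (Fin 4 → ℝ) → Matrix (Fin 4) (Fin 4) ℝ) (z : Fin 4 → ℝ)
    (a b c d : Fin 4) : ℝ :=
  riemann g z a b c d - (1 / 2) * kulkarniNomizu (tracelessRicci g z) (g z) a b c d
    - (scalar g z / 24) * kulkarniNomizu (g z) (g z) a b c d

/-- Raising both indices of a `2`-form. -/
def raise (g : Matrix (Fin 4) (Fin 4) ℝ) (θ : Fin 4 → Fin 4 → ℝ) (a b : Fin 4) : ℝ :=
  ∑ p, ∑ q, g⁻¹ a p * g⁻¹ b q * θ p q

/-- The Hodge star on `2`-forms, for the orientation `dx⁰ ∧ dx¹ ∧ dx² ∧ dx³`: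
`(*θ)_{ab} = ½ √(det g) [abcd] θ^{cd}`. -/
def hodgeStar (g : Matrix (Fin 4) (Fin 4) ℝ) (θ : Fin 4 → Fin 4 → ℝ) (a b : Fin 4) : ℝ :=
  (1 / 2) * ∑ c, ∑ d, Real.sqrt g.det * altSymbol ![a, b, c, d] * raise g θ c d

/-- The projection `π₋ = ½ (1 - *)` of `Λ²` onto `Λ²₋`. -/
def asdProj (g : Matrix (Fin 4) (Fin 4) ℝ) (θ : Fin 4 → Fin 4 → ℝ) (a b : Fin 4) : ℝ :=
  (1 / 2) * (θ a b - hodgeStar g θ a b)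

/-- The anti-self-dual Weyl tensor `W⁻ = π₋ W π₋` as a `(0,4)`-tensor: `π₋` is applied to both
pairs of indices of `W`. -/
def weylMinus (g : (Fin 4 → ℝ) → Matrix (Fin 4) (Fin 4) ℝ) (z : Fin 4 → ℝ)
    (a b c d : Fin 4) : ℝ :=
  asdProj (g z) (fun p q => asdProj (g z) (fun r s => weyl g z p q r s) c d) a b

/-- `⟨P θ, θ'⟩`, where a curvature-type tensor `P` acts on `2`-forms by
`(P θ)_{ab} = ½ P_{abcd} θ^{cd}` and `⟨θ, θ'⟩ = ½ θ_{ab} θ'^{ab}`. -/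
def curvForm (g : Matrix (Fin 4) (Fin 4) ℝ) (P : Fin 4 → Fin 4 → Fin 4 → Fin 4 → ℝ)
    (θ θ' : Fin 4 → Fin 4 → ℝ) : ℝ :=
  (1 / 4) * ∑ a, ∑ b, ∑ c, ∑ d, P a b c d * raise g θ c d * raise g θ' a b

/-- The matrix of the product metric `dt² + g`. -/
def cylMatrix (g : Matrix (Fin 3) (Fin 3) ℝ) : Matrix (Fin 4) (Fin 4) ℝ :=
  Matrix.of fun a b =>
    Fin.cases (Fin.cases 1 (fun _ => 0) b) (fun i => Fin.cases 0 (fun j => g i j) b) a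

/-- The anti-self-dual `2`-form `dt ∧ ξ - *ξ`, for `ξ` a `1`-form on the cross-section. -/
def asdTwoForm (g : Matrix (Fin 3) (Fin 3) ℝ) (ξ : Fin 3 → ℝ) (a b : Fin 4) : ℝ :=
  Fin.cases (Fin.cases 0 (fun l => ξ l) b)
    (fun k => Fin.cases (-ξ k) (fun l => -starOne g ξ k l) b) a

/-- The identification `S²(Λ²₋) = S²(T*Y)` at a point of the cylinder `dt² + g`: a curvature-type
tensor `P` corresponds to the bilinear form
`(v, w) ↦ ⟨P (dt ∧ v♭ - *v♭), dt ∧ w♭ - *w♭⟩`. -/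
def asdComponents (g : Matrix (Fin 3) (Fin 3) ℝ) (P : Fin 4 → Fin 4 → Fin 4 → Fin 4 → ℝ) :
    Matrix (Fin 3) (Fin 3) ℝ :=
  Matrix.of fun i j => curvForm (cylMatrix g) P
    (asdTwoForm g (fun p => g i p)) (asdTwoForm g (fun p => g j p))

/-! ### The cross-section `Y`, the cylinder `ℝ × Y`, and components in charts -/

/-- The model space of the cross-section. -/
abbrev E3 : Type := EuclideanSpace ℝ (Fin 3)

section Manifold

variable {Y : Type*} [TopologicalSpace Y] [ChartedSpace E3 Y]

/-- All transition maps of the atlas of `Y` preserve orientation; `Y` is then given the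
orientation for which the charts of the atlas are positively oriented. -/
def OrientedAtlas (Y : Type*) [TopologicalSpace Y] [ChartedSpace E3 Y] : Prop :=
  ∀ e ∈ atlas E3 Y, ∀ e' ∈ atlas E3 Y, ∀ u ∈ (e.symm.trans e').source,
    0 < (fderiv ℝ (e.symm.trans e') u).det

/-- The coordinate domain of a chart. -/
def chartDomain (e : OpenPartialHomeomorph Y E3) : Set (Fin 3 → ℝ) :=
  {x | WithLp.toLp 2 x ∈ e.target}

/-- The point of `Y` with coordinates `x`. -/
abbrev pt (e : OpenPartialHomeomorph Y E3) (x : Fin 3 → ℝ) : Y := e.symm (WithLp.toLp 2 x)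

/-- The coordinate vector field `∂ᵢ` of a chart. -/
def frame (e : OpenPartialHomeomorph Y E3) (x : Fin 3 → ℝ) (i : Fin 3) :
    TangentSpace (𝓡 3) (pt e x) :=
  mfderiv (𝓡 3) (𝓡 3) e.symm (WithLp.toLp 2 x) (EuclideanSpace.single i (1 : ℝ))

/-- Components of a `1`-form on `Y` in a chart. -/
def compOne (e : OpenPartialHomeomorph Y E3)
    (θ : ∀ y : Y, TangentSpace (𝓡 3) y →L[ℝ] ℝ) (x : Fin 3 → ℝ) (i : Fin 3) : ℝ :=
  θ (pt e x) (frame e x i)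

/-- Components of a `2`-tensor on `Y` in a chart. -/
def compTwo (e : OpenPartialHomeomorph Y E3)
    (T : ∀ y : Y, TangentSpace (𝓡 3) y →L[ℝ] TangentSpace (𝓡 3) y →L[ℝ] ℝ)
    (x : Fin 3 → ℝ) : Matrix (Fin 3) (Fin 3) ℝ :=
  Matrix.of fun i j => T (pt e x) (frame e x i) (frame e x j)

/-- The model with corners of the cylinder `ℝ × Y`. -/
abbrev IM : ModelWithCorners ℝ (ℝ × E3) (ModelProd ℝ E3) := 𝓘(ℝ, ℝ).prod (𝓡 3)

/-- The vector `a ∂ₜ + v` of `T_{(t,y)}(ℝ × Y) = ℝ ∂ₜ ⊕ T_y Y`. -/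
def cylVec (t : ℝ) (y : Y) (a : ℝ) (v : TangentSpace (𝓡 3) y) :
    TangentSpace IM ((t, y) : ℝ × Y) :=
  ((a, v) : ℝ × E3)

/-- The coordinate frame `∂ₜ, ∂₁, ∂₂, ∂₃` of the cylinder at the point with coordinates
`z = (t, x₁, x₂, x₃)`. -/
def cylFrame (e : OpenPartialHomeomorph Y E3) (z : Fin 4 → ℝ) (a : Fin 4) :
    TangentSpace IM ((z 0, pt e (Fin.tail z)) : ℝ × Y) :=
  Fin.cases (cylVec (z 0) (pt e (Fin.tail z)) 1 0)
    (fun i => cylVec (z 0) (pt e (Fin.tail z)) 0 (frame e (Fin.tail z) i)) a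

/-- Components of a `2`-tensor on `ℝ × Y` in the coordinates `(t, x₁, x₂, x₃)`. -/
def cylComp (e : OpenPartialHomeomorph Y E3)
    (T : ∀ p : ℝ × Y, TangentSpace IM p →L[ℝ] TangentSpace IM p →L[ℝ] ℝ)
    (z : Fin 4 → ℝ) : Matrix (Fin 4) (Fin 4) ℝ :=
  Matrix.of fun a b => T (z 0, pt e (Fin.tail z)) (cylFrame e z a) (cylFrame e z b)

variable [IsManifold (𝓡 3) ∞ Y]

/-- Smooth Riemannian metrics on `Y`. -/
abbrev MetricY (Y : Type*) [TopologicalSpace Y] [ChartedSpace E3 Y] [IsManifold (𝓡 3) ∞ Y] :=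
  Bundle.ContMDiffRiemannianMetric (𝓡 3) ∞ E3 (fun y : Y => TangentSpace (𝓡 3) y)

/-- Smooth Riemannian metrics on `ℝ × Y`. -/
abbrev MetricM (Y : Type*) [TopologicalSpace Y] [ChartedSpace E3 Y] [IsManifold (𝓡 3) ∞ Y] :=
  Bundle.ContMDiffRiemannianMetric IM ∞ (ℝ × E3) (fun p : ℝ × Y => TangentSpace IM p)

/-- `g` has constant sectional curvature `κ`:
`R_{ijkl} = κ (g_{ik} g_{jl} - g_{il} g_{jk})`. -/
def HasConstCurvature (g : MetricY Y) (κ : ℝ) : Prop :=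
  ∀ e ∈ atlas E3 Y, ∀ x ∈ chartDomain e, ∀ i j k l,
    riemann (compTwo e g.inner) x i j k l =
      κ * (compTwo e g.inner x i k * compTwo e g.inner x j l
        - compTwo e g.inner x i l * compTwo e g.inner x j k)

/-- `k s`, `s ∈ (-δ, δ)`, is a smooth path of metrics on `Y`: its components are jointly smooth in
the parameter and the coordinates. -/
def IsPathY (k : ℝ → MetricY Y) (δ : ℝ) : Prop :=
  0 < δ ∧ ∀ e ∈ atlas E3 Y, ∀ i j,
    ContDiffOn ℝ ∞ (fun q : ℝ × (Fin 3 → ℝ) => compTwo e (k q.1).inner q.2 i j)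
      (Set.Ioo (-δ) δ ×ˢ chartDomain e)

/-- `G s`, `s ∈ (-δ, δ)`, is a smooth path of metrics on `ℝ × Y`. -/
def IsPathM (G : ℝ → MetricM Y) (δ : ℝ) : Prop :=
  0 < δ ∧ ∀ e ∈ atlas E3 Y, ∀ a b,
    ContDiffOn ℝ ∞ (fun q : ℝ × (Fin 4 → ℝ) => cylComp e (G q.1).inner q.2 a b)
      (Set.Ioo (-δ) δ ×ˢ {z : Fin 4 → ℝ | Fin.tail (α := fun _ => ℝ) z ∈ chartDomain e})

/-- `G` is the product metric `dt² + g`. -/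
def IsProductMetric (G : MetricM Y) (g : MetricY Y) : Prop :=
  ∀ (t : ℝ) (y : Y) (a b : ℝ) (v w : TangentSpace (𝓡 3) y),
    G.inner (t, y) (cylVec t y a v) (cylVec t y b w) = a * b + g.inner y v w

/-- The value of `{h₀₀, α, h} = h₀₀ dt ⊗ dt + (α ⊗ dt + dt ⊗ α) + h` at a point of the cylinder on
the pair `(a ∂ₜ + v, b ∂ₜ + w)`. -/
def cylForm {y : Y} (h00 : ℝ) (α : TangentSpace (𝓡 3) y →L[ℝ] ℝ)
    (h : TangentSpace (𝓡 3) y →L[ℝ] TangentSpace (𝓡 3) y →L[ℝ] ℝ)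
    (a : ℝ) (v : TangentSpace (𝓡 3) y) (b : ℝ) (w : TangentSpace (𝓡 3) y) : ℝ :=
  h00 * a * b + (α v * b + a * α w) + h v w

end Manifold

end Cyl

end

/-!
# The linearized anti-self-dual Weyl tensor of a cylinder

Let `g` have constant curvature `κ` on a three-dimensional domain. The curvature of `dt² + g` is
`(κ/2) (g ⊚ g)`, with `g` extended by zero in the `t` direction and `⊚` the Kulkarni–Nomizu product,
and the Weyl tensor of `dt² + g` vanishes (`MetricOn.cyl_weyl`). Therefore the variation of
`W⁻ = π₋ W π₋` does not see the variation of the projections, which depend on the metric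
(`hasDerivAt_asdProjBoth`), and since the forms `dt ∧ v♭ - *v♭` are anti-self-dual, the two remaining
projections drop out of the pairing with them (`asdComponents_asdProjBoth`). What has to be computed
is the restriction to anti-self-dual forms of the variation `W'` of the full Weyl tensor.

`W'` is the variation of the curvature tensor minus Kulkarni–Nomizu products in which one factor is
the background metric or `dt²`. On anti-self-dual forms a product `k ⊚ (dt² + g)` acts through the
trace of `k` only (`asdComponents_kulkarniNomizu_metric`), and `dt² ⊚ k` acts through `k` itself
(`asdComponents_kulkarniNomizu_dt`). So, apart from multiples of `g` and of `κ h`, everything comes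
from the variation of the curvature tensor, a combination of second covariant derivatives of the
direction (`MetricFamily.hasDerivAt_riemann`). On the cylinder it has three kinds of components:

* two time indices (`MetricOn.cylRiemannVariation_time`): these contribute the symmetrized `∇α̇`,
  the Hessian of `h₀₀` and `ḧ`;
* one time index (`MetricOn.cylRiemannVariation_mixed`): by the Ricci identity and the Bianchi
  identity these are `∇dα` and the antisymmetrized `∇ḣ`, which the contraction with the parallel
  volume form turns into `∇(*dα)` and the Dirac-type operator of `ḣ`;
* no time index (`MetricOn.cylRiemannVariation_spatial`): this is the variation of the curvature of
  `g` in the direction `h`. In dimension three a curvature tensor is determined by its Ricci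
  contraction (`eps_eps_curv`), so its contribution is minus the variation of the Ricci tensor, up
  to terms in `g` and `κ h`.

The multiples of `g` combine to the trace-free parts in the formula, because `*dα` is divergence free
(`MetricOn.tr_covOne_starD`) and the direction is traceless; the sum is
`MetricOn.asdComponents_weylVariation_eq`. The form with the rough Laplacian follows from the
expression for the linearized traceless Ricci tensor that one gets by commuting covariant derivatives
in constant curvature (`MetricOn.linTracelessRicci_eq_laplacian`).

The computation takes place in coordinates. The manifold enters only through the components of
tensors in a chart, which are smooth and, for a metric, positive definite.
-/

noncomputable section

namespace Cyl

/-! ### Partial derivatives of smooth functions -/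

section Calculus

variable {n : ℕ}

theorem differentiableAt_of_smooth {E : Type*} [NormedAddCommGroup E] [NormedSpace ℝ E]
    {f : E → ℝ} {U : Set E} {x : E} (hf : ContDiffOn ℝ ∞ f U) (hU : IsOpen U) (hx : x ∈ U) :
    DifferentiableAt ℝ f x :=
  (hf.contDiffAt (hU.mem_nhds hx)).differentiableAt (by simp)

theorem contDiffOn_fderiv_apply {E : Type*} [NormedAddCommGroup E] [NormedSpace ℝ E]
    {f : E → ℝ} {U : Set E} (hf : ContDiffOn ℝ ∞ f U) (hU : IsOpen U) (v : E) :
    ContDiffOn ℝ ∞ (fun y => fderiv ℝ f y v) U :=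
  (hf.fderiv_of_isOpen hU (m := ∞) (by simp)).clm_apply contDiffOn_const

/-- Directional derivatives of a smooth function commute. -/
theorem fderiv_fderiv_comm {E : Type*} [NormedAddCommGroup E] [NormedSpace ℝ E]
    {f : E → ℝ} {U : Set E} {x : E} (hf : ContDiffOn ℝ ∞ f U) (hU : IsOpen U) (hx : x ∈ U)
    (v w : E) :
    fderiv ℝ (fun y => fderiv ℝ f y v) x w = fderiv ℝ (fun y => fderiv ℝ f y w) x v := by
  have h2 : DifferentiableAt ℝ (fderiv ℝ f) x :=
    ((hf.fderiv_of_isOpen hU (m := ∞) (by simp)).contDiffAt (hU.mem_nhds hx)).differentiableAt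
      (by simp)
  have hs : IsSymmSndFDerivAt ℝ f x :=
    (hf.contDiffAt (hU.mem_nhds hx)).isSymmSndFDerivAt (by
      simp only [minSmoothness_of_isRCLikeNormedField]
      exact WithTop.coe_le_coe.2 (le_top : (2 : ℕ∞) ≤ ⊤))
  rw [fderiv_clm_apply h2 (differentiableAt_const v), fderiv_clm_apply h2
    (differentiableAt_const w)]
  simpa using hs.eq w v

theorem pd_smooth {f : (Fin n → ℝ) → ℝ} {U : Set (Fin n → ℝ)} (hf : ContDiffOn ℝ ∞ f U)
    (hU : IsOpen U) (i : Fin n) : ContDiffOn ℝ ∞ (pd i f) U :=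
  contDiffOn_fderiv_apply hf hU _

theorem pd_comm {f : (Fin n → ℝ) → ℝ} {U : Set (Fin n → ℝ)} {x : Fin n → ℝ}
    (hf : ContDiffOn ℝ ∞ f U) (hU : IsOpen U) (hx : x ∈ U) (i j : Fin n) :
    pd i (fun y => pd j f y) x = pd j (fun y => pd i f y) x :=
  fderiv_fderiv_comm hf hU hx _ _

theorem pd_congr {f f' : (Fin n → ℝ) → ℝ} {U : Set (Fin n → ℝ)} {x : Fin n → ℝ}
    (hU : IsOpen U) (hx : x ∈ U) (h : ∀ y ∈ U, f y = f' y) (i : Fin n) :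
    pd i f x = pd i f' x := by
  have : f =ᶠ[𝓝 x] f' := by filter_upwards [hU.mem_nhds hx] with y hy using h y hy
  rw [pd, pd, this.fderiv_eq]

theorem pd_add {f f' : (Fin n → ℝ) → ℝ} {x : Fin n → ℝ} (hf : DifferentiableAt ℝ f x)
    (hf' : DifferentiableAt ℝ f' x) (i : Fin n) :
    pd i (fun y => f y + f' y) x = pd i f x + pd i f' x := by
  simp [pd, fderiv_fun_add hf hf']

theorem pd_sub {f f' : (Fin n → ℝ) → ℝ} {x : Fin n → ℝ} (hf : DifferentiableAt ℝ f x)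
    (hf' : DifferentiableAt ℝ f' x) (i : Fin n) :
    pd i (fun y => f y - f' y) x = pd i f x - pd i f' x := by
  simp [pd, fderiv_fun_sub hf hf']

theorem pd_mul {f f' : (Fin n → ℝ) → ℝ} {x : Fin n → ℝ} (hf : DifferentiableAt ℝ f x)
    (hf' : DifferentiableAt ℝ f' x) (i : Fin n) :
    pd i (fun y => f y * f' y) x = pd i f x * f' x + f x * pd i f' x := by
  simp [pd, fderiv_fun_mul hf hf']; ring

theorem pd_const (c : ℝ) (i : Fin n) (x : Fin n → ℝ) : pd i (fun _ => c) x = 0 := by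
  simp [pd]

theorem pd_const_mul {f : (Fin n → ℝ) → ℝ} {x : Fin n → ℝ} (c : ℝ)
    (hf : DifferentiableAt ℝ f x) (i : Fin n) :
    pd i (fun y => c * f y) x = c * pd i f x := by
  rw [pd_mul (differentiableAt_const c) hf, pd_const]; ring

theorem pd_sum {ι : Type*} {s : Finset ι} {f : ι → (Fin n → ℝ) → ℝ} {x : Fin n → ℝ}
    (hf : ∀ a ∈ s, DifferentiableAt ℝ (f a) x) (i : Fin n) :
    pd i (fun y => ∑ a ∈ s, f a y) x = ∑ a ∈ s, pd i (f a) x := by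
  simp [pd, fderiv_fun_sum hf]

/-! ### Smooth one-parameter families -/

variable {Ω : Set (ℝ × (Fin n → ℝ))}

/-- The slice at parameter `s` of a set of pairs (parameter, point). -/
def slice (Ω : Set (ℝ × (Fin n → ℝ))) (s : ℝ) : Set (Fin n → ℝ) := {y | (s, y) ∈ Ω}

theorem isOpen_slice (hΩ : IsOpen Ω) (s : ℝ) : IsOpen (slice Ω s) :=
  hΩ.preimage (by fun_prop)

theorem smooth_slice {F : ℝ → (Fin n → ℝ) → ℝ}
    (hF : ContDiffOn ℝ ∞ (fun q : ℝ × (Fin n → ℝ) => F q.1 q.2) Ω) (s : ℝ) :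
    ContDiffOn ℝ ∞ (F s) (slice Ω s) :=
  hF.comp (f := fun y : Fin n → ℝ => (s, y)) (by fun_prop) (fun _ hy => hy)

theorem pd_eq_fderiv_family {F : ℝ → (Fin n → ℝ) → ℝ}
    (hF : ContDiffOn ℝ ∞ (fun q : ℝ × (Fin n → ℝ) => F q.1 q.2) Ω) (hΩ : IsOpen Ω)
    {q : ℝ × (Fin n → ℝ)} (hq : q ∈ Ω) (i : Fin n) :
    pd i (F q.1) q.2
      = fderiv ℝ (fun q : ℝ × (Fin n → ℝ) => F q.1 q.2) q (0, Pi.single i 1) := by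
  have h := (differentiableAt_of_smooth hF hΩ hq).hasFDerivAt.comp q.2
    ((hasFDerivAt_const q.1 q.2).prodMk (hasFDerivAt_id (𝕜 := ℝ) q.2))
  have h' : HasFDerivAt (F q.1) _ q.2 := h
  rw [pd, h'.fderiv]
  simp

theorem smooth_pd_family {F : ℝ → (Fin n → ℝ) → ℝ}
    (hF : ContDiffOn ℝ ∞ (fun q : ℝ × (Fin n → ℝ) => F q.1 q.2) Ω) (hΩ : IsOpen Ω)
    (i : Fin n) :
    ContDiffOn ℝ ∞ (fun q : ℝ × (Fin n → ℝ) => pd i (F q.1) q.2) Ω :=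
  (contDiffOn_fderiv_apply hF hΩ (0, Pi.single i 1)).congr
    fun _ hq => pd_eq_fderiv_family hF hΩ hq i

/-- The velocity at parameter `0` of a one-parameter family of functions. -/
def vel (F : ℝ → (Fin n → ℝ) → ℝ) (y : Fin n → ℝ) : ℝ := deriv (fun s => F s y) 0

theorem hasDerivAt_family {F : ℝ → (Fin n → ℝ) → ℝ}
    (hF : ContDiffOn ℝ ∞ (fun q : ℝ × (Fin n → ℝ) => F q.1 q.2) Ω) (hΩ : IsOpen Ω)
    {q : ℝ × (Fin n → ℝ)} (hq : q ∈ Ω) :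
    HasDerivAt (fun s => F s q.2)
      (fderiv ℝ (fun q : ℝ × (Fin n → ℝ) => F q.1 q.2) q (1, 0)) q.1 := by
  have h := (differentiableAt_of_smooth hF hΩ hq).hasFDerivAt.comp_hasDerivAt q.1
    ((hasDerivAt_id q.1).prodMk (hasDerivAt_const q.1 q.2))
  exact h

theorem hasDerivAt_vel {F : ℝ → (Fin n → ℝ) → ℝ}
    (hF : ContDiffOn ℝ ∞ (fun q : ℝ × (Fin n → ℝ) => F q.1 q.2) Ω) (hΩ : IsOpen Ω)
    {y : Fin n → ℝ} (hy : y ∈ slice Ω 0) :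
    HasDerivAt (fun s => F s y) (vel F y) 0 :=
  (hasDerivAt_family hF hΩ (q := (0, y)) hy).differentiableAt.hasDerivAt

theorem vel_eq_fderiv {F : ℝ → (Fin n → ℝ) → ℝ}
    (hF : ContDiffOn ℝ ∞ (fun q : ℝ × (Fin n → ℝ) => F q.1 q.2) Ω) (hΩ : IsOpen Ω)
    {y : Fin n → ℝ} (hy : y ∈ slice Ω 0) :
    vel F y = fderiv ℝ (fun q : ℝ × (Fin n → ℝ) => F q.1 q.2) (0, y) (1, 0) :=
  (hasDerivAt_family hF hΩ (q := (0, y)) hy).deriv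

theorem smooth_vel {F : ℝ → (Fin n → ℝ) → ℝ}
    (hF : ContDiffOn ℝ ∞ (fun q : ℝ × (Fin n → ℝ) => F q.1 q.2) Ω) (hΩ : IsOpen Ω) :
    ContDiffOn ℝ ∞ (vel F) (slice Ω 0) :=
  (smooth_slice (F := fun s y => fderiv ℝ (fun q : ℝ × (Fin n → ℝ) => F q.1 q.2) (s, y) (1, 0))
    (contDiffOn_fderiv_apply hF hΩ (1, 0)) 0).congr fun _ hy => vel_eq_fderiv hF hΩ hy

/-- Differentiation in the parameter commutes with partial derivatives. -/
theorem hasDerivAt_pd_family {F : ℝ → (Fin n → ℝ) → ℝ}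
    (hF : ContDiffOn ℝ ∞ (fun q : ℝ × (Fin n → ℝ) => F q.1 q.2) Ω) (hΩ : IsOpen Ω)
    {y : Fin n → ℝ} (hy : y ∈ slice Ω 0) (i : Fin n) :
    HasDerivAt (fun s => pd i (F s) y) (pd i (vel F) y) 0 := by
  have hV := contDiffOn_fderiv_apply hF hΩ (1, 0)
  have h1 := hasDerivAt_family (F := fun s => pd i (F s)) (smooth_pd_family hF hΩ i) hΩ (q := (0, y)) hy
  have h2 : fderiv ℝ (fun q : ℝ × (Fin n → ℝ) => pd i (F q.1) q.2) (0, y) (1, 0)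
      = pd i (vel F) y := by
    have e1 : (fun q : ℝ × (Fin n → ℝ) => pd i (F q.1) q.2) =ᶠ[𝓝 (0, y)] fun q =>
        fderiv ℝ (fun q : ℝ × (Fin n → ℝ) => F q.1 q.2) q (0, Pi.single i 1) := by
      filter_upwards [hΩ.mem_nhds hy] with q hq using pd_eq_fderiv_family hF hΩ hq i
    rw [e1.fderiv_eq, fderiv_fderiv_comm hF hΩ hy]
    rw [pd_congr (isOpen_slice hΩ 0) hy (fun z hz => vel_eq_fderiv hF hΩ hz) i]
    exact (pd_eq_fderiv_family
      (F := fun s y => fderiv ℝ (fun q : ℝ × (Fin n → ℝ) => F q.1 q.2) (s, y) (1, 0))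
      hV hΩ (q := (0, y)) hy i).symm
  rw [← h2]
  exact h1

end Calculus

/-! ### Christoffel symbols and the curvature tensor of a metric in coordinates -/

section Metric

variable {n : ℕ}

theorem smooth_det {E : Type*} [NormedAddCommGroup E] [NormedSpace ℝ E]
    {M : E → Matrix (Fin n) (Fin n) ℝ} {U : Set E}
    (hM : ∀ i j, ContDiffOn ℝ ∞ (fun q => M q i j) U) :
    ContDiffOn ℝ ∞ (fun q => (M q).det) U := by
  simp only [Matrix.det_apply]
  refine ContDiffOn.sum fun σ _ => ContDiffOn.const_smul _ ?_
  exact contDiffOn_prod fun i _ => hM _ _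

theorem smooth_inv {E : Type*} [NormedAddCommGroup E] [NormedSpace ℝ E]
    {M : E → Matrix (Fin n) (Fin n) ℝ} {U : Set E}
    (hM : ∀ i j, ContDiffOn ℝ ∞ (fun q => M q i j) U) (hdet : ∀ q ∈ U, (M q).det ≠ 0)
    (i j : Fin n) : ContDiffOn ℝ ∞ (fun q => (M q)⁻¹ i j) U := by
  simp only [Matrix.inv_def, Matrix.smul_apply, smul_eq_mul, Ring.inverse_eq_inv',
    Matrix.adjugate_apply]
  refine ((smooth_det hM).inv hdet).mul (smooth_det fun k l => ?_)
  by_cases h : k = j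
  · subst h
    simpa using contDiffOn_const
  · simpa [Matrix.updateRow_ne h] using hM k l

/-- A metric on the open set `U` in coordinates: a smooth, symmetric and nondegenerate matrix-valued
function. Definiteness plays no role in the calculus and is not required. -/
structure MetricOn (U : Set (Fin n → ℝ)) (g : (Fin n → ℝ) → Matrix (Fin n) (Fin n) ℝ) :
    Prop where
  isOpen : IsOpen U
  smooth : ∀ i j, ContDiffOn ℝ ∞ (fun y => g y i j) U
  symm : ∀ y ∈ U, ∀ i j, g y i j = g y j i
  det_ne : ∀ y ∈ U, (g y).det ≠ 0

/-- A one-parameter family of metrics `g s`, jointly smooth on the open set `Ω` of pairs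
(parameter, point). The set of points at which `g s` is defined may depend on `s`. -/
structure MetricFamily (Ω : Set (ℝ × (Fin n → ℝ)))
    (g : ℝ → (Fin n → ℝ) → Matrix (Fin n) (Fin n) ℝ) : Prop where
  isOpen : IsOpen Ω
  smooth : ∀ i j, ContDiffOn ℝ ∞ (fun q : ℝ × (Fin n → ℝ) => g q.1 q.2 i j) Ω
  symm : ∀ q ∈ Ω, ∀ i j, g q.1 q.2 i j = g q.1 q.2 j i
  det_ne : ∀ q ∈ Ω, (g q.1 q.2).det ≠ 0

theorem MetricFamily.metricOn {Ω : Set (ℝ × (Fin n → ℝ))}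
    {g : ℝ → (Fin n → ℝ) → Matrix (Fin n) (Fin n) ℝ} (hg : MetricFamily Ω g) (s : ℝ) :
    MetricOn (slice Ω s) (g s) where
  isOpen := isOpen_slice hg.isOpen s
  smooth i j := smooth_slice (F := fun s y => g s y i j) (hg.smooth i j) s
  symm y hy := hg.symm (s, y) hy
  det_ne y hy := hg.det_ne (s, y) hy

variable {U : Set (Fin n → ℝ)} {g h : (Fin n → ℝ) → Matrix (Fin n) (Fin n) ℝ} {x : Fin n → ℝ}

theorem MetricOn.sum_mul_inv (hg : MetricOn U g) (hx : x ∈ U) (i j : Fin n) :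
    ∑ k, g x i k * (g x)⁻¹ k j = if i = j then 1 else 0 := by
  rw [← Matrix.mul_apply, Matrix.mul_nonsing_inv _ (isUnit_iff_ne_zero.2 (hg.det_ne x hx)),
    Matrix.one_apply]

theorem MetricOn.inv_symm (hg : MetricOn U g) (hx : x ∈ U) (i j : Fin n) :
    (g x)⁻¹ i j = (g x)⁻¹ j i := by
  have : (g x).transpose = g x := Matrix.ext fun i j => hg.symm x hx j i
  conv_lhs => rw [← this, ← Matrix.transpose_nonsing_inv, Matrix.transpose_apply]

theorem MetricOn.sum_inv_mul (hg : MetricOn U g) (hx : x ∈ U) (i j : Fin n) :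
    ∑ k, (g x)⁻¹ i k * g x k j = if i = j then 1 else 0 := by
  rw [← Matrix.mul_apply, Matrix.nonsing_inv_mul _ (isUnit_iff_ne_zero.2 (hg.det_ne x hx)),
    Matrix.one_apply]

theorem MetricOn.differentiableAt (hg : MetricOn U g) (hx : x ∈ U) (i j : Fin n) :
    DifferentiableAt ℝ (fun y => g y i j) x :=
  differentiableAt_of_smooth (hg.smooth i j) hg.isOpen hx

theorem MetricOn.christoffel_smooth (hg : MetricOn U g) (k i j : Fin n) :
    ContDiffOn ℝ ∞ (fun y => christoffel g y k i j) U := by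
  unfold christoffel
  have hp := fun a i j => pd_smooth (hg.smooth i j) hg.isOpen a
  exact contDiffOn_const.mul (ContDiffOn.sum fun l _ =>
    (smooth_inv hg.smooth hg.det_ne k l).mul (((hp _ _ _).add (hp _ _ _)).sub (hp _ _ _)))

theorem MetricFamily.christoffel_smooth {Ω : Set (ℝ × (Fin n → ℝ))}
    {g : ℝ → (Fin n → ℝ) → Matrix (Fin n) (Fin n) ℝ} (hg : MetricFamily Ω g) (k i j : Fin n) :
    ContDiffOn ℝ ∞ (fun q : ℝ × (Fin n → ℝ) => christoffel (g q.1) q.2 k i j) Ω := by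
  unfold christoffel
  have hp := fun a i j =>
    smooth_pd_family (F := fun s y => g s y i j) (hg.smooth i j) hg.isOpen a
  exact contDiffOn_const.mul (ContDiffOn.sum fun l _ =>
    (smooth_inv hg.smooth hg.det_ne k l).mul (((hp _ _ _).add (hp _ _ _)).sub (hp _ _ _)))

theorem MetricOn.pd_symm (hg : MetricOn U g) (hx : x ∈ U) (k i j : Fin n) :
    pd k (fun y => g y i j) x = pd k (fun y => g y j i) x :=
  pd_congr hg.isOpen hx (fun y hy => hg.symm y hy i j) k

theorem MetricOn.christoffel_symm (hg : MetricOn U g) (hx : x ∈ U) (k i j : Fin n) :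
    christoffel g x k i j = christoffel g x k j i := by
  unfold christoffel
  congr 1
  refine Finset.sum_congr rfl fun l _ => ?_
  rw [hg.pd_symm hx l i j]; ring

/-- The Christoffel symbols of the first kind. -/
theorem MetricOn.lower_christoffel (hg : MetricOn U g) (hx : x ∈ U) (e i j : Fin n) :
    ∑ k, g x e k * christoffel g x k i j
      = (1 / 2) * (pd i (fun y => g y j e) x + pd j (fun y => g y i e) x
          - pd e (fun y => g y i j) x) := by
  unfold christoffel
  simp only [Finset.mul_sum]
  rw [Finset.sum_comm]
  have : ∀ l, ∑ k, g x e k * (1 / 2 * ((g x)⁻¹ k l * (pd i (fun y => g y j l) x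
      + pd j (fun y => g y i l) x - pd l (fun y => g y i j) x)))
      = (∑ k, g x e k * (g x)⁻¹ k l) * ((1 / 2) * (pd i (fun y => g y j l) x
      + pd j (fun y => g y i l) x - pd l (fun y => g y i j) x)) := by
    intro l
    rw [Finset.sum_mul]
    exact Finset.sum_congr rfl fun k _ => by ring
  simp only [this, hg.sum_mul_inv hx, ite_mul, one_mul, zero_mul, Finset.sum_ite_eq,
    Finset.mem_univ, if_true]

/-- The Levi-Civita connection is metric. -/
theorem MetricOn.pd_metric (hg : MetricOn U g) (hx : x ∈ U) (k i j : Fin n) :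
    pd k (fun y => g y i j) x
      = ∑ m, (christoffel g x m k i * g x m j + christoffel g x m k j * g x i m) := by
  have h1 := hg.lower_christoffel hx j k i
  have h2 := hg.lower_christoffel hx i k j
  have e1 : ∑ m, christoffel g x m k i * g x m j = ∑ m, g x j m * christoffel g x m k i :=
    Finset.sum_congr rfl fun m _ => by rw [hg.symm x hx m j]; ring
  have e2 : ∑ m, christoffel g x m k j * g x i m = ∑ m, g x i m * christoffel g x m k j :=
    Finset.sum_congr rfl fun m _ => by ring
  rw [Finset.sum_add_distrib, e1, e2, h1, h2, hg.pd_symm hx i k j, hg.pd_symm hx k j i]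
  ring

/-- Covariant differentiation of a vector field commutes with lowering its index. -/
theorem MetricOn.lower_cov (hg : MetricOn U g) (hx : x ∈ U) {V : (Fin n → ℝ) → Fin n → ℝ}
    (hV : ∀ a, ContDiffOn ℝ ∞ (fun y => V y a) U) (c e : Fin n) :
    ∑ a, g x e a * (pd c (fun y => V y a) x + ∑ f, christoffel g x a c f * V x f)
      = pd c (fun y => ∑ a, g y e a * V y a) x
        - ∑ m, christoffel g x m c e * ∑ a, g x m a * V x a := by
  have dV : ∀ a, DifferentiableAt ℝ (fun y => V y a) x :=
    fun a => differentiableAt_of_smooth (hV a) hg.isOpen hx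
  rw [pd_sum (fun a _ => (hg.differentiableAt hx e a).fun_mul (dV a))]
  have e1 : ∀ a, pd c (fun y => g y e a * V y a) x
      = (∑ m, christoffel g x m c e * g x m a) * V x a
        + (∑ m, christoffel g x m c a * g x e m) * V x a
        + g x e a * pd c (fun y => V y a) x := by
    intro a
    rw [pd_mul (hg.differentiableAt hx e a) (dV a), hg.pd_metric hx c e a,
      Finset.sum_add_distrib]
    ring
  simp only [e1, Finset.sum_add_distrib, mul_add, Finset.mul_sum, Finset.sum_mul]
  have s1 : ∑ a, ∑ m, christoffel g x m c e * g x m a * V x a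
      = ∑ m, ∑ a, christoffel g x m c e * (g x m a * V x a) := by
    rw [Finset.sum_comm]
    exact Finset.sum_congr rfl fun _ _ => Finset.sum_congr rfl fun _ _ => by ring
  have s2 : ∑ a, ∑ m, christoffel g x m c a * g x e m * V x a
      = ∑ a, ∑ f, g x e a * (christoffel g x a c f * V x f) := by
    rw [Finset.sum_comm]
    exact Finset.sum_congr rfl fun _ _ => Finset.sum_congr rfl fun _ _ => by ring
  rw [s1, s2]
  ring

theorem riemannUp_antisymm (a b c d : Fin n) :
    riemannUp g x a b c d = -riemannUp g x a b d c := by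
  unfold riemannUp
  rw [Finset.sum_sub_distrib, Finset.sum_sub_distrib]
  ring

theorem riemann_antisymm_right (a b c d : Fin n) :
    riemann g x a b c d = -riemann g x a b d c := by
  unfold riemann
  rw [← Finset.sum_neg_distrib]
  exact Finset.sum_congr rfl fun e _ => by rw [riemannUp_antisymm]; ring

/-- The first Bianchi identity. -/
theorem MetricOn.bianchi (hg : MetricOn U g) (hx : x ∈ U) (a b c d : Fin n) :
    riemannUp g x a b c d + riemannUp g x a c d b + riemannUp g x a d b c = 0 := by
  have hp : ∀ p i j k, pd p (fun y => christoffel g y k i j) x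
      = pd p (fun y => christoffel g y k j i) x :=
    fun p i j k => pd_congr hg.isOpen hx (fun y hy => hg.christoffel_symm hy k i j) p
  unfold riemannUp
  simp only [Finset.sum_sub_distrib]
  simp only [hg.christoffel_symm hx _ d b, hg.christoffel_symm hx _ c b,
    hg.christoffel_symm hx _ d c, hp c d b, hp d c b, hp b d c]
  ring

/-- The lowered curvature tensor in terms of second derivatives of the metric. -/
theorem MetricOn.riemann_eq (hg : MetricOn U g) (hx : x ∈ U) (e b c d : Fin n) :
    riemann g x e b c d
      = (1 / 2) * (pd c (fun y => pd b (fun z => g z d e) y) x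
          - pd c (fun y => pd e (fun z => g z d b) y) x
          - pd d (fun y => pd b (fun z => g z c e) y) x
          + pd d (fun y => pd e (fun z => g z c b) y) x)
        + ∑ m, (christoffel g x m d e * ∑ a, g x m a * christoffel g x a c b
          - christoffel g x m c e * ∑ a, g x m a * christoffel g x a d b) := by
  have key : ∀ c d, ∑ a, g x e a * (pd c (fun y => christoffel g y a d b) x
        + ∑ f, christoffel g x a c f * christoffel g x f d b)
      = (1 / 2) * (pd c (fun y => pd d (fun z => g z b e) y) x
          + pd c (fun y => pd b (fun z => g z d e) y) x
          - pd c (fun y => pd e (fun z => g z d b) y) x)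
        - ∑ m, christoffel g x m c e * ∑ a, g x m a * christoffel g x a d b := by
    intro c d
    rw [hg.lower_cov hx (V := fun y a => christoffel g y a d b)
      (fun a => hg.christoffel_smooth a d b) c e]
    congr 1
    rw [pd_congr hg.isOpen hx (fun y hy => hg.lower_christoffel hy e d b) c]
    have hp : ∀ a i j, DifferentiableAt ℝ (fun y => pd a (fun z => g z i j) y) x :=
      fun a i j => differentiableAt_of_smooth
        (pd_smooth (hg.smooth i j) hg.isOpen a) hg.isOpen hx
    rw [pd_const_mul _ (((hp _ _ _).fun_add (hp _ _ _)).fun_sub (hp _ _ _)),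
      pd_sub ((hp _ _ _).fun_add (hp _ _ _)) (hp _ _ _), pd_add (hp _ _ _) (hp _ _ _)]
  have hR : riemann g x e b c d
      = ∑ a, g x e a * (pd c (fun y => christoffel g y a d b) x
          + ∑ f, christoffel g x a c f * christoffel g x f d b)
        - ∑ a, g x e a * (pd d (fun y => christoffel g y a c b) x
          + ∑ f, christoffel g x a d f * christoffel g x f c b) := by
    unfold riemann riemannUp
    rw [← Finset.sum_sub_distrib]
    refine Finset.sum_congr rfl fun a _ => ?_
    rw [Finset.sum_sub_distrib]; ring
  rw [hR, key, key, Finset.sum_sub_distrib, pd_comm (hg.smooth b e) hg.isOpen hx c d]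
  ring

theorem MetricOn.riemann_antisymm_left (hg : MetricOn U g) (hx : x ∈ U) (a b c d : Fin n) :
    riemann g x a b c d = -riemann g x b a c d := by
  have hq : ∀ p q r s, ∑ m, christoffel g x m p q * ∑ f, g x m f * christoffel g x f r s
      = ∑ m, christoffel g x m r s * ∑ f, g x m f * christoffel g x f p q := by
    intro p q r s
    simp only [Finset.mul_sum]
    rw [Finset.sum_comm]
    exact Finset.sum_congr rfl fun _ _ => Finset.sum_congr rfl fun _ _ => by
      rw [hg.symm x hx]; ring
  rw [hg.riemann_eq hx, hg.riemann_eq hx, Finset.sum_sub_distrib, Finset.sum_sub_distrib,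
    hq d a c b, hq c a d b]
  ring

theorem MetricOn.riemann_pair_symm (hg : MetricOn U g) (hx : x ∈ U) (a b c d : Fin n) :
    riemann g x a b c d = riemann g x c d a b := by
  have hs : ∀ p q i j, pd p (fun y => pd q (fun z => g z i j) y) x
      = pd p (fun y => pd q (fun z => g z j i) y) x :=
    fun p q i j => pd_congr hg.isOpen hx (fun y hy => hg.pd_symm hy q i j) p
  have hq : ∀ p q r s, ∑ m, christoffel g x m p q * ∑ f, g x m f * christoffel g x f r s
      = ∑ m, christoffel g x m r s * ∑ f, g x m f * christoffel g x f p q := by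
    intro p q r s
    simp only [Finset.mul_sum]
    rw [Finset.sum_comm]
    exact Finset.sum_congr rfl fun _ _ => Finset.sum_congr rfl fun _ _ => by
      rw [hg.symm x hx]; ring
  rw [hg.riemann_eq hx, hg.riemann_eq hx, Finset.sum_sub_distrib, Finset.sum_sub_distrib,
    hq b c a d, pd_comm (hg.smooth d a) hg.isOpen hx c b, pd_comm (hg.smooth d b) hg.isOpen hx c a,
    pd_comm (hg.smooth c a) hg.isOpen hx d b, pd_comm (hg.smooth c b) hg.isOpen hx d a]
  simp only [hg.christoffel_symm hx _ d a, hg.christoffel_symm hx _ c b,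
    hg.christoffel_symm hx _ c a, hg.christoffel_symm hx _ d b, hs _ _ d a, hs _ _ d b,
    hs _ _ c a, hs _ _ c b]
  ring

end Metric

/-! ### First variation of the curvature -/

section Variation

variable {n : ℕ} {Ω : Set (ℝ × (Fin n → ℝ))}
  {G : ℝ → (Fin n → ℝ) → Matrix (Fin n) (Fin n) ℝ} {x : Fin n → ℝ}

/-- The velocity at `s = 0` of a path `G s` of matrix-valued functions. -/
def velocity (G : ℝ → (Fin n → ℝ) → Matrix (Fin n) (Fin n) ℝ) (y : Fin n → ℝ) :
    Matrix (Fin n) (Fin n) ℝ :=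
  Matrix.of fun i j => vel (fun s z => G s z i j) y

/-- The variation `C^k_{ij}` of the Christoffel symbols along a path of metrics. -/
def velChristoffel (G : ℝ → (Fin n → ℝ) → Matrix (Fin n) (Fin n) ℝ) (y : Fin n → ℝ)
    (k i j : Fin n) : ℝ :=
  vel (fun s z => christoffel (G s) z k i j) y

/-- The variation of `Rᵃ_{bcd}` along a path of metrics. -/
def velRiemannUp (G : ℝ → (Fin n → ℝ) → Matrix (Fin n) (Fin n) ℝ) (x : Fin n → ℝ)
    (a b c d : Fin n) : ℝ :=
  pd c (fun y => velChristoffel G y a d b) x - pd d (fun y => velChristoffel G y a c b) x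
    + ∑ f, (velChristoffel G x a c f * christoffel (G 0) x f d b
        + christoffel (G 0) x a c f * velChristoffel G x f d b
        - (velChristoffel G x a d f * christoffel (G 0) x f c b
        + christoffel (G 0) x a d f * velChristoffel G x f c b))

/-- The variation `½ (∇_k h_{ie} + ∇_i h_{ke} - ∇_e h_{ki})` of the connection in the direction
`h`, with all indices lowered. -/
def lowerConnVariation (g h : (Fin n → ℝ) → Matrix (Fin n) (Fin n) ℝ) (x : Fin n → ℝ)
    (e k i : Fin n) : ℝ :=
  (1 / 2) * (covTwo g h x k i e + covTwo g h x i k e - covTwo g h x e k i)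

theorem MetricFamily.eventually_mem (hG : MetricFamily Ω G) (hx : x ∈ slice Ω 0) :
    ∀ᶠ s in 𝓝 (0 : ℝ), x ∈ slice Ω s := by
  have h : Filter.Tendsto (fun s : ℝ => (s, x)) (𝓝 0) (𝓝 (0, x)) :=
    Continuous.tendsto (by fun_prop) _
  exact h (hG.isOpen.mem_nhds hx)

theorem MetricFamily.hasDerivAt (hG : MetricFamily Ω G) (hx : x ∈ slice Ω 0) (i j : Fin n) :
    HasDerivAt (fun s => G s x i j) (velocity G x i j) 0 :=
  hasDerivAt_vel (F := fun s z => G s z i j) (hG.smooth i j) hG.isOpen hx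

theorem MetricFamily.velocity_smooth (hG : MetricFamily Ω G) (i j : Fin n) :
    ContDiffOn ℝ ∞ (fun y => velocity G y i j) (slice Ω 0) :=
  smooth_vel (F := fun s z => G s z i j) (hG.smooth i j) hG.isOpen

theorem MetricFamily.velocity_symm (hG : MetricFamily Ω G) (hx : x ∈ slice Ω 0) (i j : Fin n) :
    velocity G x i j = velocity G x j i := by
  refine (hG.hasDerivAt hx i j).unique ((hG.hasDerivAt hx j i).congr_of_eventuallyEq ?_)
  filter_upwards [hG.eventually_mem hx] with s hs using hG.symm (s, x) hs i j

theorem MetricFamily.velChristoffel_smooth (hG : MetricFamily Ω G) (k i j : Fin n) :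
    ContDiffOn ℝ ∞ (fun y => velChristoffel G y k i j) (slice Ω 0) :=
  smooth_vel (F := fun s z => christoffel (G s) z k i j) (hG.christoffel_smooth k i j) hG.isOpen

theorem MetricFamily.hasDerivAt_christoffel (hG : MetricFamily Ω G) (hx : x ∈ slice Ω 0)
    (k i j : Fin n) :
    HasDerivAt (fun s => christoffel (G s) x k i j) (velChristoffel G x k i j) 0 :=
  hasDerivAt_vel (F := fun s z => christoffel (G s) z k i j) (hG.christoffel_smooth k i j)
    hG.isOpen hx

theorem MetricFamily.hasDerivAt_riemannUp (hG : MetricFamily Ω G) (hx : x ∈ slice Ω 0)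
    (a b c d : Fin n) :
    HasDerivAt (fun s => riemannUp (G s) x a b c d) (velRiemannUp G x a b c d) 0 := by
  have hp : ∀ p k i j, HasDerivAt (fun s => pd p (fun y => christoffel (G s) y k i j) x)
      (pd p (fun y => velChristoffel G y k i j) x) 0 := fun p k i j =>
    hasDerivAt_pd_family (F := fun s z => christoffel (G s) z k i j)
      (hG.christoffel_smooth k i j) hG.isOpen hx p
  have hc := hG.hasDerivAt_christoffel hx
  unfold riemannUp velRiemannUp
  exact ((hp _ _ _ _).sub (hp _ _ _ _)).add (HasDerivAt.fun_sum fun f _ =>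
    ((hc _ _ _).mul (hc _ _ _)).sub ((hc _ _ _).mul (hc _ _ _)))

/-- The first variation of the Levi-Civita connection. -/
theorem MetricFamily.lower_velChristoffel (hG : MetricFamily Ω G) (hx : x ∈ slice Ω 0)
    (e k i : Fin n) :
    ∑ m, G 0 x e m * velChristoffel G x m k i
      = lowerConnVariation (G 0) (velocity G) x e k i := by
  have hg := hG.metricOn 0
  have hp : ∀ p i j, HasDerivAt (fun s => pd p (fun y => G s y i j) x)
      (pd p (fun y => velocity G y i j) x) 0 := fun p i j =>
    hasDerivAt_pd_family (F := fun s z => G s z i j) (hG.smooth i j) hG.isOpen hx p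
  have h1 : HasDerivAt (fun s => ∑ m, G s x e m * christoffel (G s) x m k i)
      (∑ m, (velocity G x e m * christoffel (G 0) x m k i
        + G 0 x e m * velChristoffel G x m k i)) 0 :=
    HasDerivAt.fun_sum fun m _ => (hG.hasDerivAt hx e m).mul (hG.hasDerivAt_christoffel hx m k i)
  have h2 : HasDerivAt (fun s => (1 / 2) * (pd k (fun y => G s y i e) x
      + pd i (fun y => G s y k e) x - pd e (fun y => G s y k i) x))
      ((1 / 2) * (pd k (fun y => velocity G y i e) x + pd i (fun y => velocity G y k e) x
        - pd e (fun y => velocity G y k i) x)) 0 :=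
    (((hp k i e).add (hp i k e)).sub (hp e k i)).const_mul _
  have h3 := h1.unique (h2.congr_of_eventuallyEq (by
    filter_upwards [hG.eventually_mem hx] with s hs using (hG.metricOn s).lower_christoffel hs e k i))
  rw [Finset.sum_add_distrib] at h3
  have h4 : ∑ m, velocity G x e m * christoffel (G 0) x m k i
      = ∑ m, christoffel (G 0) x m k i * velocity G x m e :=
    Finset.sum_congr rfl fun m _ => by rw [hG.velocity_symm hx e m]; ring
  unfold lowerConnVariation covTwo
  simp only [Finset.sum_add_distrib, hg.christoffel_symm hx _ e k, hg.christoffel_symm hx _ e i,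
    hg.christoffel_symm hx _ i k]
  rw [h4] at h3
  have h5 : ∑ m, christoffel (G 0) x m k e * velocity G x i m
      = ∑ m, christoffel (G 0) x m k e * velocity G x m i :=
    Finset.sum_congr rfl fun m _ => by rw [hG.velocity_symm hx i m]
  rw [h5]
  linear_combination h3

theorem MetricOn.covTwo_smooth {U : Set (Fin n → ℝ)}
    {g h : (Fin n → ℝ) → Matrix (Fin n) (Fin n) ℝ} (hg : MetricOn U g)
    (hh : ∀ i j, ContDiffOn ℝ ∞ (fun y => h y i j) U) (k i j : Fin n) :
    ContDiffOn ℝ ∞ (fun y => covTwo g h y k i j) U := by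
  unfold covTwo
  exact (pd_smooth (hh i j) hg.isOpen k).sub (ContDiffOn.sum fun m _ =>
    ((hg.christoffel_smooth m k i).mul (hh m j)).add ((hg.christoffel_smooth m k j).mul (hh i m)))

theorem MetricOn.covTwo_symm {U : Set (Fin n → ℝ)}
    {g h : (Fin n → ℝ) → Matrix (Fin n) (Fin n) ℝ} (hg : MetricOn U g)
    (hs : ∀ y ∈ U, ∀ i j, h y i j = h y j i)
    (hx : x ∈ U) (k i j : Fin n) : covTwo g h x k i j = covTwo g h x k j i := by
  unfold covTwo
  rw [pd_congr hg.isOpen hx (fun y hy => hs y hy i j) k]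
  congr 1
  exact Finset.sum_congr rfl fun m _ => by rw [hs x hx m j, hs x hx i m]; ring

theorem MetricOn.covCovTwo_symm {U : Set (Fin n → ℝ)}
    {g h : (Fin n → ℝ) → Matrix (Fin n) (Fin n) ℝ} (hg : MetricOn U g)
    (hs : ∀ y ∈ U, ∀ i j, h y i j = h y j i)
    (hx : x ∈ U) (k l i j : Fin n) : covCovTwo g h x k l i j = covCovTwo g h x k l j i := by
  unfold covCovTwo
  rw [pd_congr hg.isOpen hx (fun y hy => hg.covTwo_symm hs hy l i j) k]
  congr 1
  exact Finset.sum_congr rfl fun m _ => by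
    rw [hg.covTwo_symm hs hx m i j, hg.covTwo_symm hs hx l m j, hg.covTwo_symm hs hx l i m]; ring

/-- `∇` commutes with the algebraic operations: the covariant derivative of the lowered variation
of the connection, in terms of second covariant derivatives of `h`. -/
theorem cov_lowerConnVariation {U : Set (Fin n → ℝ)}
    {g h : (Fin n → ℝ) → Matrix (Fin n) (Fin n) ℝ} (hg : MetricOn U g)
    (hh : ∀ i j, ContDiffOn ℝ ∞ (fun y => h y i j) U) (hx : x ∈ U) (c e d b : Fin n) :
    pd c (fun y => lowerConnVariation g h y e d b) x
      = (1 / 2) * (covCovTwo g h x c d b e + covCovTwo g h x c b d e - covCovTwo g h x c e d b)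
        + ∑ m, (christoffel g x m c e * lowerConnVariation g h x m d b
          + christoffel g x m c d * lowerConnVariation g h x e m b
          + christoffel g x m c b * lowerConnVariation g h x e d m) := by
  have hd : ∀ k i j, DifferentiableAt ℝ (fun y => covTwo g h y k i j) x :=
    fun k i j => differentiableAt_of_smooth (hg.covTwo_smooth hh k i j) hg.isOpen hx
  unfold lowerConnVariation covCovTwo
  rw [pd_const_mul _ (((hd _ _ _).fun_add (hd _ _ _)).fun_sub (hd _ _ _)),
    pd_sub ((hd _ _ _).fun_add (hd _ _ _)) (hd _ _ _), pd_add (hd _ _ _) (hd _ _ _)]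
  have : ∑ m, (christoffel g x m c e * (1 / 2 * (covTwo g h x d b m + covTwo g h x b d m
            - covTwo g h x m d b))
          + christoffel g x m c d * (1 / 2 * (covTwo g h x m b e + covTwo g h x b m e
            - covTwo g h x e m b))
          + christoffel g x m c b * (1 / 2 * (covTwo g h x d m e + covTwo g h x m d e
            - covTwo g h x e d m)))
      = (1 / 2) * (∑ m, (christoffel g x m c d * covTwo g h x m b e
          + christoffel g x m c b * covTwo g h x d m e
          + christoffel g x m c e * covTwo g h x d b m)
        + ∑ m, (christoffel g x m c b * covTwo g h x m d e
          + christoffel g x m c d * covTwo g h x b m e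
          + christoffel g x m c e * covTwo g h x b d m)
        - ∑ m, (christoffel g x m c e * covTwo g h x m d b
          + christoffel g x m c d * covTwo g h x e m b
          + christoffel g x m c b * covTwo g h x e d m)) := by
    rw [← Finset.sum_add_distrib, ← Finset.sum_sub_distrib, Finset.mul_sum]
    exact Finset.sum_congr rfl fun m _ => by ring
  rw [this]
  ring

/-- The first variation of the curvature tensor. -/
theorem MetricFamily.lower_velRiemannUp (hG : MetricFamily Ω G) (hx : x ∈ slice Ω 0)
    (e b c d : Fin n) :
    ∑ a, G 0 x e a * velRiemannUp G x a b c d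
      = (1 / 2) * (covCovTwo (G 0) (velocity G) x c d b e + covCovTwo (G 0) (velocity G) x c b d e
          - covCovTwo (G 0) (velocity G) x c e d b - covCovTwo (G 0) (velocity G) x d c b e
          - covCovTwo (G 0) (velocity G) x d b c e + covCovTwo (G 0) (velocity G) x d e c b) := by
  have hg := hG.metricOn 0
  have key : ∀ c d, ∑ a, G 0 x e a * (pd c (fun y => velChristoffel G y a d b) x
        + ∑ f, christoffel (G 0) x a c f * velChristoffel G x f d b)
      = (1 / 2) * (covCovTwo (G 0) (velocity G) x c d b e + covCovTwo (G 0) (velocity G) x c b d e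
          - covCovTwo (G 0) (velocity G) x c e d b)
        + ∑ m, (christoffel (G 0) x m c d * lowerConnVariation (G 0) (velocity G) x e m b
          + christoffel (G 0) x m c b * lowerConnVariation (G 0) (velocity G) x e d m) := by
    intro c d
    rw [hg.lower_cov hx (V := fun y a => velChristoffel G y a d b)
      (fun a => hG.velChristoffel_smooth a d b) c e,
      pd_congr hg.isOpen hx (fun y hy => hG.lower_velChristoffel hy e d b) c,
      cov_lowerConnVariation hg hG.velocity_smooth hx]
    simp only [hG.lower_velChristoffel hx, Finset.sum_add_distrib]
    ring
  have hL : ∀ c d, ∑ a, G 0 x e a * ∑ f, velChristoffel G x a c f * christoffel (G 0) x f d b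
      = ∑ f, christoffel (G 0) x f d b * lowerConnVariation (G 0) (velocity G) x e c f := by
    intro c d
    simp only [← hG.lower_velChristoffel hx, Finset.mul_sum]
    rw [Finset.sum_comm]
    exact Finset.sum_congr rfl fun _ _ => Finset.sum_congr rfl fun _ _ => by ring
  have hR : ∑ a, G 0 x e a * velRiemannUp G x a b c d
      = ∑ a, G 0 x e a * (pd c (fun y => velChristoffel G y a d b) x
          + ∑ f, christoffel (G 0) x a c f * velChristoffel G x f d b)
        - ∑ a, G 0 x e a * (pd d (fun y => velChristoffel G y a c b) x
          + ∑ f, christoffel (G 0) x a d f * velChristoffel G x f c b)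
        + ∑ a, G 0 x e a * ∑ f, velChristoffel G x a c f * christoffel (G 0) x f d b
        - ∑ a, G 0 x e a * ∑ f, velChristoffel G x a d f * christoffel (G 0) x f c b := by
    unfold velRiemannUp
    rw [← Finset.sum_sub_distrib, ← Finset.sum_add_distrib, ← Finset.sum_sub_distrib]
    refine Finset.sum_congr rfl fun a _ => ?_
    rw [Finset.sum_sub_distrib, Finset.sum_add_distrib, Finset.sum_add_distrib]; ring
  rw [hR, key, key, hL, hL]
  simp only [Finset.sum_add_distrib, hg.christoffel_symm hx _ d c]
  ring

end Variation

/-! ### Covariant calculus in dimension three -/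

section Three

variable {U : Set (Fin 3 → ℝ)} {g h : (Fin 3 → ℝ) → Matrix (Fin 3) (Fin 3) ℝ}
  {θ : (Fin 3 → ℝ) → Fin 3 → ℝ} {x : Fin 3 → ℝ}

/-- `∇ₖ∇ₗ θⱼ`, `k` being the last differentiation. -/
def covCovOne (g : (Fin 3 → ℝ) → Matrix (Fin 3) (Fin 3) ℝ) (θ : (Fin 3 → ℝ) → Fin 3 → ℝ)
    (x : Fin 3 → ℝ) (k l j : Fin 3) : ℝ :=
  pd k (fun y => covOne g θ y l j) x
    - ∑ m, (christoffel g x m k l * covOne g θ x m j + christoffel g x m k j * covOne g θ x l m)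

theorem MetricOn.covOne_smooth (hg : MetricOn U g) (hθ : ∀ i, ContDiffOn ℝ ∞ (fun y => θ y i) U)
    (i j : Fin 3) : ContDiffOn ℝ ∞ (fun y => covOne g θ y i j) U :=
  (pd_smooth (hθ j) hg.isOpen i).sub
    (ContDiffOn.sum fun m _ => (hg.christoffel_smooth m i j).mul (hθ m))

/-- The Ricci identity for `1`-forms. -/
theorem MetricOn.covCovOne_comm (hg : MetricOn U g)
    (hθ : ∀ i, ContDiffOn ℝ ∞ (fun y => θ y i) U) (hx : x ∈ U) (k l j : Fin 3) :
    covCovOne g θ x k l j - covCovOne g θ x l k j = -∑ a, riemannUp g x a j k l * θ x a := by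
  have dθ : ∀ i, DifferentiableAt ℝ (fun y => θ y i) x :=
    fun i => differentiableAt_of_smooth (hθ i) hg.isOpen hx
  have dp : ∀ k i, DifferentiableAt ℝ (fun y => pd k (fun z => θ z i) y) x :=
    fun k i => differentiableAt_of_smooth (pd_smooth (hθ i) hg.isOpen k) hg.isOpen hx
  have dΓ : ∀ m i j, DifferentiableAt ℝ (fun y => christoffel g y m i j) x :=
    fun m i j => differentiableAt_of_smooth (hg.christoffel_smooth m i j) hg.isOpen hx
  have e : ∀ k l, pd k (fun y => covOne g θ y l j) x
      = pd k (fun y => pd l (fun z => θ z j) y) x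
        - ∑ m, (pd k (fun y => christoffel g y m l j) x * θ x m
          + christoffel g x m l j * pd k (fun y => θ y m) x) := by
    intro k l
    simp only [covOne, Matrix.of_apply]
    rw [pd_sub (dp _ _) (DifferentiableAt.fun_sum fun m _ => (dΓ _ _ _).fun_mul (dθ _)),
      pd_sum fun m _ => (dΓ _ _ _).fun_mul (dθ _)]
    simp only [pd_mul (dΓ _ _ _) (dθ _)]
  unfold covCovOne
  rw [e, e, pd_comm (hθ j) hg.isOpen hx k l]
  simp only [covOne, Matrix.of_apply, riemannUp, Fin.sum_univ_three, hg.christoffel_symm hx _ l k]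
  ring

/-- The Ricci identity for `2`-tensors. -/
theorem MetricOn.covCovTwo_comm (hg : MetricOn U g)
    (hh : ∀ i j, ContDiffOn ℝ ∞ (fun y => h y i j) U) (hx : x ∈ U) (k l i j : Fin 3) :
    covCovTwo g h x k l i j - covCovTwo g h x l k i j
      = -∑ a, (riemannUp g x a i k l * h x a j + riemannUp g x a j k l * h x i a) := by
  have dh : ∀ i j, DifferentiableAt ℝ (fun y => h y i j) x :=
    fun i j => differentiableAt_of_smooth (hh i j) hg.isOpen hx
  have dp : ∀ k i j, DifferentiableAt ℝ (fun y => pd k (fun z => h z i j) y) x :=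
    fun k i j => differentiableAt_of_smooth (pd_smooth (hh i j) hg.isOpen k) hg.isOpen hx
  have dΓ : ∀ m i j, DifferentiableAt ℝ (fun y => christoffel g y m i j) x :=
    fun m i j => differentiableAt_of_smooth (hg.christoffel_smooth m i j) hg.isOpen hx
  have e : ∀ k l, pd k (fun y => covTwo g h y l i j) x
      = pd k (fun y => pd l (fun z => h z i j) y) x
        - ∑ m, (pd k (fun y => christoffel g y m l i) x * h x m j
          + christoffel g x m l i * pd k (fun y => h y m j) x
          + (pd k (fun y => christoffel g y m l j) x * h x i m
          + christoffel g x m l j * pd k (fun y => h y i m) x)) := by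
    intro k l
    unfold covTwo
    have dm : ∀ m, DifferentiableAt ℝ (fun y => christoffel g y m l i * h y m j
        + christoffel g y m l j * h y i m) x := fun m =>
      ((dΓ _ _ _).fun_mul (dh _ _)).fun_add ((dΓ _ _ _).fun_mul (dh _ _))
    rw [pd_sub (dp _ _ _) (DifferentiableAt.fun_sum fun m _ => dm m), pd_sum fun m _ => dm m]
    congr 1
    refine Finset.sum_congr rfl fun m _ => ?_
    rw [pd_add ((dΓ _ _ _).fun_mul (dh _ _)) ((dΓ _ _ _).fun_mul (dh _ _)),
      pd_mul (dΓ _ _ _) (dh _ _), pd_mul (dΓ _ _ _) (dh _ _)]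
  unfold covCovTwo
  rw [e, e, pd_comm (hh i j) hg.isOpen hx k l]
  simp only [covTwo, riemannUp, Fin.sum_univ_three, hg.christoffel_symm hx _ l k]
  ring

/-- The inverse metric is parallel. -/
theorem MetricOn.pd_inv (hg : MetricOn U g) (hx : x ∈ U) (k i j : Fin 3) :
    pd k (fun y => (g y)⁻¹ i j) x
      = -∑ m, (christoffel g x i k m * (g x)⁻¹ m j + christoffel g x j k m * (g x)⁻¹ i m) := by
  have hs := smooth_inv hg.smooth hg.det_ne
  have h1 : ∀ e, ∑ a, g x e a * (pd k (fun y => (g y)⁻¹ a j) x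
      + ∑ f, christoffel g x a k f * (g x)⁻¹ f j) = -christoffel g x j k e := by
    intro e
    rw [hg.lower_cov hx (V := fun y a => (g y)⁻¹ a j) (fun a => hs a j) k e,
      pd_congr hg.isOpen hx (fun y hy => hg.sum_mul_inv hy e j) k, pd_const]
    simp [hg.sum_mul_inv hx]
  have h2 : ∑ e, (g x)⁻¹ i e * ∑ a, g x e a * (pd k (fun y => (g y)⁻¹ a j) x
      + ∑ f, christoffel g x a k f * (g x)⁻¹ f j)
      = pd k (fun y => (g y)⁻¹ i j) x + ∑ f, christoffel g x i k f * (g x)⁻¹ f j := by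
    set V := fun a => pd k (fun y => (g y)⁻¹ a j) x + ∑ f, christoffel g x a k f * (g x)⁻¹ f j
    have : ∑ e, (g x)⁻¹ i e * ∑ a, g x e a * V a = ∑ a, (∑ e, (g x)⁻¹ i e * g x e a) * V a := by
      simp only [Finset.mul_sum, Finset.sum_mul]
      rw [Finset.sum_comm]
      exact Finset.sum_congr rfl fun _ _ => Finset.sum_congr rfl fun _ _ => by ring
    rw [this]
    simp [hg.sum_inv_mul hx, V]
  simp only [h1] at h2
  rw [Finset.sum_add_distrib]
  have h3 : ∑ e, (g x)⁻¹ i e * -christoffel g x j k e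
      = -∑ e, christoffel g x j k e * (g x)⁻¹ i e := by
    rw [← Finset.sum_neg_distrib]
    exact Finset.sum_congr rfl fun _ _ => by ring
  rw [h3] at h2
  linear_combination -h2

/-- Covariant differentiation commutes with the trace. -/
theorem MetricOn.pd_trace (hg : MetricOn U g) {T : (Fin 3 → ℝ) → Fin 3 → Fin 3 → ℝ}
    (hT : ∀ i j, ContDiffOn ℝ ∞ (fun y => T y i j) U) (hx : x ∈ U) (k : Fin 3) :
    pd k (fun y => ∑ i, ∑ j, (g y)⁻¹ i j * T y i j) x
      = ∑ i, ∑ j, (g x)⁻¹ i j * (pd k (fun y => T y i j) x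
        - ∑ m, (christoffel g x m k i * T x m j + christoffel g x m k j * T x i m)) := by
  have dT : ∀ i j, DifferentiableAt ℝ (fun y => T y i j) x :=
    fun i j => differentiableAt_of_smooth (hT i j) hg.isOpen hx
  have dI : ∀ i j, DifferentiableAt ℝ (fun y => (g y)⁻¹ i j) x :=
    fun i j => differentiableAt_of_smooth (smooth_inv hg.smooth hg.det_ne i j) hg.isOpen hx
  rw [pd_sum fun i _ => DifferentiableAt.fun_sum fun j _ => (dI _ _).fun_mul (dT _ _)]
  have : ∀ i, pd k (fun y => ∑ j, (g y)⁻¹ i j * T y i j) x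
      = ∑ j, (pd k (fun y => (g y)⁻¹ i j) x * T x i j
        + (g x)⁻¹ i j * pd k (fun y => T y i j) x) := by
    intro i
    rw [pd_sum fun j _ => (dI _ _).fun_mul (dT _ _)]
    exact Finset.sum_congr rfl fun j _ => pd_mul (dI _ _) (dT _ _) k
  rw [Finset.sum_congr rfl fun i _ => this i]
  simp only [hg.pd_inv hx]
  simp only [Fin.sum_univ_three]
  ring

theorem MetricOn.tr_smooth (hg : MetricOn U g)
    (hh : ∀ i j, ContDiffOn ℝ ∞ (fun y => h y i j) U) :
    ContDiffOn ℝ ∞ (fun y => tr (g y) (h y)) U := by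
  unfold tr
  exact ContDiffOn.sum fun i _ => ContDiffOn.sum fun j _ =>
    (smooth_inv hg.smooth hg.det_ne i j).mul (hh i j)

theorem MetricOn.pd_tr (hg : MetricOn U g)
    (hh : ∀ i j, ContDiffOn ℝ ∞ (fun y => h y i j) U) (hx : x ∈ U) (k : Fin 3) :
    pd k (fun y => tr (g y) (h y)) x = ∑ i, ∑ j, (g x)⁻¹ i j * covTwo g h x k i j := by
  unfold tr covTwo
  exact hg.pd_trace (T := fun y i j => h y i j) hh hx k

/-- The Hessian of the trace is the trace of the second covariant derivative. -/
theorem MetricOn.hessian_tr (hg : MetricOn U g)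
    (hh : ∀ i j, ContDiffOn ℝ ∞ (fun y => h y i j) U) (hx : x ∈ U) (k l : Fin 3) :
    covOne g (fun y p => pd p (fun z => tr (g z) (h z)) y) x k l
      = ∑ i, ∑ j, (g x)⁻¹ i j * covCovTwo g h x k l i j := by
  simp only [covOne, Matrix.of_apply, hg.pd_tr hh hx]
  rw [pd_congr hg.isOpen hx (fun y hy => hg.pd_tr hh hy l) k,
    hg.pd_trace (T := fun y i j => covTwo g h y l i j) (hg.covTwo_smooth hh l) hx]
  simp only [covCovTwo, Fin.sum_univ_three]
  ring

/-- The covariant derivative of the divergence. -/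
theorem MetricOn.covOne_divTwo (hg : MetricOn U g)
    (hh : ∀ i j, ContDiffOn ℝ ∞ (fun y => h y i j) U) (hx : x ∈ U) (k j : Fin 3) :
    covOne g (divTwo g h) x k j = ∑ i, ∑ l, (g x)⁻¹ i l * covCovTwo g h x k i l j := by
  simp only [covOne, Matrix.of_apply, divTwo]
  rw [hg.pd_trace (T := fun y i l => covTwo g h y i l j)
    (fun i l => hg.covTwo_smooth hh i l j) hx]
  simp only [covCovTwo, Fin.sum_univ_three]
  ring

end Three

/-! ### The volume form in dimension three -/

section VolumeForm

theorem altSymbol_three (i j k : Fin 3) :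
    altSymbol ![i, j, k] =
      (((j : ℕ) : ℝ) - (i : ℕ)) * (((k : ℕ) : ℝ) - (j : ℕ)) * (((k : ℕ) : ℝ) - (i : ℕ)) / 2 := by
  fin_cases i <;> fin_cases j <;> fin_cases k <;>
    simp [altSymbol, Matrix.det_fin_three] <;> norm_num

theorem altSymbol_swap_right (i j k : Fin 3) : altSymbol ![i, j, k] = -altSymbol ![i, k, j] := by
  rw [altSymbol_three, altSymbol_three]; ring

theorem altSymbol_rotate (i j k : Fin 3) : altSymbol ![i, j, k] = altSymbol ![j, k, i] := by
  rw [altSymbol_three, altSymbol_three]; ring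

theorem epsUp_antisymm (g : Matrix (Fin 3) (Fin 3) ℝ) (i k l : Fin 3) :
    epsUp g i k l = -epsUp g i l k := by
  unfold epsUp
  rw [Finset.sum_comm, ← Finset.sum_neg_distrib]
  refine Finset.sum_congr rfl fun p _ => ?_
  rw [← Finset.sum_neg_distrib]
  refine Finset.sum_congr rfl fun q _ => ?_
  rw [altSymbol_swap_right]; ring

variable {U : Set (Fin 3 → ℝ)} {g : (Fin 3 → ℝ) → Matrix (Fin 3) (Fin 3) ℝ}
  {x : Fin 3 → ℝ}

/-- The logarithmic derivative of the Riemannian volume density is the trace of the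
connection. -/
theorem MetricOn.pd_sqrt_det (hg : MetricOn U g) (hx : x ∈ U) (hdet : 0 < (g x).det)
    (m : Fin 3) :
    pd m (fun y => Real.sqrt (g y).det) x = Real.sqrt (g x).det * ∑ a, christoffel g x a m a := by
  have d : ∀ i j, DifferentiableAt ℝ (fun y => g y i j) x := hg.differentiableAt hx
  have hd : DifferentiableAt ℝ (fun y => (g y).det) x :=
    differentiableAt_of_smooth (smooth_det hg.smooth) hg.isOpen hx
  have h1 : pd m (fun y => (g y).det) x = 2 * (g x).det * ∑ a, christoffel g x a m a := by
    have s10 := hg.symm x hx 1 0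
    have s20 := hg.symm x hx 2 0
    have s21 := hg.symm x hx 2 1
    simp only [Matrix.det_fin_three]
    rw [pd_sub (by fun_prop) (by fun_prop), pd_add (by fun_prop) (by fun_prop),
      pd_add (by fun_prop) (by fun_prop), pd_sub (by fun_prop) (by fun_prop),
      pd_sub (by fun_prop) (by fun_prop)]
    simp only [pd_mul ((d _ _).fun_mul (d _ _)) (d _ _), pd_mul (d _ _) (d _ _)]
    simp only [hg.pd_metric hx]
    simp only [Fin.sum_univ_three, s10, s20, s21]
    ring
  have h2 : pd m (fun y => Real.sqrt (g y).det) x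
      = 1 / (2 * Real.sqrt (g x).det) * pd m (fun y => (g y).det) x := by
    rw [pd, (hd.hasFDerivAt.sqrt hdet.ne').fderiv]
    simp [pd]
  have hs : Real.sqrt (g x).det ≠ 0 := (Real.sqrt_pos.2 hdet).ne'
  rw [h2, h1]
  have := Real.mul_self_sqrt hdet.le
  field_simp
  linear_combination -(∑ a, christoffel g x a m a) * this

theorem MetricOn.epsUp_smooth (hg : MetricOn U g) (hdet : ∀ y ∈ U, 0 < (g y).det)
    (i k l : Fin 3) : ContDiffOn ℝ ∞ (fun y => epsUp (g y) i k l) U := by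
  unfold epsUp
  have hs := smooth_inv hg.smooth hg.det_ne
  exact ContDiffOn.sum fun p _ => ContDiffOn.sum fun q _ =>
    ((((smooth_det hg.smooth).sqrt fun y hy => (hdet y hy).ne').mul contDiffOn_const).mul
      (hs p k)).mul (hs q l)

/-- The volume form is parallel. -/
theorem MetricOn.pd_epsUp (hg : MetricOn U g) (hdet : ∀ y ∈ U, 0 < (g y).det) (hx : x ∈ U)
    (m i k l : Fin 3) :
    pd m (fun y => epsUp (g y) i k l) x
      = ∑ a, (christoffel g x a m i * epsUp (g x) a k l
          - christoffel g x k m a * epsUp (g x) i a l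
          - christoffel g x l m a * epsUp (g x) i k a) := by
  have dI : ∀ i j, DifferentiableAt ℝ (fun y => (g y)⁻¹ i j) x :=
    fun i j => differentiableAt_of_smooth (smooth_inv hg.smooth hg.det_ne i j) hg.isOpen hx
  have dS : DifferentiableAt ℝ (fun y => Real.sqrt (g y).det) x :=
    differentiableAt_of_smooth ((smooth_det hg.smooth).sqrt fun y hy => (hdet y hy).ne')
      hg.isOpen hx
  have e : ∀ p q, pd m (fun y => Real.sqrt (g y).det * altSymbol ![i, p, q] * (g y)⁻¹ p k
        * (g y)⁻¹ q l) x
      = pd m (fun y => Real.sqrt (g y).det) x * altSymbol ![i, p, q] * (g x)⁻¹ p k * (g x)⁻¹ q l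
        + Real.sqrt (g x).det * altSymbol ![i, p, q] * pd m (fun y => (g y)⁻¹ p k) x
          * (g x)⁻¹ q l
        + Real.sqrt (g x).det * altSymbol ![i, p, q] * (g x)⁻¹ p k
          * pd m (fun y => (g y)⁻¹ q l) x := by
    intro p q
    rw [pd_mul ((dS.mul_const _).fun_mul (dI _ _)) (dI _ _), pd_mul (dS.mul_const _) (dI _ _),
      pd_mul dS (differentiableAt_const _), pd_const]
    ring
  have e' : pd m (fun y => epsUp (g y) i k l) x = ∑ p, ∑ q, pd m (fun y =>
      Real.sqrt (g y).det * altSymbol ![i, p, q] * (g y)⁻¹ p k * (g y)⁻¹ q l) x := by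
    unfold epsUp
    have dT : ∀ p q, DifferentiableAt ℝ (fun y => Real.sqrt (g y).det * altSymbol ![i, p, q]
        * (g y)⁻¹ p k * (g y)⁻¹ q l) x :=
      fun p q => ((dS.mul_const _).fun_mul (dI _ _)).fun_mul (dI _ _)
    rw [pd_sum fun p _ => DifferentiableAt.fun_sum fun q _ => dT p q]
    exact Finset.sum_congr rfl fun p _ => pd_sum (fun q _ => dT p q) m
  rw [e']
  simp only [e, hg.pd_sqrt_det hx (hdet x hx), hg.pd_inv hx]
  unfold epsUp
  fin_cases i <;> simp [Fin.sum_univ_three, altSymbol_three] <;> ring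

/-- Covariant differentiation commutes with the contraction by the volume form. -/
theorem MetricOn.cov_eps_contract (hg : MetricOn U g) (hdet : ∀ y ∈ U, 0 < (g y).det)
    {T : (Fin 3 → ℝ) → Fin 3 → Fin 3 → ℝ} (hT : ∀ i j, ContDiffOn ℝ ∞ (fun y => T y i j) U)
    (hx : x ∈ U) (m i : Fin 3) :
    pd m (fun y => ∑ k, ∑ l, epsUp (g y) i k l * T y k l) x
        - ∑ a, christoffel g x a m i * ∑ k, ∑ l, epsUp (g x) a k l * T x k l
      = ∑ k, ∑ l, epsUp (g x) i k l * (pd m (fun y => T y k l) x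
        - ∑ a, (christoffel g x a m k * T x a l + christoffel g x a m l * T x k a)) := by
  have dT : ∀ i j, DifferentiableAt ℝ (fun y => T y i j) x :=
    fun i j => differentiableAt_of_smooth (hT i j) hg.isOpen hx
  have dE : ∀ k l, DifferentiableAt ℝ (fun y => epsUp (g y) i k l) x :=
    fun k l => differentiableAt_of_smooth (hg.epsUp_smooth hdet i k l) hg.isOpen hx
  have e : pd m (fun y => ∑ k, ∑ l, epsUp (g y) i k l * T y k l) x
      = ∑ k, ∑ l, (pd m (fun y => epsUp (g y) i k l) x * T x k l
        + epsUp (g x) i k l * pd m (fun y => T y k l) x) := by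
    rw [pd_sum fun k _ => DifferentiableAt.fun_sum fun l _ => (dE _ _).fun_mul (dT _ _)]
    refine Finset.sum_congr rfl fun k _ => ?_
    rw [pd_sum fun l _ => (dE _ _).fun_mul (dT _ _)]
    exact Finset.sum_congr rfl fun l _ => pd_mul (dE _ _) (dT _ _) m
  rw [e]
  simp only [hg.pd_epsUp hdet hx]
  simp only [Fin.sum_univ_three]
  ring

/-- The covariant derivative of `*dα` in terms of second covariant derivatives of `α`. -/
theorem MetricOn.covOne_starD (hg : MetricOn U g) (hdet : ∀ y ∈ U, 0 < (g y).det)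
    {A : (Fin 3 → ℝ) → Fin 3 → ℝ} (hA : ∀ i, ContDiffOn ℝ ∞ (fun y => A y i) U)
    (hx : x ∈ U) (m i : Fin 3) :
    covOne g (starD g A) x m i
      = (1 / 2) * ∑ k, ∑ l, epsUp (g x) i k l
          * (covCovOne g A x m k l - covCovOne g A x m l k) := by
  have hst : ∀ y ∈ U, ∀ j, starD g A y j
      = ∑ k, ∑ l, epsUp (g y) j k l * ((1 / 2) * (covOne g A y k l - covOne g A y l k)) := by
    intro y hy j
    unfold starD
    simp only [Finset.mul_sum (a := (1 / 2 : ℝ))]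
    refine Finset.sum_congr rfl fun k _ => Finset.sum_congr rfl fun l _ => ?_
    simp only [covOne, Matrix.of_apply, hg.christoffel_symm hy _ l k]
    ring
  have hc := hg.covOne_smooth hA
  have dc : ∀ k l, DifferentiableAt ℝ (fun y => covOne g A y k l) x :=
    fun k l => differentiableAt_of_smooth (hc k l) hg.isOpen hx
  have h := hg.cov_eps_contract hdet (T := fun y k l => (1 / 2) * (covOne g A y k l
    - covOne g A y l k)) (fun k l => contDiffOn_const.mul ((hc k l).sub (hc l k))) hx m i
  rw [covOne, Matrix.of_apply, pd_congr hg.isOpen hx (fun y hy => hst y hy i) m]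
  simp only [hst x hx]
  rw [h, Finset.mul_sum]
  refine Finset.sum_congr rfl fun k _ => ?_
  rw [Finset.mul_sum]
  refine Finset.sum_congr rfl fun l _ => ?_
  rw [pd_const_mul _ ((dc _ _).fun_sub (dc _ _)), pd_sub (dc _ _) (dc _ _)]
  simp only [covCovOne, Fin.sum_univ_three]
  ring

end VolumeForm

/-! ### Contractions with the volume form of a three-dimensional inner product -/

section Algebra

variable {g : Matrix (Fin 3) (Fin 3) ℝ}

/-- The symmetries of a curvature tensor, apart from the first Bianchi identity. -/
structure CurvSymm {n : ℕ} (P : Fin n → Fin n → Fin n → Fin n → ℝ) : Prop where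
  left : ∀ a b c d, P a b c d = -P b a c d
  right : ∀ a b c d, P a b c d = -P a b d c
  pair : ∀ a b c d, P a b c d = P c d a b

theorem inv_apply_symm (hs : ∀ i j, g i j = g j i) (i j : Fin 3) : g⁻¹ i j = g⁻¹ j i := by
  have : g.transpose = g := Matrix.ext fun i j => hs j i
  conv_lhs => rw [← this, ← Matrix.transpose_nonsing_inv, Matrix.transpose_apply]

theorem det_mul_det_inv (hd : 0 < g.det) : g.det * (g⁻¹).det = 1 := by
  rw [Matrix.det_nonsing_inv, Ring.inverse_eq_inv', mul_inv_cancel₀ hd.ne']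

theorem eq_det_smul_adjugate_inv (hd : 0 < g.det) : g = g.det • (g⁻¹).adjugate := by
  have h1 : g⁻¹ * g = 1 := Matrix.nonsing_inv_mul _ (isUnit_iff_ne_zero.2 hd.ne')
  calc g = g.det • ((g⁻¹).adjugate * g⁻¹ * g) := by
        rw [Matrix.adjugate_mul, Matrix.smul_mul, Matrix.one_mul, smul_smul, det_mul_det_inv hd,
          one_smul]
    _ = _ := by rw [Matrix.mul_assoc, h1, Matrix.mul_one]

theorem sum_mul_inv_apply (hd : 0 < g.det) (i j : Fin 3) :
    ∑ k, g i k * g⁻¹ k j = if i = j then 1 else 0 := by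
  rw [← Matrix.mul_apply, Matrix.mul_nonsing_inv _ (isUnit_iff_ne_zero.2 hd.ne'),
    Matrix.one_apply]

theorem sum_inv_mul_apply (hd : 0 < g.det) (i j : Fin 3) :
    ∑ k, g⁻¹ i k * g k j = if i = j then 1 else 0 := by
  rw [← Matrix.mul_apply, Matrix.nonsing_inv_mul _ (isUnit_iff_ne_zero.2 hd.ne'),
    Matrix.one_apply]

/-- `½ ε^{klm} ε_{ilm} = δ^k_i` with the first index lowered. -/
theorem eps_contract_two (hs : ∀ i j, g i j = g j i) (hd : 0 < g.det) (k i : Fin 3) :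
    (1 / 2) * ∑ l, ∑ m, Real.sqrt g.det * altSymbol ![k, l, m] * epsUp g i l m = g i k := by
  have hσ := Real.mul_self_sqrt hd.le
  have s10 := inv_apply_symm hs 1 0
  have s20 := inv_apply_symm hs 2 0
  have s21 := inv_apply_symm hs 2 1
  have e : g i k = g.det * (g⁻¹).adjugate i k := by
    conv_lhs => rw [eq_det_smul_adjugate_inv hd]
    simp
  rw [e, Matrix.adjugate_fin_three]
  simp only [epsUp]
  generalize g⁻¹ = γ at *
  generalize g.det = D at *
  generalize Real.sqrt D = σ at *
  subst hσ
  fin_cases i <;> fin_cases k <;>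
    simp [Fin.sum_univ_three, altSymbol_three, s10, s20, s21] <;> ring

/-- The index lowered, `ε_i^{kl} g_{lj}` is antisymmetric in `i` and `j`. -/
theorem eps_lower_antisymm (hd : 0 < g.det) (i j k : Fin 3) :
    ∑ l, epsUp g i k l * g l j = -∑ l, epsUp g j k l * g l i := by
  have key : ∀ i j, ∑ l, epsUp g i k l * g l j
      = ∑ p, Real.sqrt g.det * altSymbol ![i, p, j] * g⁻¹ p k := by
    intro i j
    have : ∀ l, epsUp g i k l * g l j = ∑ p, ∑ q, Real.sqrt g.det * altSymbol ![i, p, q]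
        * g⁻¹ p k * (g⁻¹ q l * g l j) := by
      intro l
      simp only [epsUp, Finset.sum_mul]
      exact Finset.sum_congr rfl fun _ _ => Finset.sum_congr rfl fun _ _ => by ring
    simp only [this]
    rw [Finset.sum_comm]
    refine Finset.sum_congr rfl fun p _ => ?_
    rw [Finset.sum_comm]
    simp only [← Finset.mul_sum, sum_inv_mul_apply hd]
    simp
  rw [key, key, ← Finset.sum_neg_distrib]
  refine Finset.sum_congr rfl fun p _ => ?_
  rw [altSymbol_rotate, altSymbol_swap_right, altSymbol_rotate, altSymbol_rotate]
  rw [altSymbol_rotate j, altSymbol_rotate p]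
  ring

set_option maxHeartbeats 4000000 in
/-- A curvature tensor in dimension three is determined by its contractions:
`¼ ε_i^{kl} ε_j^{mn} P_{klmn} = ½ (tr tr P) g_{ij} - (tr P)_{ij}`. -/
theorem eps_eps_curv (hs : ∀ i j, g i j = g j i) (hd : 0 < g.det)
    {P : Fin 3 → Fin 3 → Fin 3 → Fin 3 → ℝ} (hP : CurvSymm P) (i j : Fin 3) :
    (1 / 4) * ∑ k, ∑ l, ∑ m, ∑ n, epsUp g i k l * epsUp g j m n * P k l m n
      = (1 / 2) * (∑ b, ∑ d, g⁻¹ b d * ∑ a, ∑ c, g⁻¹ a c * P a b c d) * g i j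
        - ∑ a, ∑ c, g⁻¹ a c * P a i c j := by
  have hσ := Real.mul_self_sqrt hd.le
  have hD := det_mul_det_inv hd
  have s10 := inv_apply_symm hs 1 0
  have s20 := inv_apply_symm hs 2 0
  have s21 := inv_apply_symm hs 2 1
  have z1 : ∀ k m n, P k k m n = 0 := fun k m n => by have := hP.left k k m n; linarith
  have z2 : ∀ k m n, P m n k k = 0 := fun k m n => by have := hP.right m n k k; linarith
  have l10 := hP.left 1 0
  have l20 := hP.left 2 0
  have l21 := hP.left 2 1
  have r10 := fun a b => hP.right a b 1 0
  have r20 := fun a b => hP.right a b 2 0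
  have r21 := fun a b => hP.right a b 2 1
  have p1 := hP.pair 0 2 0 1
  have p2 := hP.pair 1 2 0 1
  have p3 := hP.pair 1 2 0 2
  have e : ∀ i j, g i j = g.det * (g⁻¹).adjugate i j := fun i j => by
    conv_lhs => rw [eq_det_smul_adjugate_inv hd]
    simp
  -- Both sides become polynomials in `γ = g⁻¹`, in `D = det g` and in the components of `P`. They
  -- agree modulo the relation `D * det γ = 1`; multiplying the last term by `D * det γ` makes both
  -- sides homogeneous and equal as polynomials.
  rw [e, Matrix.adjugate_fin_three]
  rw [Matrix.det_fin_three g⁻¹] at hD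
  simp only [epsUp]
  generalize g⁻¹ = γ at *
  generalize g.det = D at *
  rw [s10, s20, s21] at hD
  have hD' : ∀ r : ℝ, r = r * (D * (γ 0 0 * γ 1 1 * γ 2 2 - γ 0 0 * γ 1 2 * γ 1 2
      - γ 0 1 * γ 0 1 * γ 2 2 + γ 0 1 * γ 1 2 * γ 0 2 + γ 0 2 * γ 0 1 * γ 1 2
      - γ 0 2 * γ 1 1 * γ 0 2)) := fun r => by rw [hD]; ring
  rw [hD' (∑ a, ∑ c, γ a c * P a i c j)]
  clear hD hD' e
  generalize Real.sqrt D = σ at *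
  subst hσ
  clear hd hs hP
  fin_cases i <;> fin_cases j <;>
    simp [Fin.sum_univ_three, altSymbol_three, s10, s20, s21, z1, z2, l10, l20, l21, r10, r20,
      r21, p1, p2, p3] <;> ring

end Algebra

/-! ### Two-forms and curvature tensors on the cylinder at a point -/

section CylAlgebra

@[simp] theorem cylMatrix_zero_zero (g : Matrix (Fin 3) (Fin 3) ℝ) : cylMatrix g 0 0 = 1 := rfl

@[simp] theorem cylMatrix_zero_succ (g : Matrix (Fin 3) (Fin 3) ℝ) (j : Fin 3) :
    cylMatrix g 0 j.succ = 0 := rfl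

@[simp] theorem cylMatrix_succ_zero (g : Matrix (Fin 3) (Fin 3) ℝ) (i : Fin 3) :
    cylMatrix g i.succ 0 = 0 := rfl

@[simp] theorem cylMatrix_succ_succ (g : Matrix (Fin 3) (Fin 3) ℝ) (i j : Fin 3) :
    cylMatrix g i.succ j.succ = g i j := rfl

theorem cylMatrix_mul (g k : Matrix (Fin 3) (Fin 3) ℝ) :
    cylMatrix g * cylMatrix k = cylMatrix (g * k) := by
  ext a b
  rw [Matrix.mul_apply, Fin.sum_univ_succ]
  refine Fin.cases ?_ (fun i => ?_) a <;> refine Fin.cases ?_ (fun j => ?_) b <;>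
    simp [Matrix.mul_apply]

theorem cylMatrix_one : cylMatrix 1 = 1 := by
  ext a b
  refine Fin.cases ?_ (fun i => ?_) a <;> refine Fin.cases ?_ (fun j => ?_) b <;>
    simp [Matrix.one_apply, Fin.succ_ne_zero, (Fin.succ_ne_zero _).symm]

theorem cylMatrix_inv {g : Matrix (Fin 3) (Fin 3) ℝ} (hd : g.det ≠ 0) :
    (cylMatrix g)⁻¹ = cylMatrix g⁻¹ :=
  Matrix.inv_eq_right_inv (by
    rw [cylMatrix_mul, Matrix.mul_nonsing_inv _ (isUnit_iff_ne_zero.2 hd), cylMatrix_one])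

theorem cylMatrix_det (g : Matrix (Fin 3) (Fin 3) ℝ) : (cylMatrix g).det = g.det := by
  rw [Matrix.det_succ_row_zero, Fin.sum_univ_succ]
  have : (cylMatrix g).submatrix Fin.succ (Fin.succAbove 0) = g := by
    ext i j
    simp
  simp only [cylMatrix_zero_zero, cylMatrix_zero_succ, this]
  simp

theorem altSymbol_zero_succ (k l m : Fin 3) :
    altSymbol ![0, k.succ, l.succ, m.succ] = altSymbol ![k, l, m] := by
  unfold altSymbol
  rw [Matrix.det_succ_column_zero, Fin.sum_univ_succ]
  have h0 : ∀ r : Fin 3, (![0, k.succ, l.succ, m.succ] r.succ : Fin 4) ≠ 0 := by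
    intro r; fin_cases r <;> simp
  simp only [Matrix.of_apply, h0]
  simp only [if_false, mul_zero, zero_mul, Finset.sum_const_zero, add_zero]
  simp
  congr 1
  ext r s
  fin_cases r <;> simp <;> congr

theorem altSymbol_comp_perm {n : ℕ} (i : Fin n → Fin n) (σ : Equiv.Perm (Fin n)) :
    altSymbol (i ∘ σ) = (Equiv.Perm.sign σ : ℤ) * altSymbol i := by
  unfold altSymbol
  rw [← Matrix.det_permute]
  rfl

theorem altSymbol_swap_pairs (a b c d : Fin 4) :
    altSymbol ![a, b, c, d] = altSymbol ![c, d, a, b] := by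
  have h := altSymbol_comp_perm ![a, b, c, d] (Equiv.swap 0 2 * Equiv.swap 1 3)
  have e : ![a, b, c, d] ∘ (Equiv.swap 0 2 * Equiv.swap 1 3 : Equiv.Perm (Fin 4))
      = ![c, d, a, b] := by
    funext r; fin_cases r <;> rfl
  rw [e, Equiv.Perm.sign_mul, Equiv.Perm.sign_swap (by decide), Equiv.Perm.sign_swap (by decide)]
    at h
  simpa using h.symm

theorem altSymbol_swap_last (a b c d : Fin 4) :
    altSymbol ![a, b, c, d] = -altSymbol ![a, b, d, c] := by
  have h := altSymbol_comp_perm ![a, b, d, c] (Equiv.swap 2 3)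
  have e : ![a, b, d, c] ∘ (Equiv.swap 2 3 : Equiv.Perm (Fin 4)) = ![a, b, c, d] := by
    funext r; fin_cases r <;> rfl
  rw [e, Equiv.Perm.sign_swap (by decide)] at h
  simpa using h

theorem altSymbol_swap_first (a b c d : Fin 4) :
    altSymbol ![a, b, c, d] = -altSymbol ![b, a, c, d] := by
  rw [altSymbol_swap_pairs, altSymbol_swap_last, altSymbol_swap_pairs]

theorem altSymbol_succ (k l m n : Fin 3) :
    altSymbol ![k.succ, l.succ, m.succ, n.succ] = 0 := by
  unfold altSymbol
  refine Matrix.det_eq_zero_of_column_eq_zero 0 fun r => ?_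
  fin_cases r <;> simp

variable {g : Matrix (Fin 3) (Fin 3) ℝ}

theorem starOne_row (hs : ∀ i j, g i j = g j i) (hd : 0 < g.det) (i k l : Fin 3) :
    starOne g (fun p => g i p) k l = Real.sqrt g.det * altSymbol ![k, l, i] := by
  unfold starOne
  have : ∀ m, ∑ p, Real.sqrt g.det * altSymbol ![k, l, m] * g⁻¹ m p * g i p
      = Real.sqrt g.det * altSymbol ![k, l, m] * if m = i then 1 else 0 := by
    intro m
    rw [← sum_inv_mul_apply hd, Finset.mul_sum]
    exact Finset.sum_congr rfl fun p _ => by rw [hs i p]; ring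
  simp [this]

theorem raise_antisymm {G : Matrix (Fin 4) (Fin 4) ℝ} {θ : Fin 4 → Fin 4 → ℝ}
    (hθ : ∀ a b, θ a b = -θ b a) (a b : Fin 4) : raise G θ a b = -raise G θ b a := by
  unfold raise
  rw [Finset.sum_comm, ← Finset.sum_neg_distrib]
  refine Finset.sum_congr rfl fun p _ => ?_
  rw [← Finset.sum_neg_distrib]
  exact Finset.sum_congr rfl fun q _ => by rw [hθ q p]; ring

theorem asdTwoForm_antisymm (hs : ∀ i j, g i j = g j i) (hd : 0 < g.det)
    (i : Fin 3) (a b : Fin 4) :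
    asdTwoForm g (fun p => g i p) a b = -asdTwoForm g (fun p => g i p) b a := by
  refine Fin.cases ?_ (fun k => ?_) a <;> refine Fin.cases ?_ (fun l => ?_) b <;>
    simp only [asdTwoForm, Fin.cases_zero, Fin.cases_succ, starOne_row hs hd]
  · simp
  · simp
  · rw [altSymbol_rotate, altSymbol_swap_right, altSymbol_rotate, altSymbol_rotate]
    ring

theorem raise_asdTwoForm_zero_succ (hs : ∀ i j, g i j = g j i) (hd : 0 < g.det)
    (i l : Fin 3) :
    raise (cylMatrix g) (asdTwoForm g (fun p => g i p)) 0 l.succ = if i = l then 1 else 0 := by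
  unfold raise
  rw [cylMatrix_inv hd.ne']
  simp only [Fin.sum_univ_succ (n := 3), asdTwoForm, Fin.cases_zero, Fin.cases_succ,
    cylMatrix_zero_zero, cylMatrix_zero_succ, cylMatrix_succ_zero, cylMatrix_succ_succ]
  simp only [zero_mul, mul_zero, one_mul, Finset.sum_const_zero, add_zero, zero_add]
  rw [← sum_mul_inv_apply hd]
  exact Finset.sum_congr rfl fun p _ => by rw [inv_apply_symm hs l p]; ring

theorem raise_asdTwoForm_succ_succ (hs : ∀ i j, g i j = g j i) (hd : 0 < g.det)
    (i k l : Fin 3) :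
    raise (cylMatrix g) (asdTwoForm g (fun p => g i p)) k.succ l.succ = -epsUp g i k l := by
  unfold raise epsUp
  rw [cylMatrix_inv hd.ne']
  simp only [Fin.sum_univ_succ (n := 3), asdTwoForm, Fin.cases_zero, Fin.cases_succ,
    cylMatrix_succ_zero, cylMatrix_succ_succ, starOne_row hs hd]
  simp only [zero_mul, mul_zero, Finset.sum_const_zero, zero_add]
  rw [← Finset.sum_neg_distrib]
  refine Finset.sum_congr rfl fun p _ => ?_
  rw [← Finset.sum_neg_distrib]
  refine Finset.sum_congr rfl fun q _ => ?_
  rw [altSymbol_rotate i, inv_apply_symm hs k p, inv_apply_symm hs l q]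
  ring

/-- Pairing an antisymmetric array with the raised `2`-form `dt ∧ ∂ᵢ♭ - *∂ᵢ♭`. -/
theorem sum_mul_raise_asdTwoForm (hs : ∀ i j, g i j = g j i) (hd : 0 < g.det)
    {Z : Fin 4 → Fin 4 → ℝ} (hZ : ∀ a b, Z a b = -Z b a)
    (i : Fin 3) :
    ∑ a, ∑ b, Z a b * raise (cylMatrix g) (asdTwoForm g (fun p => g i p)) a b
      = 2 * Z 0 i.succ - ∑ k, ∑ l, epsUp g i k l * Z k.succ l.succ := by
  have h0 : Z 0 0 = 0 := by have := hZ 0 0; linarith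
  have hr := raise_antisymm (G := cylMatrix g) (asdTwoForm_antisymm hs hd i)
  have hs0 : ∀ k : Fin 3, Z k.succ 0
      * raise (cylMatrix g) (asdTwoForm g (fun p => g i p)) k.succ 0
      = Z 0 k.succ * if i = k then 1 else 0 := by
    intro k
    rw [hZ k.succ 0, hr, raise_asdTwoForm_zero_succ hs hd]; ring
  simp only [Fin.sum_univ_succ (n := 3), h0, raise_asdTwoForm_zero_succ hs hd,
    raise_asdTwoForm_succ_succ hs hd, hs0, Finset.sum_add_distrib]
  have : ∑ k : Fin 3, ∑ l : Fin 3, Z k.succ l.succ * -epsUp g i k l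
      = -∑ k, ∑ l, epsUp g i k l * Z k.succ l.succ := by
    rw [← Finset.sum_neg_distrib]
    refine Finset.sum_congr rfl fun p _ => ?_
    rw [← Finset.sum_neg_distrib]
    exact Finset.sum_congr rfl fun q _ => by ring
  rw [this]
  simp
  ring

/-- `dt ∧ ∂ᵢ♭ - *∂ᵢ♭` is anti-self-dual. -/
theorem hodgeStar_asdTwoForm (hs : ∀ i j, g i j = g j i) (hd : 0 < g.det)
    (i : Fin 3) (a b : Fin 4) :
    hodgeStar (cylMatrix g) (asdTwoForm g (fun p => g i p)) a b
      = -asdTwoForm g (fun p => g i p) a b := by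
  have h : ∀ a b, hodgeStar (cylMatrix g) (asdTwoForm g (fun p => g i p)) a b
      = Real.sqrt g.det * altSymbol ![a, b, 0, i.succ] - (1 / 2) * ∑ k, ∑ l, epsUp g i k l
          * (Real.sqrt g.det * altSymbol ![a, b, k.succ, l.succ]) := by
    intro a b
    unfold hodgeStar
    rw [sum_mul_raise_asdTwoForm hs hd fun c d => by rw [altSymbol_swap_last]; ring,
      cylMatrix_det]
    ring
  have e0 : ∀ c d, altSymbol ![(0 : Fin 4), 0, c, d] = 0 := fun c d => by
    have := altSymbol_swap_first 0 0 c d; linarith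
  have e1 : ∀ k c : Fin 3, altSymbol ![0, k.succ, 0, c.succ] = 0 := fun k c => by
    have h1 := altSymbol_comp_perm ![0, k.succ, 0, c.succ] (Equiv.swap 0 2)
    have e : ![0, k.succ, 0, c.succ] ∘ (Equiv.swap 0 2 : Equiv.Perm (Fin 4))
        = ![0, k.succ, 0, c.succ] := by
      funext r; fin_cases r <;> rfl
    rw [e, Equiv.Perm.sign_swap (by decide)] at h1
    push_cast at h1
    linarith
  have e2 : ∀ k : Fin 3, hodgeStar (cylMatrix g) (asdTwoForm g (fun p => g i p)) 0 k.succ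
      = -asdTwoForm g (fun p => g i p) 0 k.succ := by
    intro k
    rw [h, e1]
    simp only [altSymbol_zero_succ, asdTwoForm, Fin.cases_zero, Fin.cases_succ]
    rw [← eps_contract_two hs hd k i]
    simp only [mul_comm (epsUp g i _ _)]
    ring
  refine Fin.cases ?_ (fun k => ?_) a <;> refine Fin.cases ?_ (fun l => ?_) b
  · rw [h]
    simp [e0, asdTwoForm]
  · exact e2 l
  · have hh : ∀ a b, hodgeStar (cylMatrix g) (asdTwoForm g (fun p => g i p)) a b
        = -hodgeStar (cylMatrix g) (asdTwoForm g (fun p => g i p)) b a := by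
      intro a b
      unfold hodgeStar
      simp only [altSymbol_swap_first a b, mul_neg, neg_mul, Finset.sum_neg_distrib]
    rw [hh, e2, asdTwoForm_antisymm hs hd, neg_neg]
  · rw [h, altSymbol_swap_pairs _ _ 0, altSymbol_zero_succ, altSymbol_rotate i]
    simp only [altSymbol_succ, asdTwoForm, Fin.cases_succ, starOne_row hs hd]
    simp

end CylAlgebra

section CurvatureComponents

variable {g : Matrix (Fin 3) (Fin 3) ℝ}

/-- The components on `Λ²₋ = T*Y` of a curvature tensor of the cylinder. -/
theorem asdComponents_eq (hs : ∀ i j, g i j = g j i) (hd : 0 < g.det)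
    {P : Fin 4 → Fin 4 → Fin 4 → Fin 4 → ℝ} (hP : CurvSymm P) (i j : Fin 3) :
    asdComponents g P i j = P 0 j.succ 0 i.succ
      - (1 / 2) * ∑ k, ∑ l, epsUp g i k l * P 0 j.succ k.succ l.succ
      - (1 / 2) * ∑ k, ∑ l, epsUp g j k l * P 0 i.succ k.succ l.succ
      + (1 / 4) * ∑ k, ∑ l, ∑ m, ∑ n,
          epsUp g j k l * epsUp g i m n * P k.succ l.succ m.succ n.succ := by
  set X := fun i => raise (cylMatrix g) (asdTwoForm g (fun p => g i p))
  have h1 : ∀ a b, ∑ c, ∑ d, P a b c d * X i c d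
      = 2 * P a b 0 i.succ - ∑ k, ∑ l, epsUp g i k l * P a b k.succ l.succ :=
    fun a b => sum_mul_raise_asdTwoForm hs hd (Z := P a b) (hP.right a b) i
  have h2 : asdComponents g P i j = (1 / 4) * ∑ a, ∑ b,
      (2 * P a b 0 i.succ - ∑ k, ∑ l, epsUp g i k l * P a b k.succ l.succ) * X j a b := by
    simp only [← h1, Finset.sum_mul]
    rfl
  rw [h2, sum_mul_raise_asdTwoForm hs hd]
  · have e1 : ∑ k, ∑ l, epsUp g j k l * (2 * P k.succ l.succ 0 i.succ
          - ∑ m, ∑ n, epsUp g i m n * P k.succ l.succ m.succ n.succ)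
        = 2 * ∑ k, ∑ l, epsUp g j k l * P 0 i.succ k.succ l.succ
          - ∑ k, ∑ l, ∑ m, ∑ n,
            epsUp g j k l * epsUp g i m n * P k.succ l.succ m.succ n.succ := by
      rw [Finset.mul_sum, ← Finset.sum_sub_distrib]
      refine Finset.sum_congr rfl fun k _ => ?_
      rw [Finset.mul_sum, ← Finset.sum_sub_distrib]
      refine Finset.sum_congr rfl fun l _ => ?_
      rw [hP.pair, mul_sub]
      simp only [Finset.mul_sum, mul_assoc]
      ring
    rw [e1]
    ring
  · intro a b
    rw [hP.left]
    have : ∀ k l : Fin 3, epsUp g i k l * P a b k.succ l.succ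
        = -(epsUp g i k l * P b a k.succ l.succ) := fun k l => by rw [hP.left]; ring
    simp only [this, Finset.sum_neg_distrib]
    ring

theorem asdComponents_add_mul (P Q : Fin 4 → Fin 4 → Fin 4 → Fin 4 → ℝ) (r : ℝ) (i j : Fin 3) :
    asdComponents g (fun a b c d => P a b c d + r * Q a b c d) i j
      = asdComponents g P i j + r * asdComponents g Q i j := by
  simp only [asdComponents, curvForm, Matrix.of_apply, add_mul, Finset.sum_add_distrib, mul_add]
  congr 1
  simp only [Finset.mul_sum]
  exact Finset.sum_congr rfl fun _ _ => Finset.sum_congr rfl fun _ _ =>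
    Finset.sum_congr rfl fun _ _ => Finset.sum_congr rfl fun _ _ => by ring

/-- The projection `π₋` applied to both pairs of indices of a curvature-type tensor. -/
def asdProjBoth (G : Matrix (Fin 4) (Fin 4) ℝ) (P : Fin 4 → Fin 4 → Fin 4 → Fin 4 → ℝ)
    (a b c d : Fin 4) : ℝ :=
  asdProj G (fun p q => asdProj G (fun r s => P p q r s) c d) a b

theorem sum_mul_raise_comm {G : Matrix (Fin 4) (Fin 4) ℝ} (hG : ∀ a b, G⁻¹ a b = G⁻¹ b a)
    (θ η : Fin 4 → Fin 4 → ℝ) :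
    ∑ a, ∑ b, θ a b * raise G η a b = ∑ a, ∑ b, raise G θ a b * η a b := by
  have h1 : ∑ a, ∑ b, θ a b * raise G η a b
      = ∑ x : Fin 4 × Fin 4, ∑ y : Fin 4 × Fin 4,
          θ x.1 x.2 * (G⁻¹ x.1 y.1 * G⁻¹ x.2 y.2 * η y.1 y.2) := by
    rw [Fintype.sum_prod_type]
    refine Finset.sum_congr rfl fun a _ => Finset.sum_congr rfl fun b _ => ?_
    rw [raise, Fintype.sum_prod_type]
    simp only [Finset.mul_sum]
  have h2 : ∑ a, ∑ b, raise G θ a b * η a b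
      = ∑ x : Fin 4 × Fin 4, ∑ y : Fin 4 × Fin 4,
          G⁻¹ x.1 y.1 * G⁻¹ x.2 y.2 * θ y.1 y.2 * η x.1 x.2 := by
    rw [Fintype.sum_prod_type]
    refine Finset.sum_congr rfl fun a _ => Finset.sum_congr rfl fun b _ => ?_
    rw [raise, Fintype.sum_prod_type]
    simp only [Finset.sum_mul]
  rw [h1, h2, Finset.sum_comm]
  refine Finset.sum_congr rfl fun x _ => Finset.sum_congr rfl fun y _ => ?_
  rw [hG y.1, hG y.2]; ring

/-- The Hodge star on `2`-forms is self-adjoint. -/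
theorem sum_hodgeStar_mul_raise {G : Matrix (Fin 4) (Fin 4) ℝ}
    (θ η : Fin 4 → Fin 4 → ℝ) :
    ∑ a, ∑ b, hodgeStar G θ a b * raise G η a b
      = ∑ a, ∑ b, raise G θ a b * hodgeStar G η a b := by
  have h1 : ∑ a, ∑ b, hodgeStar G θ a b * raise G η a b
      = ∑ x : Fin 4 × Fin 4, ∑ y : Fin 4 × Fin 4,
          (1 / 2) * (Real.sqrt G.det * altSymbol ![x.1, x.2, y.1, y.2] * raise G θ y.1 y.2)
            * raise G η x.1 x.2 := by
    rw [Fintype.sum_prod_type]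
    refine Finset.sum_congr rfl fun a _ => Finset.sum_congr rfl fun b _ => ?_
    rw [hodgeStar, Fintype.sum_prod_type]
    simp only [Finset.mul_sum, Finset.sum_mul]
  have h2 : ∑ a, ∑ b, raise G θ a b * hodgeStar G η a b
      = ∑ x : Fin 4 × Fin 4, ∑ y : Fin 4 × Fin 4, raise G θ x.1 x.2 * ((1 / 2) *
          (Real.sqrt G.det * altSymbol ![x.1, x.2, y.1, y.2] * raise G η y.1 y.2)) := by
    rw [Fintype.sum_prod_type]
    refine Finset.sum_congr rfl fun a _ => Finset.sum_congr rfl fun b _ => ?_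
    rw [hodgeStar, Fintype.sum_prod_type]
    simp only [Finset.mul_sum]
  rw [h1, h2, Finset.sum_comm]
  refine Finset.sum_congr rfl fun x _ => Finset.sum_congr rfl fun y _ => ?_
  rw [altSymbol_swap_pairs]; ring

/-- The projection `π₋` may be dropped in a pairing with an anti-self-dual form. -/
theorem sum_asdProj_mul_raise (hs : ∀ i j, g i j = g j i) (hd : 0 < g.det)
    (θ : Fin 4 → Fin 4 → ℝ) (i : Fin 3) :
    ∑ a, ∑ b, asdProj (cylMatrix g) θ a b
        * raise (cylMatrix g) (asdTwoForm g (fun p => g i p)) a b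
      = ∑ a, ∑ b, θ a b * raise (cylMatrix g) (asdTwoForm g (fun p => g i p)) a b := by
  have hsymm : ∀ a b, (cylMatrix g)⁻¹ a b = (cylMatrix g)⁻¹ b a := by
    intro a b
    rw [cylMatrix_inv hd.ne']
    refine Fin.cases ?_ (fun k => ?_) a <;> refine Fin.cases ?_ (fun l => ?_) b <;>
      simp [inv_apply_symm hs]
  have h1 := sum_hodgeStar_mul_raise (G := cylMatrix g) θ (asdTwoForm g (fun p => g i p))
  simp only [hodgeStar_asdTwoForm hs hd, mul_neg, Finset.sum_neg_distrib] at h1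
  rw [← sum_mul_raise_comm hsymm] at h1
  simp only [asdProj]
  have : ∀ a b, 1 / 2 * (θ a b - hodgeStar (cylMatrix g) θ a b)
        * raise (cylMatrix g) (asdTwoForm g (fun p => g i p)) a b
      = 1 / 2 * (θ a b * raise (cylMatrix g) (asdTwoForm g (fun p => g i p)) a b)
        - 1 / 2 * (hodgeStar (cylMatrix g) θ a b
          * raise (cylMatrix g) (asdTwoForm g (fun p => g i p)) a b) := fun a b => by ring
  simp only [this, Finset.sum_sub_distrib, ← Finset.mul_sum]
  rw [h1]; ring

/-- The anti-self-dual components see only the anti-self-dual part of a tensor: the projection is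
self-adjoint and fixes `dt ∧ v♭ - *v♭`. -/
theorem asdComponents_asdProjBoth (hs : ∀ i j, g i j = g j i) (hd : 0 < g.det)
    (P : Fin 4 → Fin 4 → Fin 4 → Fin 4 → ℝ) :
    asdComponents g (asdProjBoth (cylMatrix g) P) = asdComponents g P := by
  ext i j
  simp only [asdComponents, Matrix.of_apply, curvForm]
  congr 1
  set X := fun i => raise (cylMatrix g) (asdTwoForm g (fun p => g i p))
  have swap : ∀ F : Fin 4 → Fin 4 → Fin 4 → Fin 4 → ℝ,
      ∑ a, ∑ b, ∑ c, ∑ d, F a b c d = ∑ c, ∑ d, ∑ a, ∑ b, F a b c d := by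
    intro F
    have h1 : ∑ a, ∑ b, ∑ c, ∑ d, F a b c d
        = ∑ x : Fin 4 × Fin 4, ∑ y : Fin 4 × Fin 4, F x.1 x.2 y.1 y.2 := by
      simp only [Fintype.sum_prod_type]
    have h2 : ∑ c, ∑ d, ∑ a, ∑ b, F a b c d
        = ∑ y : Fin 4 × Fin 4, ∑ x : Fin 4 × Fin 4, F x.1 x.2 y.1 y.2 := by
      simp only [Fintype.sum_prod_type]
    rw [h1, h2, Finset.sum_comm]
  have hX := sum_asdProj_mul_raise hs hd
  calc ∑ a, ∑ b, ∑ c, ∑ d, asdProjBoth (cylMatrix g) P a b c d * X i c d * X j a b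
      = ∑ c, ∑ d, (∑ a, ∑ b, asdProjBoth (cylMatrix g) P a b c d * X j a b) * X i c d := by
        rw [swap]
        simp only [Finset.sum_mul]
        exact Finset.sum_congr rfl fun _ _ => Finset.sum_congr rfl fun _ _ =>
          Finset.sum_congr rfl fun _ _ => Finset.sum_congr rfl fun _ _ => by ring
    _ = ∑ c, ∑ d, (∑ a, ∑ b, asdProj (cylMatrix g) (P a b) c d * X j a b) * X i c d := by
        refine Finset.sum_congr rfl fun c _ => Finset.sum_congr rfl fun d _ => ?_
        congr 1
        exact hX (fun p q => asdProj (cylMatrix g) (P p q) c d) j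
    _ = ∑ a, ∑ b, (∑ c, ∑ d, asdProj (cylMatrix g) (P a b) c d * X i c d) * X j a b := by
        simp only [Finset.sum_mul]
        rw [← swap]
        exact Finset.sum_congr rfl fun _ _ => Finset.sum_congr rfl fun _ _ =>
          Finset.sum_congr rfl fun _ _ => Finset.sum_congr rfl fun _ _ => by ring
    _ = ∑ a, ∑ b, (∑ c, ∑ d, P a b c d * X i c d) * X j a b := by
        refine Finset.sum_congr rfl fun a _ => Finset.sum_congr rfl fun b _ => ?_
        congr 1
        exact hX (P a b) i
    _ = _ := by simp only [Finset.sum_mul]; rfl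

/-- If a path of `2`-forms vanishes at `s = 0`, the variation of the projection `π₋` does not
contribute to the derivative of its anti-self-dual part. -/
theorem hasDerivAt_asdProj {G : ℝ → Matrix (Fin 4) (Fin 4) ℝ}
    (hγ : ∀ a b, DifferentiableAt ℝ (fun s => (G s)⁻¹ a b) 0)
    (hσ : DifferentiableAt ℝ (fun s => Real.sqrt (G s).det) 0)
    {θ : ℝ → Fin 4 → Fin 4 → ℝ} {θ' : Fin 4 → Fin 4 → ℝ} (h0 : ∀ a b, θ 0 a b = 0)
    (hθ : ∀ a b, HasDerivAt (fun s => θ s a b) (θ' a b) 0) (a b : Fin 4) :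
    HasDerivAt (fun s => asdProj (G s) (θ s) a b) (asdProj (G 0) θ' a b) 0 := by
  have hmul : ∀ {c u : ℝ → ℝ} {u' : ℝ}, DifferentiableAt ℝ c 0 → u 0 = 0 → HasDerivAt u u' 0 →
      HasDerivAt (fun s => c s * u s) (c 0 * u') 0 := by
    intro c u u' hc hu0 hu
    have := hc.hasDerivAt.mul hu
    rw [hu0, mul_zero, zero_add] at this
    exact this
  have hraise : ∀ c d, HasDerivAt (fun s => raise (G s) (θ s) c d) (raise (G 0) θ' c d) 0 :=
    fun c d => HasDerivAt.fun_sum fun p _ => HasDerivAt.fun_sum fun q _ =>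
      hmul ((hγ c p).fun_mul (hγ d q)) (h0 p q) (hθ p q)
  have hr0 : ∀ c d, raise (G 0) (θ 0) c d = 0 := by
    intro c d
    simp [raise, h0]
  have hstar : HasDerivAt (fun s => hodgeStar (G s) (θ s) a b) (hodgeStar (G 0) θ' a b) 0 :=
    (HasDerivAt.fun_sum fun c _ => HasDerivAt.fun_sum fun d _ =>
      hmul (hσ.mul_const _) (hr0 c d) (hraise c d)).const_mul _
  exact ((hθ a b).sub hstar).const_mul _

theorem hasDerivAt_asdProjBoth {G : ℝ → Matrix (Fin 4) (Fin 4) ℝ}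
    (hγ : ∀ a b, DifferentiableAt ℝ (fun s => (G s)⁻¹ a b) 0)
    (hσ : DifferentiableAt ℝ (fun s => Real.sqrt (G s).det) 0)
    {P : ℝ → Fin 4 → Fin 4 → Fin 4 → Fin 4 → ℝ} {P' : Fin 4 → Fin 4 → Fin 4 → Fin 4 → ℝ}
    (h0 : ∀ a b c d, P 0 a b c d = 0)
    (hP : ∀ a b c d, HasDerivAt (fun s => P s a b c d) (P' a b c d) 0) (a b c d : Fin 4) :
    HasDerivAt (fun s => asdProjBoth (G s) (P s) a b c d) (asdProjBoth (G 0) P' a b c d) 0 := by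
  refine hasDerivAt_asdProj hγ hσ (θ := fun s p q => asdProj (G s) (fun r t => P s p q r t) c d)
    (fun p q => ?_) (fun p q => ?_) a b
  · simp [asdProj, hodgeStar, raise, h0]
  · exact hasDerivAt_asdProj hγ hσ (h0 p q) (hP p q) c d

end CurvatureComponents

section KulkarniNomizu

variable {g : Matrix (Fin 3) (Fin 3) ℝ}

theorem kulkarniNomizu_curvSymm {n : ℕ} {h k : Matrix (Fin n) (Fin n) ℝ}
    (hh : ∀ i j, h i j = h j i) (hk : ∀ i j, k i j = k j i) : CurvSymm (kulkarniNomizu h k) where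
  left a b c d := by unfold kulkarniNomizu; ring
  right a b c d := by unfold kulkarniNomizu; ring
  pair a b c d := by
    unfold kulkarniNomizu
    rw [hh c a, hh d b, hh c b, hh d a, hk c a, hk d b, hk c b, hk d a]; ring

/-- The double contraction of `k ⊚ g` with the volume form in dimension three. -/
theorem eps_eps_kulkarniNomizu (hs : ∀ i j, g i j = g j i) (hd : 0 < g.det)
    {k : Matrix (Fin 3) (Fin 3) ℝ} (hk : ∀ i j, k i j = k j i) (j i : Fin 3) :
    (1 / 4) * ∑ p, ∑ l, ∑ m, ∑ n, epsUp g j p l * epsUp g i m n * kulkarniNomizu k g p l m n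
      = (∑ a, ∑ c, g⁻¹ a c * k a c) * g j i - k j i := by
  have e3 := eps_eps_curv hs hd (kulkarniNomizu_curvSymm hk hs) j i
  have e4 : ∀ b d, ∑ a, ∑ c, g⁻¹ a c * kulkarniNomizu k g a b c d
      = (∑ a, ∑ c, g⁻¹ a c * k a c) * g b d + k b d := by
    intro b d
    have h1 : ∑ a, ∑ c, g⁻¹ a c * g a c = 3 := by
      have : ∀ a, ∑ c, g⁻¹ a c * g a c = 1 := fun a => by
        simpa using (Finset.sum_congr rfl fun c _ => by rw [hs a c]).trans
          (sum_inv_mul_apply hd a a)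
      simp [this]
    have h2 : ∑ a, ∑ c, g⁻¹ a c * (k a d * g b c) = k b d := by
      have : ∀ a, ∑ c, g⁻¹ a c * (k a d * g b c) = k a d * if b = a then 1 else 0 := fun a => by
        rw [← sum_mul_inv_apply hd, Finset.mul_sum]
        exact Finset.sum_congr rfl fun c _ => by rw [inv_apply_symm hs]; ring
      simp [this]
    have h3 : ∑ a, ∑ c, g⁻¹ a c * (k b c * g a d) = k b d := by
      rw [Finset.sum_comm]
      have : ∀ c, ∑ a, g⁻¹ a c * (k b c * g a d) = k b c * if c = d then 1 else 0 := fun c => by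
        rw [← sum_inv_mul_apply hd, Finset.mul_sum]
        exact Finset.sum_congr rfl fun a _ => by rw [inv_apply_symm hs]; ring
      simp [this]
    have h4 : ∀ a c, g⁻¹ a c * kulkarniNomizu k g a b c d
        = g⁻¹ a c * k a c * g b d + k b d * (g⁻¹ a c * g a c) - g⁻¹ a c * (k a d * g b c)
          - g⁻¹ a c * (k b c * g a d) := fun a c => by unfold kulkarniNomizu; ring
    simp only [h4, Finset.sum_sub_distrib, Finset.sum_add_distrib, ← Finset.mul_sum,
      ← Finset.sum_mul, h1, h2, h3]
    ring
  simp only [e4] at e3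
  have e5 : ∀ τ : ℝ, ∑ b, ∑ d, g⁻¹ b d * (τ * g b d + k b d)
      = 3 * τ + ∑ b, ∑ d, g⁻¹ b d * k b d := by
    intro τ
    have h1 : ∑ a, ∑ c, g⁻¹ a c * g a c = 3 := by
      have : ∀ a, ∑ c, g⁻¹ a c * g a c = 1 := fun a => by
        simpa using (Finset.sum_congr rfl fun c _ => by rw [hs a c]).trans
          (sum_inv_mul_apply hd a a)
      simp [this]
    have h2 : ∀ b d, g⁻¹ b d * (τ * g b d + k b d)
        = τ * (g⁻¹ b d * g b d) + g⁻¹ b d * k b d := fun b d => by ring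
    simp only [h2, Finset.sum_add_distrib, ← Finset.mul_sum, h1]
    ring
  rw [e5] at e3
  rw [e3]
  ring

/-- On `Λ²₋` the Kulkarni-Nomizu product `k ⊚ g` acts through the trace of `k`. -/
theorem asdComponents_kulkarniNomizu_metric (hs : ∀ i j, g i j = g j i) (hd : 0 < g.det)
    {k : Matrix (Fin 4) (Fin 4) ℝ} (hk : ∀ i j, k i j = k j i) (i j : Fin 3) :
    asdComponents g (kulkarniNomizu k (cylMatrix g)) i j
      = (k 0 0 + ∑ a, ∑ b, g⁻¹ a b * k a.succ b.succ) * g i j := by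
  have hc : ∀ a b, cylMatrix g a b = cylMatrix g b a := by
    intro a b
    refine Fin.cases ?_ (fun k => ?_) a <;> refine Fin.cases ?_ (fun l => ?_) b <;>
      simp [hs]
  rw [asdComponents_eq hs hd (kulkarniNomizu_curvSymm hk hc)]
  set k₃ : Matrix (Fin 3) (Fin 3) ℝ := fun a b => k a.succ b.succ
  have e1 : ∀ i j : Fin 3, ∑ m, ∑ l, epsUp g i m l
      * kulkarniNomizu k (cylMatrix g) 0 j.succ m.succ l.succ
      = 2 * ∑ m, k 0 m.succ * ∑ l, epsUp g i m l * g l j := by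
    intro i j
    have h1 : ∀ m l : Fin 3, epsUp g i m l
        * kulkarniNomizu k (cylMatrix g) 0 j.succ m.succ l.succ
        = k 0 m.succ * (epsUp g i m l * g l j) + k 0 l.succ * (epsUp g i l m * g m j) := by
      intro m l
      rw [epsUp_antisymm g i l m, hs l j, hs m j]
      simp [kulkarniNomizu]; ring
    simp only [h1, Finset.sum_add_distrib]
    rw [Finset.sum_comm (f := fun m l => k 0 (Fin.succ l) * (epsUp g i l m * g m j))]
    simp only [← Finset.mul_sum]
    ring
  have e2 : ∑ m, k 0 m.succ * ∑ l, epsUp g j m l * g l i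
      = -∑ m, k 0 m.succ * ∑ l, epsUp g i m l * g l j := by
    rw [← Finset.sum_neg_distrib]
    exact Finset.sum_congr rfl fun m _ => by rw [eps_lower_antisymm hd]; ring
  have e3 := eps_eps_kulkarniNomizu hs hd (fun a b => hk a.succ b.succ : ∀ a b, k₃ a b = k₃ b a) j i
  have e7 : kulkarniNomizu k (cylMatrix g) 0 j.succ 0 i.succ = k 0 0 * g j i + k j.succ i.succ := by
    simp [kulkarniNomizu]
  have e8 : (1 / 4) * ∑ p, ∑ l, ∑ m, ∑ n, epsUp g j p l * epsUp g i m n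
        * kulkarniNomizu k (cylMatrix g) p.succ l.succ m.succ n.succ = _ := e3
  rw [e7, e8, e1, e1, e2, hs j i]
  change _ = (k 0 0 + ∑ a, ∑ b, g⁻¹ a b * k₃ a b) * g i j
  rw [show k j.succ i.succ = k₃ j i from rfl]
  ring

/-- The components of `dt² ⊚ k` on `Λ²₋`; here `cylMatrix 0` is `dt²`. -/
theorem asdComponents_kulkarniNomizu_dt (hs : ∀ i j, g i j = g j i) (hd : 0 < g.det)
    {k : Matrix (Fin 4) (Fin 4) ℝ} (hk : ∀ i j, k i j = k j i) (i j : Fin 3) :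
    asdComponents g (kulkarniNomizu (cylMatrix 0) k) i j = k i.succ j.succ := by
  have hc : ∀ a b, cylMatrix 0 a b = cylMatrix 0 b a := by
    intro a b
    refine Fin.cases ?_ (fun k => ?_) a <;> refine Fin.cases ?_ (fun l => ?_) b <;>
      simp
  rw [asdComponents_eq hs hd (kulkarniNomizu_curvSymm hc hk)]
  simp [kulkarniNomizu, hk j.succ]

end KulkarniNomizu

/-! ### First variation of the Ricci tensor -/

section RicciVariation

variable {n : ℕ} {Ω : Set (ℝ × (Fin n → ℝ))}
  {G : ℝ → (Fin n → ℝ) → Matrix (Fin n) (Fin n) ℝ} {x : Fin n → ℝ}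

/-- The part of the variation of `R_{ebcd}` in the direction `h` that involves second
derivatives of `h`; it is the variation of `R^a_{bcd}` with its first index lowered. -/
def lowerRiemannVariation (g h : (Fin n → ℝ) → Matrix (Fin n) (Fin n) ℝ) (x : Fin n → ℝ)
    (e b c d : Fin n) : ℝ :=
  (1 / 2) * (covCovTwo g h x c d b e + covCovTwo g h x c b d e - covCovTwo g h x c e d b
    - covCovTwo g h x d c b e - covCovTwo g h x d b c e + covCovTwo g h x d e c b)

/-- The variation of the Ricci tensor of `g` in the direction `h`. -/
def ricciVariation (g h : (Fin n → ℝ) → Matrix (Fin n) (Fin n) ℝ) (x : Fin n → ℝ)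
    (b d : Fin n) : ℝ :=
  ∑ a, ∑ e, (g x)⁻¹ a e * lowerRiemannVariation g h x e b a d

/-- The variation of the scalar curvature of `g` in the direction `h`. -/
def scalarVariation (g h : (Fin n → ℝ) → Matrix (Fin n) (Fin n) ℝ) (x : Fin n → ℝ) : ℝ :=
  ∑ i, ∑ j, ((g x)⁻¹ i j * ricciVariation g h x i j
    - (∑ a, ∑ b, (g x)⁻¹ i a * h x a b * (g x)⁻¹ b j) * ricci g x i j)

theorem MetricFamily.hasDerivAt_inv (hG : MetricFamily Ω G) (hx : x ∈ slice Ω 0) (i j : Fin n) :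
    HasDerivAt (fun s => (G s x)⁻¹ i j)
      (-∑ a, ∑ b, (G 0 x)⁻¹ i a * velocity G x a b * (G 0 x)⁻¹ b j) 0 := by
  have hg := hG.metricOn 0
  have hI : ∀ i j, HasDerivAt (fun s => (G s x)⁻¹ i j) (vel (fun s z => (G s z)⁻¹ i j) x) 0 :=
    fun i j => hasDerivAt_vel (F := fun s z => (G s z)⁻¹ i j)
      (smooth_inv hG.smooth hG.det_ne i j) hG.isOpen hx
  have h1 : ∀ a, ∑ b, (velocity G x a b * (G 0 x)⁻¹ b j
      + G 0 x a b * vel (fun s z => (G s z)⁻¹ b j) x) = 0 := by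
    intro a
    have h2 : HasDerivAt (fun s => ∑ b, G s x a b * (G s x)⁻¹ b j)
        (∑ b, (velocity G x a b * (G 0 x)⁻¹ b j
          + G 0 x a b * vel (fun s z => (G s z)⁻¹ b j) x)) 0 :=
      HasDerivAt.fun_sum fun b _ => (hG.hasDerivAt hx a b).mul (hI b j)
    refine h2.unique ((hasDerivAt_const (0 : ℝ) (if a = j then (1 : ℝ) else 0)).congr_of_eventuallyEq
      ?_)
    filter_upwards [hG.eventually_mem hx] with s hs using (hG.metricOn s).sum_mul_inv hs a j
  have h3 : ∑ a, (G 0 x)⁻¹ i a * ∑ b, G 0 x a b * vel (fun s z => (G s z)⁻¹ b j) x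
      = vel (fun s z => (G s z)⁻¹ i j) x := by
    have : ∑ a, (G 0 x)⁻¹ i a * ∑ b, G 0 x a b * vel (fun s z => (G s z)⁻¹ b j) x
        = ∑ b, (∑ a, (G 0 x)⁻¹ i a * G 0 x a b) * vel (fun s z => (G s z)⁻¹ b j) x := by
      simp only [Finset.mul_sum, Finset.sum_mul]
      rw [Finset.sum_comm]
      exact Finset.sum_congr rfl fun _ _ => Finset.sum_congr rfl fun _ _ => by ring
    rw [this]
    simp [hg.sum_inv_mul hx]
  have h4 : vel (fun s z => (G s z)⁻¹ i j) x
      = -∑ a, ∑ b, (G 0 x)⁻¹ i a * velocity G x a b * (G 0 x)⁻¹ b j := by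
    rw [← h3, ← Finset.sum_neg_distrib]
    refine Finset.sum_congr rfl fun a _ => ?_
    have h5 := h1 a
    rw [Finset.sum_add_distrib] at h5
    rw [eq_neg_of_add_eq_zero_right h5, mul_neg, Finset.mul_sum]
    congr 1
    exact Finset.sum_congr rfl fun b _ => by ring
  rw [← h4]
  exact hI i j

theorem MetricFamily.hasDerivAt_ricci (hG : MetricFamily Ω G) (hx : x ∈ slice Ω 0)
    (b d : Fin n) :
    HasDerivAt (fun s => ricci (G s) x b d) (ricciVariation (G 0) (velocity G) x b d) 0 := by
  have hg := hG.metricOn 0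
  have h1 : HasDerivAt (fun s => ricci (G s) x b d) (∑ a, velRiemannUp G x a b a d) 0 := by
    simp only [ricci, Matrix.of_apply]
    exact HasDerivAt.fun_sum fun a _ => hG.hasDerivAt_riemannUp hx a b a d
  have h2 : ∑ a, velRiemannUp G x a b a d = ricciVariation (G 0) (velocity G) x b d := by
    unfold ricciVariation
    refine Finset.sum_congr rfl fun a _ => ?_
    simp only [lowerRiemannVariation, ← hG.lower_velRiemannUp hx, Finset.mul_sum]
    rw [Finset.sum_comm]
    simp only [← mul_assoc, ← Finset.sum_mul, hg.sum_inv_mul hx]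
    simp
  rw [← h2]
  exact h1

theorem MetricFamily.hasDerivAt_scalar (hG : MetricFamily Ω G) (hx : x ∈ slice Ω 0) :
    HasDerivAt (fun s => scalar (G s) x) (scalarVariation (G 0) (velocity G) x) 0 := by
  unfold scalar tr scalarVariation
  refine HasDerivAt.fun_sum fun i _ => HasDerivAt.fun_sum fun j _ => ?_
  refine ((hG.hasDerivAt_inv hx i j).mul (hG.hasDerivAt_ricci hx i j)).congr_deriv ?_
  ring

theorem MetricFamily.hasDerivAt_tracelessRicci (hG : MetricFamily Ω G) (hx : x ∈ slice Ω 0)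
    (i j : Fin n) :
    HasDerivAt (fun s => tracelessRicci (G s) x i j)
      (ricciVariation (G 0) (velocity G) x i j
        - (1 / (n : ℝ)) * (scalarVariation (G 0) (velocity G) x * G 0 x i j
          + scalar (G 0) x * velocity G x i j)) 0 := by
  have h := (hG.hasDerivAt_ricci hx i j).sub
    (((hG.hasDerivAt_scalar hx).const_mul (1 / (n : ℝ))).mul (hG.hasDerivAt hx i j))
  refine h.congr_deriv ?_
  ring

/-- The variation of the curvature tensor. The second term comes from lowering the first index with
the varying metric. -/
theorem MetricFamily.hasDerivAt_riemann (hG : MetricFamily Ω G) (hx : x ∈ slice Ω 0)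
    (e b c d : Fin n) :
    HasDerivAt (fun s => riemann (G s) x e b c d)
      (lowerRiemannVariation (G 0) (velocity G) x e b c d
        + ∑ a, velocity G x e a * riemannUp (G 0) x a b c d) 0 := by
  have h1 : HasDerivAt (fun s => riemann (G s) x e b c d)
      (∑ a, (velocity G x e a * riemannUp (G 0) x a b c d
        + G 0 x e a * velRiemannUp G x a b c d)) 0 :=
    HasDerivAt.fun_sum fun a _ => (hG.hasDerivAt hx e a).mul (hG.hasDerivAt_riemannUp hx a b c d)
  rw [Finset.sum_add_distrib, hG.lower_velRiemannUp hx] at h1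
  refine h1.congr_deriv ?_
  unfold lowerRiemannVariation
  ring

/-- A smooth path of symmetric matrix-valued functions is a family of metrics on the set of pairs at
which it is nondegenerate. -/
theorem metricFamily_of_smooth {U : Set (Fin n → ℝ)} {S : Set ℝ} (hU : IsOpen U) (hS : IsOpen S)
    (hsm : ∀ i j, ContDiffOn ℝ ∞ (fun q : ℝ × (Fin n → ℝ) => G q.1 q.2 i j) (S ×ˢ U))
    (hsymm : ∀ s ∈ S, ∀ y ∈ U, ∀ i j, G s y i j = G s y j i) :
    MetricFamily {q ∈ S ×ˢ U | (G q.1 q.2).det ≠ 0} G where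
  isOpen := by
    have := (smooth_det hsm).continuousOn.isOpen_inter_preimage (hS.prod hU)
      (isOpen_compl_singleton (x := (0 : ℝ)))
    exact this
  smooth i j := (hsm i j).mono fun q hq => hq.1
  symm q hq := hsymm q.1 hq.1.1 q.2 hq.1.2
  det_ne q hq := hq.2

end RicciVariation

section TracelessRicci

variable {U : Set (Fin 3 → ℝ)} {g h : (Fin 3 → ℝ) → Matrix (Fin 3) (Fin 3) ℝ} {x : Fin 3 → ℝ}

/-- The linearized traceless Ricci tensor in terms of the variations of the Ricci tensor and of the
scalar curvature, computed along the affine path `g + s h`. -/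
theorem MetricOn.linTracelessRicci_eq (hg : MetricOn U g)
    (hh : ∀ i j, ContDiffOn ℝ ∞ (fun y => h y i j) U)
    (hs : ∀ y ∈ U, ∀ i j, h y i j = h y j i) (hx : x ∈ U) (i j : Fin 3) :
    linTracelessRicci g h x i j
      = ricciVariation g h x i j
        - (1 / 3) * (scalarVariation g h x * g x i j + scalar g x * h x i j) := by
  have hF := metricFamily_of_smooth (G := fun s y => g y + s • h y) (S := Set.univ) hg.isOpen
    isOpen_univ (fun i j => by
      have h1 : ContDiffOn ℝ ∞ (fun q : ℝ × (Fin 3 → ℝ) => g q.2 i j) (Set.univ ×ˢ U) :=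
        (hg.smooth i j).comp contDiffOn_snd fun q hq => hq.2
      have h2 : ContDiffOn ℝ ∞ (fun q : ℝ × (Fin 3 → ℝ) => h q.2 i j) (Set.univ ×ˢ U) :=
        (hh i j).comp contDiffOn_snd fun q hq => hq.2
      exact h1.add (contDiffOn_fst.mul h2))
    (fun s _ y hy i j => by simp [hg.symm y hy i j, hs y hy i j])
  have hv : velocity (fun s y => g y + s • h y) = h := by
    funext y
    ext i j
    have : HasDerivAt (fun s : ℝ => g y i j + s * h y i j) (h y i j) 0 := by
      simpa using ((hasDerivAt_id (0 : ℝ)).mul_const (h y i j)).const_add (g y i j)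
    exact this.deriv
  have hx' : x ∈ slice {q ∈ Set.univ ×ˢ U | ((fun s y => g y + s • h y) q.1 q.2).det ≠ 0} 0 := by
    refine ⟨⟨trivial, hx⟩, ?_⟩
    simpa using hg.det_ne x hx
  have hd := hF.hasDerivAt_tracelessRicci hx' i j
  rw [hv] at hd
  simp only [zero_smul, add_zero] at hd
  exact_mod_cast hd.deriv

/-- The derivative of the traceless Ricci tensor along any path of metrics. -/
theorem hasDerivAt_tracelessRicci_of_path {K : ℝ → (Fin 3 → ℝ) → Matrix (Fin 3) (Fin 3) ℝ}
    {S : Set ℝ} (hU : IsOpen U) (hS : IsOpen S) (h0S : (0 : ℝ) ∈ S)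
    (hsm : ∀ i j, ContDiffOn ℝ ∞ (fun q : ℝ × (Fin 3 → ℝ) => K q.1 q.2 i j) (S ×ˢ U))
    (hsymm : ∀ s ∈ S, ∀ y ∈ U, ∀ i j, K s y i j = K s y j i)
    (hdet : ∀ y ∈ U, (K 0 y).det ≠ 0) (hx : x ∈ U) (i j : Fin 3) :
    HasDerivAt (fun s => tracelessRicci (K s) x i j)
      (linTracelessRicci (K 0) (velocity K) x i j) 0 := by
  have hF := metricFamily_of_smooth hU hS hsm hsymm
  have hsl : slice {q ∈ S ×ˢ U | (K q.1 q.2).det ≠ 0} 0 = U := by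
    ext y
    exact ⟨fun hy => hy.1.2, fun hy => ⟨⟨h0S, hy⟩, hdet y hy⟩⟩
  have hx' : x ∈ slice {q ∈ S ×ˢ U | (K q.1 q.2).det ≠ 0} 0 := by rw [hsl]; exact hx
  rw [(hF.metricOn 0).linTracelessRicci_eq hF.velocity_smooth (fun y hy => hF.velocity_symm hy)
    hx']
  exact_mod_cast hF.hasDerivAt_tracelessRicci hx' i j

end TracelessRicci

/-! ### Metrics of constant curvature in dimension three -/

section ConstantCurvature

variable {U : Set (Fin 3 → ℝ)} {g h : (Fin 3 → ℝ) → Matrix (Fin 3) (Fin 3) ℝ} {x : Fin 3 → ℝ}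

theorem MetricOn.sum_inv_mul_left (hg : MetricOn U g) (hx : x ∈ U) (u : Fin 3 → ℝ) (b : Fin 3) :
    ∑ a, ∑ e, (g x)⁻¹ a e * (g x b a * u e) = u b := by
  rw [Finset.sum_comm]
  have : ∀ e, ∑ a, (g x)⁻¹ a e * (g x b a * u e) = u e * if b = e then 1 else 0 := fun e => by
    rw [← hg.sum_mul_inv hx, Finset.mul_sum]
    exact Finset.sum_congr rfl fun a _ => by ring
  simp [this]

theorem MetricOn.sum_inv_mul_right (hg : MetricOn U g) (hx : x ∈ U) (u : Fin 3 → ℝ)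
    (d : Fin 3) : ∑ a, ∑ e, (g x)⁻¹ a e * (u a * g x e d) = u d := by
  have : ∀ a, ∑ e, (g x)⁻¹ a e * (u a * g x e d) = u a * if a = d then 1 else 0 := fun e => by
    rw [← hg.sum_inv_mul hx, Finset.mul_sum]
    exact Finset.sum_congr rfl fun a _ => by ring
  simp [this]

theorem MetricOn.tr_metric (hg : MetricOn U g) (hx : x ∈ U) :
    ∑ a, ∑ e, (g x)⁻¹ a e * g x e a = 3 := by
  simp [hg.sum_inv_mul hx]

theorem MetricOn.sum_inv_swap (hg : MetricOn U g) (hx : x ∈ U) (T : Fin 3 → Fin 3 → ℝ) :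
    ∑ a, ∑ e, (g x)⁻¹ a e * T e a = ∑ a, ∑ e, (g x)⁻¹ a e * T a e := by
  rw [Finset.sum_comm]
  exact Finset.sum_congr rfl fun a _ => Finset.sum_congr rfl fun e _ => by
    rw [hg.inv_symm hx]

variable {κ : ℝ}

/-- The curvature of `g` on `U` is constant, equal to `κ`. -/
def ConstCurvOn (U : Set (Fin 3 → ℝ)) (g : (Fin 3 → ℝ) → Matrix (Fin 3) (Fin 3) ℝ) (κ : ℝ) :
    Prop :=
  ∀ y ∈ U, ∀ i j k l, riemann g y i j k l = κ * (g y i k * g y j l - g y i l * g y j k)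

theorem MetricOn.riemannUp_const (hg : MetricOn U g) (hκ : ConstCurvOn U g κ) (hx : x ∈ U)
    (a b c d : Fin 3) :
    riemannUp g x a b c d
      = κ * ((if a = c then 1 else 0) * g x b d - (if a = d then 1 else 0) * g x b c) := by
  have h1 : ∑ e, (g x)⁻¹ a e * riemann g x e b c d = riemannUp g x a b c d := by
    have : ∑ e, (g x)⁻¹ a e * riemann g x e b c d
        = ∑ f, (∑ e, (g x)⁻¹ a e * g x e f) * riemannUp g x f b c d := by
      simp only [riemann, Finset.mul_sum, Finset.sum_mul]
      rw [Finset.sum_comm]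
      exact Finset.sum_congr rfl fun _ _ => Finset.sum_congr rfl fun _ _ => by ring
    rw [this]
    simp [hg.sum_inv_mul hx]
  rw [← h1, ← hg.sum_inv_mul hx, ← hg.sum_inv_mul hx]
  simp only [hκ x hx, Fin.sum_univ_three]
  ring

theorem MetricOn.ricci_const (hg : MetricOn U g) (hκ : ConstCurvOn U g κ) (hx : x ∈ U)
    (b d : Fin 3) : ricci g x b d = 2 * κ * g x b d := by
  simp only [ricci, Matrix.of_apply, hg.riemannUp_const hκ hx]
  rw [← Finset.mul_sum, Finset.sum_sub_distrib]
  simp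
  ring

theorem MetricOn.scalar_const (hg : MetricOn U g) (hκ : ConstCurvOn U g κ) (hx : x ∈ U) :
    scalar g x = 6 * κ := by
  have h1 := hg.tr_metric hx
  rw [hg.sum_inv_swap hx (fun a e => g x a e)] at h1
  have h2 : ∀ a e, (g x)⁻¹ a e * (2 * κ * g x a e) = 2 * κ * ((g x)⁻¹ a e * g x a e) :=
    fun a e => by ring
  simp only [scalar, tr, hg.ricci_const hκ hx, h2, ← Finset.mul_sum, h1]
  ring

/-- The commutator term `∇^k∇_d h_{bk} - ∇_d∇^k h_{bk}` in constant curvature. -/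
theorem MetricOn.trace_comm_const (hg : MetricOn U g) (hκ : ConstCurvOn U g κ)
    (hh : ∀ i j, ContDiffOn ℝ ∞ (fun y => h y i j) U)
    (hs : ∀ y ∈ U, ∀ i j, h y i j = h y j i) (hx : x ∈ U) (b d : Fin 3) :
    ∑ a, ∑ e, (g x)⁻¹ a e * covCovTwo g h x a d b e
      = covOne g (divTwo g h) x d b + 3 * κ * h x b d - κ * tr (g x) (h x) * g x b d := by
  have h1 : ∀ a e, (g x)⁻¹ a e * covCovTwo g h x a d b e
      = (g x)⁻¹ a e * covCovTwo g h x d a e b - κ * g x b d * ((g x)⁻¹ a e * h x a e)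
        + κ * ((g x)⁻¹ a e * (g x b a * h x d e)) - κ * ((g x)⁻¹ a e * (h x b a * g x e d))
        + κ * h x b d * ((g x)⁻¹ a e * g x e a) := by
    intro a e
    have := hg.covCovTwo_comm hh hx a d b e
    simp only [hg.riemannUp_const hκ hx, Finset.sum_add_distrib] at this
    simp only [sub_mul, mul_sub, Finset.sum_sub_distrib, mul_assoc, ite_mul, mul_ite, one_mul,
      zero_mul, mul_zero, Finset.sum_ite_eq', Finset.mem_univ, if_true] at this
    rw [hg.covCovTwo_symm hs hx d a e b]
    linear_combination (g x)⁻¹ a e * this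
  simp only [h1, Finset.sum_add_distrib, Finset.sum_sub_distrib, ← Finset.mul_sum,
    hg.sum_inv_mul_left hx (fun e => h x d e), hg.sum_inv_mul_right hx (fun a => h x b a),
    hg.tr_metric hx, ← hg.covOne_divTwo hh hx, tr]
  rw [hs x hx d b]
  ring

/-- The linearized Ricci tensor in constant curvature. -/
theorem MetricOn.ricciVariation_const (hg : MetricOn U g) (hκ : ConstCurvOn U g κ)
    (hh : ∀ i j, ContDiffOn ℝ ∞ (fun y => h y i j) U)
    (hs : ∀ y ∈ U, ∀ i j, h y i j = h y j i) (hx : x ∈ U) (b d : Fin 3) :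
    ricciVariation g h x b d
      = (1 / 2) * (covOne g (divTwo g h) x d b + covOne g (divTwo g h) x b d
          - roughLaplacian g h x b d
          - covOne g (fun y p => pd p (fun z => tr (g z) (h z)) y) x d b)
        + 3 * κ * h x b d - κ * tr (g x) (h x) * g x b d := by
  have h1 : ∀ a e, (g x)⁻¹ a e * lowerRiemannVariation g h x e b a d
      = (1 / 2) * ((g x)⁻¹ a e * covCovTwo g h x a d b e)
        + (1 / 2) * ((g x)⁻¹ a e * covCovTwo g h x a b d e)
        - (1 / 2) * ((g x)⁻¹ a e * covCovTwo g h x a e b d)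
        - (1 / 2) * ((g x)⁻¹ a e * covCovTwo g h x d a e b)
        - (1 / 2) * ((g x)⁻¹ a e * covCovTwo g h x d b a e)
        + (1 / 2) * ((g x)⁻¹ a e * covCovTwo g h x d e a b) := by
    intro a e
    unfold lowerRiemannVariation
    rw [hg.covCovTwo_symm hs hx a e d b, hg.covCovTwo_symm hs hx d a b e]
    ring
  have h2 := hg.sum_inv_swap hx (fun a e => covCovTwo g h x d a e b)
  simp only [ricciVariation, h1, Finset.sum_add_distrib, Finset.sum_sub_distrib, ← Finset.mul_sum,
    hg.trace_comm_const hκ hh hs hx, hg.hessian_tr hh hx, h2, roughLaplacian, Matrix.of_apply]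
  rw [hg.symm x hx d b, hs x hx d b]
  ring

theorem MetricOn.scalarVariation_const (hg : MetricOn U g) (hκ : ConstCurvOn U g κ) (hx : x ∈ U) :
    scalarVariation g h x = ∑ i, ∑ j, (g x)⁻¹ i j * ricciVariation g h x i j
      - 2 * κ * tr (g x) (h x) := by
  have h1 : ∑ i, ∑ j, (∑ a, ∑ b, (g x)⁻¹ i a * h x a b * (g x)⁻¹ b j) * g x i j
      = tr (g x) (h x) := by
    have e1 : ∀ i, ∑ j, (∑ a, ∑ b, (g x)⁻¹ i a * h x a b * (g x)⁻¹ b j) * g x i j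
        = ∑ a, ∑ b, (g x)⁻¹ i a * h x a b * if b = i then 1 else 0 := by
      intro i
      simp only [← hg.sum_inv_mul hx, Finset.sum_mul, Finset.mul_sum]
      rw [Finset.sum_comm]
      refine Finset.sum_congr rfl fun a _ => ?_
      rw [Finset.sum_comm]
      exact Finset.sum_congr rfl fun b _ => Finset.sum_congr rfl fun j _ => by
        rw [hg.symm x hx i j]; ring
    simp only [e1]
    simp only [mul_ite, mul_one, mul_zero, Finset.sum_ite_eq', Finset.mem_univ, if_true, tr]
    rw [hg.sum_inv_swap hx (fun a e => h x a e)]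
  simp only [scalarVariation, Finset.sum_sub_distrib, hg.ricci_const hκ hx]
  congr 1
  rw [← h1, Finset.mul_sum]
  refine Finset.sum_congr rfl fun i _ => ?_
  rw [Finset.mul_sum]
  exact Finset.sum_congr rfl fun j _ => by ring

/-- The trace-free linearization of the Ricci tensor in constant curvature. -/
theorem MetricOn.linTracelessRicci_const (hg : MetricOn U g) (hκ : ConstCurvOn U g κ)
    (hh : ∀ i j, ContDiffOn ℝ ∞ (fun y => h y i j) U)
    (hs : ∀ y ∈ U, ∀ i j, h y i j = h y j i) (hx : x ∈ U) (i j : Fin 3) :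
    linTracelessRicci g h x i j
      = ricciVariation g h x i j
        - (1 / 3) * ((∑ a, ∑ b, (g x)⁻¹ a b * ricciVariation g h x a b
            - 2 * κ * tr (g x) (h x)) * g x i j + 6 * κ * h x i j) := by
  rw [hg.linTracelessRicci_eq hh hs hx, hg.scalarVariation_const hκ hx, hg.scalar_const hκ hx]

theorem MetricOn.covTwo_sub_mul (hg : MetricOn U g)
    (hh : ∀ i j, ContDiffOn ℝ ∞ (fun y => h y i j) U) {u : (Fin 3 → ℝ) → ℝ}
    (hu : ContDiffOn ℝ ∞ u U) (hx : x ∈ U) (k i j : Fin 3) :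
    covTwo g (fun y => h y - u y • g y) x k i j = covTwo g h x k i j - pd k u x * g x i j := by
  have du := differentiableAt_of_smooth hu hg.isOpen hx
  have e : pd k (fun y => (h y - u y • g y) i j) x
      = pd k (fun y => h y i j) x - (pd k u x * g x i j + u x * pd k (fun y => g y i j) x) := by
    have : (fun y => (h y - u y • g y) i j) = fun y => h y i j - u y * g y i j := by
      funext y; simp
    rw [this, pd_sub (differentiableAt_of_smooth (hh i j) hg.isOpen hx)
      (du.fun_mul (hg.differentiableAt hx i j)), pd_mul du (hg.differentiableAt hx i j)]
  unfold covTwo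
  rw [e, hg.pd_metric hx]
  simp only [Matrix.sub_apply, Matrix.smul_apply, smul_eq_mul, Fin.sum_univ_three]
  ring

theorem MetricOn.covCovTwo_sub_mul (hg : MetricOn U g)
    (hh : ∀ i j, ContDiffOn ℝ ∞ (fun y => h y i j) U) {u : (Fin 3 → ℝ) → ℝ}
    (hu : ContDiffOn ℝ ∞ u U) (hx : x ∈ U) (k l i j : Fin 3) :
    covCovTwo g (fun y => h y - u y • g y) x k l i j
      = covCovTwo g h x k l i j - covOne g (fun y p => pd p u y) x k l * g x i j := by
  have dp := differentiableAt_of_smooth (pd_smooth hu hg.isOpen l) hg.isOpen hx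
  have dc := differentiableAt_of_smooth (hg.covTwo_smooth hh l i j) hg.isOpen hx
  unfold covCovTwo
  rw [pd_congr hg.isOpen hx (fun y hy => hg.covTwo_sub_mul hh hu hy l i j) k,
    pd_sub dc (dp.fun_mul (hg.differentiableAt hx i j)), pd_mul dp (hg.differentiableAt hx i j),
    hg.pd_metric hx]
  simp only [hg.covTwo_sub_mul hh hu hx, covOne, Matrix.of_apply, Fin.sum_univ_three]
  ring

/-- The rough Laplacian commutes with taking the trace-free part. -/
theorem MetricOn.roughLaplacian_tf (hg : MetricOn U g)
    (hh : ∀ i j, ContDiffOn ℝ ∞ (fun y => h y i j) U) (hx : x ∈ U) (i j : Fin 3) :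
    roughLaplacian g (fun y => tf (g y) (h y)) x i j
      = roughLaplacian g h x i j
        - (1 / 3) * tr (g x) (covOne g (fun y p => pd p (fun z => tr (g z) (h z)) y) x)
          * g x i j := by
  have hu := hg.tr_smooth hh
  have e : (fun y => tf (g y) (h y))
      = fun y => h y - ((1 / 3) * tr (g y) (h y)) • g y := by
    funext y; simp [tf]
  have dp : ∀ y ∈ U, ∀ p, pd p (fun z => (1 / 3) * tr (g z) (h z)) y
      = (1 / 3) * pd p (fun z => tr (g z) (h z)) y := fun y hy p =>
    pd_const_mul _ (differentiableAt_of_smooth hu hg.isOpen hy) p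
  have ec : ∀ k l, covOne g (fun y p => pd p (fun z => (1 / 3) * tr (g z) (h z)) y) x k l
      = (1 / 3) * covOne g (fun y p => pd p (fun z => tr (g z) (h z)) y) x k l := by
    intro k l
    simp only [covOne, Matrix.of_apply]
    rw [pd_congr hg.isOpen hx (fun y hy => dp y hy l) k, pd_const_mul _
      (differentiableAt_of_smooth (pd_smooth hu hg.isOpen l) hg.isOpen hx)]
    simp only [dp x hx, Fin.sum_univ_three]
    ring
  have htr : tr (g x) (covOne g (fun y p => pd p (fun z => tr (g z) (h z)) y) x)
      = ∑ k, ∑ l, (g x)⁻¹ k l * covOne g (fun y p => pd p (fun z => tr (g z) (h z)) y) x k l := rfl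
  rw [e, htr]
  simp only [roughLaplacian, Matrix.of_apply,
    hg.covCovTwo_sub_mul hh (contDiffOn_const.mul hu) hx, ec]
  simp only [mul_sub, Finset.sum_sub_distrib, Finset.mul_sum, Finset.sum_mul]
  congr 1
  exact Finset.sum_congr rfl fun _ _ => Finset.sum_congr rfl fun _ _ => by ring

theorem MetricOn.hessian_symm (hg : MetricOn U g) {u : (Fin 3 → ℝ) → ℝ}
    (hu : ContDiffOn ℝ ∞ u U) (hx : x ∈ U) (i j : Fin 3) :
    covOne g (fun y p => pd p u y) x i j = covOne g (fun y p => pd p u y) x j i := by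
  simp only [covOne, Matrix.of_apply, pd_comm hu hg.isOpen hx i j, hg.christoffel_symm hx _ i j]

/-- The linearized traceless Ricci tensor in constant curvature, in terms of the rough
Laplacian. -/
theorem MetricOn.linTracelessRicci_eq_laplacian (hg : MetricOn U g) (hκ : ConstCurvOn U g κ)
    (hh : ∀ i j, ContDiffOn ℝ ∞ (fun y => h y i j) U)
    (hs : ∀ y ∈ U, ∀ i j, h y i j = h y j i) (hx : x ∈ U) (i j : Fin 3) :
    linTracelessRicci g h x i j
      = (1 / 2) * confKilling g (divTwo g h) x i j
        - (1 / 4) * confKilling g (fun y p => pd p (fun z => tr (g z) (h z)) y) x i j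
        + κ * tf (g x) (h x) i j
        - (1 / 2) * roughLaplacian g (fun y => tf (g y) (h y)) x i j := by
  set τ := fun y p => pd p (fun z => tr (g z) (h z)) y with hτ
  have h1 : ∑ a, ∑ b, (g x)⁻¹ a b * roughLaplacian g h x a b = tr (g x) (covOne g τ x) := by
    have htr : tr (g x) (covOne g τ x) = ∑ k, ∑ l, (g x)⁻¹ k l * covOne g τ x k l := rfl
    rw [htr]
    simp only [hτ, hg.hessian_tr hh hx, roughLaplacian, Matrix.of_apply]
    simp only [Fin.sum_univ_three]
    ring
  have hess : covOne g τ x i j = covOne g τ x j i := hg.hessian_symm (hg.tr_smooth hh) hx i j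
  have h2 : ∑ a, ∑ b, (g x)⁻¹ a b * ricciVariation g h x a b
      = tr (g x) (covOne g (divTwo g h) x) - tr (g x) (covOne g τ x) := by
    have e : ∀ a b, (g x)⁻¹ a b * ricciVariation g h x a b
        = (1 / 2) * ((g x)⁻¹ a b * covOne g (divTwo g h) x b a)
          + (1 / 2) * ((g x)⁻¹ a b * covOne g (divTwo g h) x a b)
          - (1 / 2) * ((g x)⁻¹ a b * roughLaplacian g h x a b)
          - (1 / 2) * ((g x)⁻¹ a b * covOne g τ x b a)
          + 3 * κ * ((g x)⁻¹ a b * h x a b)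
          - κ * tr (g x) (h x) * ((g x)⁻¹ a b * g x b a) := by
      intro a b
      rw [hg.ricciVariation_const hκ hh hs hx, hg.symm x hx b a]
      ring
    simp only [e, Finset.sum_add_distrib, Finset.sum_sub_distrib, ← Finset.mul_sum,
      hg.tr_metric hx, h1, hg.sum_inv_swap hx (fun a e => covOne g τ x a e),
      hg.sum_inv_swap hx (fun a e => covOne g (divTwo g h) x a e)]
    unfold tr
    ring
  rw [hg.linTracelessRicci_const hκ hh hs hx, h2, hg.ricciVariation_const hκ hh hs hx,
    hg.roughLaplacian_tf hh hx]
  simp only [confKilling, Matrix.of_apply, tf, Matrix.sub_apply, Matrix.smul_apply, smul_eq_mul,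
    ← hτ, hess]
  push_cast
  ring

end ConstantCurvature

/-! ### Covariant derivatives on the cylinder -/

section Cylinder

/-- The point `(t, x)` of `ℝ × ℝ³ = ℝ⁴`. -/
abbrev cons4 (t : ℝ) (x : Fin 3 → ℝ) : Fin 4 → ℝ := Fin.cons (α := fun _ => ℝ) t x

/-- The coordinates on the cross-section of a point of `ℝ⁴`. -/
abbrev tail4 (z : Fin 4 → ℝ) : Fin 3 → ℝ := Fin.tail (α := fun _ => ℝ) z

/-- The cylinder `ℝ × U` over a coordinate domain. -/
def cylDomain (U : Set (Fin 3 → ℝ)) : Set (Fin 4 → ℝ) := {z | tail4 z ∈ U}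

theorem cons4_tail4 (z : Fin 4 → ℝ) : cons4 (z 0) (tail4 z) = z := Fin.cons_self_tail z

theorem contDiff_tail4 : ContDiff ℝ ∞ tail4 :=
  contDiff_pi.2 fun i => contDiff_apply ℝ ℝ i.succ

theorem contDiff_cons4 (t : ℝ) : ContDiff ℝ ∞ (cons4 t) := by
  refine contDiff_pi.2 fun a => ?_
  refine Fin.cases ?_ (fun i => ?_) a
  · exact contDiff_const
  · exact contDiff_apply ℝ ℝ i

theorem isOpen_cylDomain {U : Set (Fin 3 → ℝ)} (hU : IsOpen U) : IsOpen (cylDomain U) :=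
  hU.preimage contDiff_tail4.continuous

theorem pd_succ {F : (Fin 4 → ℝ) → ℝ} {t : ℝ} {x : Fin 3 → ℝ}
    (hF : DifferentiableAt ℝ F (cons4 t x)) (i : Fin 3) :
    pd i.succ F (cons4 t x) = pd i (fun y => F (cons4 t y)) x := by
  have h1 : HasFDerivAt (cons4 t) (fderiv ℝ (cons4 t) x) x :=
    ((contDiff_cons4 t).differentiable (by simp)).differentiableAt.hasFDerivAt
  have h2 : fderiv ℝ (cons4 t) x (Pi.single i 1) = Pi.single i.succ 1 := by
    have h3 : ∀ a, HasFDerivAt (fun y => cons4 t y a)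
        ((ContinuousLinearMap.proj a).comp (fderiv ℝ (cons4 t) x)) x :=
      fun a => hasFDerivAt_pi'.1 h1 a
    funext a
    refine Fin.cases ?_ (fun j => ?_) a
    · have := (h3 0).unique (hasFDerivAt_const t x)
      simpa using congrArg (fun L => L (Pi.single i 1)) this
    · have := (h3 j.succ).unique (hasFDerivAt_apply j x)
      have h4 := congrArg (fun L => L (Pi.single i 1)) this
      simp only [ContinuousLinearMap.comp_apply, ContinuousLinearMap.proj_apply] at h4
      rw [h4]
      by_cases hij : i = j
      · subst hij; simp
      · rw [Pi.single_eq_of_ne (Ne.symm hij), Pi.single_eq_of_ne]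
        exact fun h => hij (Fin.succ_injective _ h).symm
  have h5 : HasFDerivAt (fun y => F (cons4 t y)) _ x := hF.hasFDerivAt.comp x h1
  rw [pd, pd, h5.fderiv, ContinuousLinearMap.comp_apply, h2]

theorem hasDerivAt_cons4 {F : (Fin 4 → ℝ) → ℝ} {t : ℝ} {x : Fin 3 → ℝ}
    (hF : DifferentiableAt ℝ F (cons4 t x)) :
    HasDerivAt (fun s => F (cons4 s x)) (pd 0 F (cons4 t x)) t := by
  have h1 : HasDerivAt (fun s => cons4 s x) (Pi.single 0 1) t := by
    refine hasDerivAt_pi.2 fun a => ?_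
    refine Fin.cases ?_ (fun j => ?_) a
    · rw [Pi.single_eq_same]
      exact hasDerivAt_id t
    · simpa using hasDerivAt_const t (x j)
  exact hF.hasFDerivAt.comp_hasDerivAt t h1

theorem pd_zero {F : (Fin 4 → ℝ) → ℝ} {t : ℝ} {x : Fin 3 → ℝ}
    (hF : DifferentiableAt ℝ F (cons4 t x)) :
    pd 0 F (cons4 t x) = deriv (fun s => F (cons4 s x)) t :=
  (hasDerivAt_cons4 hF).deriv.symm

/-- The product metric `dt² + g` in coordinates. -/
abbrev cylMetric (g : (Fin 3 → ℝ) → Matrix (Fin 3) (Fin 3) ℝ) (z : Fin 4 → ℝ) :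
    Matrix (Fin 4) (Fin 4) ℝ := cylMatrix (g (tail4 z))

variable {U : Set (Fin 3 → ℝ)} {g : (Fin 3 → ℝ) → Matrix (Fin 3) (Fin 3) ℝ}
  {k : (Fin 4 → ℝ) → Matrix (Fin 4) (Fin 4) ℝ} {t : ℝ} {x : Fin 3 → ℝ}

theorem smooth_comp_tail4 {f : (Fin 3 → ℝ) → ℝ} (hf : ContDiffOn ℝ ∞ f U) :
    ContDiffOn ℝ ∞ (fun z => f (tail4 z)) (cylDomain U) :=
  hf.comp contDiff_tail4.contDiffOn fun _ hz => hz

theorem smooth_comp_cons4 {F : (Fin 4 → ℝ) → ℝ} (hF : ContDiffOn ℝ ∞ F (cylDomain U)) (t : ℝ) :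
    ContDiffOn ℝ ∞ (fun y => F (cons4 t y)) U :=
  hF.comp (contDiff_cons4 t).contDiffOn fun _ hy => hy

theorem MetricOn.cyl (hg : MetricOn U g) : MetricOn (cylDomain U) (cylMetric g) where
  isOpen := isOpen_cylDomain hg.isOpen
  smooth a b := by
    refine Fin.cases ?_ (fun i => ?_) a <;> refine Fin.cases ?_ (fun j => ?_) b
    · exact contDiffOn_const
    · exact contDiffOn_const
    · exact contDiffOn_const
    · exact smooth_comp_tail4 (hg.smooth i j)
  symm z hz a b := by
    refine Fin.cases ?_ (fun i => ?_) a <;> refine Fin.cases ?_ (fun j => ?_) b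
    · rfl
    · rfl
    · rfl
    · exact hg.symm _ hz i j
  det_ne z hz := by
    rw [cylMetric, cylMatrix_det]
    exact hg.det_ne _ hz

theorem pd_zero_comp_tail4 (f : (Fin 3 → ℝ) → ℝ) {z : Fin 4 → ℝ}
    (hf : DifferentiableAt ℝ (fun z => f (tail4 z)) z) : pd 0 (fun z => f (tail4 z)) z = 0 := by
  rw [← cons4_tail4 z] at hf ⊢
  rw [pd_zero hf]
  simp

theorem MetricOn.cyl_christoffel_zero_up (hg : MetricOn U g) {z : Fin 4 → ℝ}
    (hz : z ∈ cylDomain U) (b c : Fin 4) : christoffel (cylMetric g) z 0 b c = 0 := by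
  unfold christoffel
  rw [Fin.sum_univ_succ, cylMetric, cylMatrix_inv (hg.det_ne _ hz)]
  have h0 : ∀ a c, pd a (fun y => cylMetric g y c 0) z = 0 := by
    intro a c
    refine Fin.cases ?_ (fun j => ?_) c <;> exact pd_const _ _ _
  have h1 : pd 0 (fun y => cylMetric g y b c) z = 0 := by
    refine Fin.cases ?_ (fun i => ?_) b <;> refine Fin.cases ?_ (fun j => ?_) c
    · exact pd_const _ _ _
    · exact pd_const _ _ _
    · exact pd_const _ _ _
    · exact pd_zero_comp_tail4 (fun y => g y i j)
        (differentiableAt_of_smooth (hg.cyl.smooth i.succ j.succ) hg.cyl.isOpen hz)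
  simp [h0, h1]

theorem MetricOn.cyl_christoffel_zero_left (hg : MetricOn U g) {z : Fin 4 → ℝ}
    (hz : z ∈ cylDomain U) (a c : Fin 4) : christoffel (cylMetric g) z a 0 c = 0 := by
  unfold christoffel
  have h0 : ∀ a c, pd a (fun y => cylMetric g y c 0) z = 0 := by
    intro a c
    refine Fin.cases ?_ (fun j => ?_) c <;> exact pd_const _ _ _
  have h2 : ∀ a c, pd a (fun y => cylMetric g y 0 c) z = 0 := by
    intro a c
    refine Fin.cases ?_ (fun j => ?_) c <;> exact pd_const _ _ _
  have h1 : ∀ b c, pd 0 (fun y => cylMetric g y b c) z = 0 := by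
    intro b c
    refine Fin.cases ?_ (fun i => ?_) b <;> refine Fin.cases ?_ (fun j => ?_) c
    · exact pd_const _ _ _
    · exact pd_const _ _ _
    · exact pd_const _ _ _
    · exact pd_zero_comp_tail4 (fun y => g y i j)
        (differentiableAt_of_smooth (hg.cyl.smooth i.succ j.succ) hg.cyl.isOpen hz)
  simp [h1, h2]

theorem MetricOn.cyl_christoffel_zero_right (hg : MetricOn U g) {z : Fin 4 → ℝ}
    (hz : z ∈ cylDomain U) (a b : Fin 4) : christoffel (cylMetric g) z a b 0 = 0 := by
  rw [hg.cyl.christoffel_symm hz, hg.cyl_christoffel_zero_left hz]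

theorem MetricOn.cyl_christoffel_succ (hg : MetricOn U g) {z : Fin 4 → ℝ}
    (hz : z ∈ cylDomain U) (a b c : Fin 3) :
    christoffel (cylMetric g) z a.succ b.succ c.succ = christoffel g (tail4 z) a b c := by
  unfold christoffel
  have h1 : ∀ a b c : Fin 3, pd a.succ (fun y => cylMetric g y b.succ c.succ) z
      = pd a (fun y => g y b c) (tail4 z) := by
    intro a b c
    have hd := differentiableAt_of_smooth (hg.cyl.smooth b.succ c.succ) hg.cyl.isOpen hz
    rw [← cons4_tail4 z] at hd
    have := pd_succ hd a
    rw [cons4_tail4] at this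
    exact this
  rw [Fin.sum_univ_succ]
  simp only [h1]
  rw [cylMetric, cylMatrix_inv (hg.det_ne _ hz)]
  simp

theorem MetricOn.cyl_riemannUp_zero (hg : MetricOn U g) {z : Fin 4 → ℝ} (hz : z ∈ cylDomain U)
    (b c d : Fin 4) : riemannUp (cylMetric g) z 0 b c d = 0 := by
  unfold riemannUp
  have h1 : ∀ p b c, pd p (fun y => christoffel (cylMetric g) y 0 b c) z = 0 := fun p b c => by
    rw [pd_congr hg.cyl.isOpen hz (fun y hy => hg.cyl_christoffel_zero_up hy b c) p, pd_const]
  simp [h1, hg.cyl_christoffel_zero_up hz]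

theorem MetricOn.cyl_riemannUp_zero_second (hg : MetricOn U g) {z : Fin 4 → ℝ}
    (hz : z ∈ cylDomain U) (a c d : Fin 4) : riemannUp (cylMetric g) z a 0 c d = 0 := by
  unfold riemannUp
  have h1 : ∀ p a b, pd p (fun y => christoffel (cylMetric g) y a b 0) z = 0 := fun p a b => by
    rw [pd_congr hg.cyl.isOpen hz (fun y hy => hg.cyl_christoffel_zero_right hy a b) p, pd_const]
  simp [h1, hg.cyl_christoffel_zero_right hz]

theorem MetricOn.cyl_riemannUp_zero_third (hg : MetricOn U g) {z : Fin 4 → ℝ}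
    (hz : z ∈ cylDomain U) (a b d : Fin 4) : riemannUp (cylMetric g) z a b 0 d = 0 := by
  unfold riemannUp
  have h1 : ∀ p a b, pd p (fun y => christoffel (cylMetric g) y a 0 b) z = 0 := fun p a b => by
    rw [pd_congr hg.cyl.isOpen hz (fun y hy => hg.cyl_christoffel_zero_left hy a b) p, pd_const]
  have h2 : pd 0 (fun y => christoffel (cylMetric g) y a d b) z = 0 := by
    refine Fin.cases ?_ (fun a => ?_) a
    · rw [pd_congr hg.cyl.isOpen hz (fun y hy => hg.cyl_christoffel_zero_up hy d b) 0, pd_const]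
    refine Fin.cases ?_ (fun d => ?_) d
    · exact h1 _ _ _
    refine Fin.cases ?_ (fun b => ?_) b
    · rw [pd_congr hg.cyl.isOpen hz
        (fun y hy => hg.cyl_christoffel_zero_right hy a.succ d.succ) 0, pd_const]
    rw [pd_congr hg.cyl.isOpen hz (fun y hy => hg.cyl_christoffel_succ hy a d b) 0]
    exact pd_zero_comp_tail4 _ (differentiableAt_of_smooth
      (smooth_comp_tail4 (hg.christoffel_smooth a d b)) hg.cyl.isOpen hz)
  simp [h1, h2, hg.cyl_christoffel_zero_left hz]

theorem MetricOn.cyl_riemannUp_zero_fourth (hg : MetricOn U g) {z : Fin 4 → ℝ}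
    (hz : z ∈ cylDomain U) (a b c : Fin 4) : riemannUp (cylMetric g) z a b c 0 = 0 := by
  rw [riemannUp_antisymm, hg.cyl_riemannUp_zero_third hz, neg_zero]

/-- A partial derivative along the cross-section of a function on the cylinder that is known on
the slice `{t} × U`. -/
theorem pd_succ_of_slice {F : (Fin 4 → ℝ) → ℝ} (hF : ContDiffOn ℝ ∞ F (cylDomain U))
    (hU : IsOpen U) (hx : x ∈ U) {f : (Fin 3 → ℝ) → ℝ} (hf : ∀ y ∈ U, F (cons4 t y) = f y)
    (i : Fin 3) : pd i.succ F (cons4 t x) = pd i f x := by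
  rw [pd_succ (differentiableAt_of_smooth hF (isOpen_cylDomain hU) hx), pd_congr hU hx hf]

theorem MetricOn.cyl_riemannUp_succ (hg : MetricOn U g) (hx : x ∈ U) (a b c d : Fin 3) :
    riemannUp (cylMetric g) (cons4 t x) a.succ b.succ c.succ d.succ = riemannUp g x a b c d := by
  have hz : cons4 t x ∈ cylDomain U := hx
  have h1 : ∀ p a b c : Fin 3, pd p.succ (fun y => christoffel (cylMetric g) y a.succ b.succ c.succ)
      (cons4 t x) = pd p (fun y => christoffel g y a b c) x := fun p a b c =>
    pd_succ_of_slice (hg.cyl.christoffel_smooth a.succ b.succ c.succ) hg.isOpen hx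
      (fun y hy => hg.cyl_christoffel_succ (z := cons4 t y) hy a b c) p
  unfold riemannUp
  rw [Fin.sum_univ_succ]
  simp [h1, hg.cyl_christoffel_zero_up hz, hg.cyl_christoffel_succ hz]

/-! The first covariant derivatives of a tensor `k` on the cylinder. -/

theorem MetricOn.cyl_covTwo_zero (hg : MetricOn U g) {z : Fin 4 → ℝ} (hz : z ∈ cylDomain U)
    (a b : Fin 4) : covTwo (cylMetric g) k z 0 a b = pd 0 (fun z => k z a b) z := by
  unfold covTwo
  simp [hg.cyl_christoffel_zero_left hz]

theorem MetricOn.cyl_covTwo_succ_zero_zero (hg : MetricOn U g)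
    (hk : ∀ a b, ContDiffOn ℝ ∞ (fun z => k z a b) (cylDomain U)) (hx : x ∈ U) (i : Fin 3) :
    covTwo (cylMetric g) k (cons4 t x) i.succ 0 0 = pd i (fun y => k (cons4 t y) 0 0) x := by
  have hz : cons4 t x ∈ cylDomain U := hx
  unfold covTwo
  simp only [hg.cyl_christoffel_zero_right hz, zero_mul, add_zero, Finset.sum_const_zero, sub_zero]
  exact pd_succ_of_slice (hk 0 0) hg.isOpen hx (fun _ _ => rfl) i

theorem MetricOn.cyl_covTwo_succ_succ_zero (hg : MetricOn U g)
    (hk : ∀ a b, ContDiffOn ℝ ∞ (fun z => k z a b) (cylDomain U)) (hx : x ∈ U) (i j : Fin 3) :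
    covTwo (cylMetric g) k (cons4 t x) i.succ j.succ 0
      = covOne g (fun y p => k (cons4 t y) p.succ 0) x i j := by
  have hz : cons4 t x ∈ cylDomain U := hx
  unfold covTwo
  rw [Fin.sum_univ_succ]
  simp only [hg.cyl_christoffel_zero_right hz, hg.cyl_christoffel_zero_up hz,
    hg.cyl_christoffel_succ hz, zero_mul, add_zero, zero_add, covOne, Matrix.of_apply]
  rw [pd_succ_of_slice (hk j.succ 0) hg.isOpen hx (fun _ _ => rfl) i]
  rfl

theorem MetricOn.cyl_covTwo_succ_succ_succ (hg : MetricOn U g)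
    (hk : ∀ a b, ContDiffOn ℝ ∞ (fun z => k z a b) (cylDomain U)) (hx : x ∈ U) (i j l : Fin 3) :
    covTwo (cylMetric g) k (cons4 t x) i.succ j.succ l.succ
      = covTwo g (fun y => Matrix.of fun p q => k (cons4 t y) p.succ q.succ) x i j l := by
  have hz : cons4 t x ∈ cylDomain U := hx
  unfold covTwo
  rw [Fin.sum_univ_succ]
  simp only [hg.cyl_christoffel_zero_up hz,
    hg.cyl_christoffel_succ hz, zero_mul, add_zero, zero_add, Matrix.of_apply]
  rw [pd_succ_of_slice (hk j.succ l.succ) hg.isOpen hx (fun _ _ => rfl) i]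
  rfl

/-! The second covariant derivatives of a tensor `k` on the cylinder. -/

theorem MetricOn.cyl_covCovTwo_hessian (hg : MetricOn U g)
    (hk : ∀ a b, ContDiffOn ℝ ∞ (fun z => k z a b) (cylDomain U)) (hx : x ∈ U) (i j : Fin 3) :
    covCovTwo (cylMetric g) k (cons4 t x) i.succ j.succ 0 0
      = covOne g (fun y p => pd p (fun z => k (cons4 t z) 0 0) y) x i j := by
  have hz : cons4 t x ∈ cylDomain U := hx
  unfold covCovTwo
  rw [Fin.sum_univ_succ]
  simp only [hg.cyl_christoffel_zero_right hz, hg.cyl_christoffel_zero_up hz,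
    hg.cyl_christoffel_succ hz, zero_mul, add_zero, zero_add, covOne, Matrix.of_apply,
    hg.cyl_covTwo_succ_zero_zero hk hx]
  rw [pd_succ_of_slice (hg.cyl.covTwo_smooth hk _ _ _) hg.isOpen hx
    (fun y hy => hg.cyl_covTwo_succ_zero_zero hk hy j) i]
  rfl

theorem MetricOn.cyl_covCovTwo_mixed (hg : MetricOn U g)
    (hk : ∀ a b, ContDiffOn ℝ ∞ (fun z => k z a b) (cylDomain U)) (hx : x ∈ U) (l i j : Fin 3) :
    covCovTwo (cylMetric g) k (cons4 t x) l.succ i.succ j.succ 0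
      = covCovOne g (fun y p => k (cons4 t y) p.succ 0) x l i j := by
  have hz : cons4 t x ∈ cylDomain U := hx
  unfold covCovTwo covCovOne
  rw [Fin.sum_univ_succ]
  simp only [hg.cyl_christoffel_zero_right hz, hg.cyl_christoffel_zero_up hz,
    hg.cyl_christoffel_succ hz, zero_mul, add_zero, zero_add,
    hg.cyl_covTwo_succ_succ_zero hk hx]
  rw [pd_succ_of_slice (hg.cyl.covTwo_smooth hk _ _ _) hg.isOpen hx
    (fun y hy => hg.cyl_covTwo_succ_succ_zero hk hy i j) l]
  rfl

theorem MetricOn.cyl_covCovTwo_spatial (hg : MetricOn U g)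
    (hk : ∀ a b, ContDiffOn ℝ ∞ (fun z => k z a b) (cylDomain U)) (hx : x ∈ U)
    (l m i j : Fin 3) :
    covCovTwo (cylMetric g) k (cons4 t x) l.succ m.succ i.succ j.succ
      = covCovTwo g (fun y => Matrix.of fun p q => k (cons4 t y) p.succ q.succ) x l m i j := by
  have hz : cons4 t x ∈ cylDomain U := hx
  unfold covCovTwo
  rw [Fin.sum_univ_succ]
  simp only [hg.cyl_christoffel_zero_up hz,
    hg.cyl_christoffel_succ hz, zero_mul, add_zero, zero_add,
    hg.cyl_covTwo_succ_succ_succ hk hx]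
  rw [pd_succ_of_slice (hg.cyl.covTwo_smooth hk _ _ _) hg.isOpen hx
    (fun y hy => hg.cyl_covTwo_succ_succ_succ hk hy m i j) l]
  rfl

theorem MetricOn.cyl_covCovTwo_time (hg : MetricOn U g) {z : Fin 4 → ℝ} (hz : z ∈ cylDomain U)
    (a b : Fin 4) :
    covCovTwo (cylMetric g) k z 0 0 a b = pd 0 (fun y => pd 0 (fun z => k z a b) y) z := by
  unfold covCovTwo
  simp only [hg.cyl_christoffel_zero_left hz, zero_mul, add_zero, Finset.sum_const_zero, sub_zero]
  exact pd_congr hg.cyl.isOpen hz (fun y hy => hg.cyl_covTwo_zero hy a b) 0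

theorem MetricOn.cyl_covCovTwo_space_time (hg : MetricOn U g)
    (hk : ∀ a b, ContDiffOn ℝ ∞ (fun z => k z a b) (cylDomain U)) (hx : x ∈ U) (l i j : Fin 3) :
    covCovTwo (cylMetric g) k (cons4 t x) l.succ 0 i.succ j.succ
      = covTwo g (fun y => Matrix.of fun p q => pd 0 (fun z => k z p.succ q.succ) (cons4 t y))
          x l i j := by
  have hz : cons4 t x ∈ cylDomain U := hx
  have h1 : ∀ y ∈ U, ∀ a b, covTwo (cylMetric g) k (cons4 t y) 0 a b
      = pd 0 (fun z => k z a b) (cons4 t y) :=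
    fun y hy a b => hg.cyl_covTwo_zero (z := cons4 t y) hy a b
  unfold covCovTwo covTwo
  rw [Fin.sum_univ_succ, Fin.sum_univ_succ]
  simp only [hg.cyl_christoffel_zero_right hz, hg.cyl_christoffel_zero_up hz,
    hg.cyl_christoffel_succ hz, zero_mul, add_zero, zero_add, Matrix.of_apply]
  have h2 : pd l.succ (fun y => covTwo (cylMetric g) k y 0 i.succ j.succ) (cons4 t x)
      = pd l (fun y => pd 0 (fun z => k z i.succ j.succ) (cons4 t y)) x :=
    pd_succ_of_slice (hg.cyl.covTwo_smooth hk _ _ _) hg.isOpen hx (fun y hy => h1 y hy _ _) l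
  unfold covTwo at h1 h2
  simp only [h1 x hx]
  rw [h2]
  rfl

theorem MetricOn.cyl_covCovTwo_time_space (hg : MetricOn U g)
    (hk : ∀ a b, ContDiffOn ℝ ∞ (fun z => k z a b) (cylDomain U)) (hx : x ∈ U) (i j : Fin 3) :
    covCovTwo (cylMetric g) k (cons4 t x) 0 i.succ j.succ 0
      = covOne g (fun y p => pd 0 (fun z => k z p.succ 0) (cons4 t y)) x i j := by
  have hz : cons4 t x ∈ cylDomain U := hx
  have hV := hg.cyl.isOpen
  unfold covCovTwo
  simp only [hg.cyl_christoffel_zero_left hz, zero_mul, add_zero, Finset.sum_const_zero, sub_zero]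
  have h1 : ∀ z ∈ cylDomain U, covTwo (cylMetric g) k z i.succ j.succ 0
      = pd i.succ (fun z => k z j.succ 0) z
        - ∑ m, christoffel g (tail4 z) m i j * k z m.succ 0 := by
    intro z hz
    unfold covTwo
    rw [Fin.sum_univ_succ]
    simp only [hg.cyl_christoffel_zero_right hz, hg.cyl_christoffel_zero_up hz,
      hg.cyl_christoffel_succ hz, zero_mul, add_zero, zero_add]
  have dk : ∀ m : Fin 3, DifferentiableAt ℝ (fun z => k z m.succ 0) (cons4 t x) :=
    fun m => differentiableAt_of_smooth (hk m.succ 0) hV hz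
  have dΓ : ∀ m, DifferentiableAt ℝ (fun z => christoffel g (tail4 z) m i j) (cons4 t x) :=
    fun m => differentiableAt_of_smooth (smooth_comp_tail4 (hg.christoffel_smooth m i j)) hV hz
  have dp : DifferentiableAt ℝ (fun z => pd i.succ (fun z => k z j.succ 0) z) (cons4 t x) :=
    differentiableAt_of_smooth (pd_smooth (hk j.succ 0) hV i.succ) hV hz
  rw [pd_congr hV hz h1 0, pd_sub dp (DifferentiableAt.fun_sum fun m _ => (dΓ m).fun_mul (dk m)),
    pd_sum fun m _ => (dΓ m).fun_mul (dk m), pd_comm (hk j.succ 0) hV hz 0 i.succ,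
    pd_succ_of_slice (pd_smooth (hk j.succ 0) hV 0) hg.isOpen hx (fun _ _ => rfl) i]
  simp only [covOne, Matrix.of_apply]
  congr 1
  refine Finset.sum_congr rfl fun m _ => ?_
  rw [pd_mul (dΓ m) (dk m), pd_zero_comp_tail4 (fun y => christoffel g y m i j) (dΓ m), zero_mul,
    zero_add]
  rfl

end Cylinder

/-! ### The operators `*d` and `𝒦` -/

section Star

variable {U : Set (Fin 3 → ℝ)} {g : (Fin 3 → ℝ) → Matrix (Fin 3) (Fin 3) ℝ} {x : Fin 3 → ℝ}

theorem eps_raise {g : Matrix (Fin 3) (Fin 3) ℝ} (hs : ∀ i j, g i j = g j i) (m k l : Fin 3) :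
    ∑ i, g⁻¹ m i * epsUp g i k l = Real.sqrt g.det * (g⁻¹).det * altSymbol ![m, k, l] := by
  have s10 := inv_apply_symm hs 1 0
  have s20 := inv_apply_symm hs 2 0
  have s21 := inv_apply_symm hs 2 1
  rw [Matrix.det_fin_three g⁻¹]
  simp only [epsUp]
  generalize g⁻¹ = γ at *
  fin_cases m <;> fin_cases k <;> fin_cases l <;>
    simp [Fin.sum_univ_three, altSymbol_three, s10, s20, s21] <;> ring

/-- `*dα` is divergence free. The divergence is the contraction of `∇∇α` with the volume form, that is
a cyclic sum of commutators of second derivatives, which vanishes by the Bianchi identity. -/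
theorem MetricOn.tr_covOne_starD (hg : MetricOn U g) (hdet : ∀ y ∈ U, 0 < (g y).det)
    {A : (Fin 3 → ℝ) → Fin 3 → ℝ} (hA : ∀ i, ContDiffOn ℝ ∞ (fun y => A y i) U) (hx : x ∈ U) :
    tr (g x) (covOne g (starD g A) x) = 0 := by
  have h1 : tr (g x) (covOne g (starD g A) x)
      = (1 / 2) * ∑ m, ∑ k, ∑ l, (∑ i, (g x)⁻¹ m i * epsUp (g x) i k l)
          * (covCovOne g A x m k l - covCovOne g A x m l k) := by
    simp only [tr, hg.covOne_starD hdet hA hx, Fin.sum_univ_three]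
    ring
  rw [h1]
  simp only [eps_raise (hg.symm x hx)]
  have c1 := hg.covCovOne_comm hA hx 0 1 2
  have c2 := hg.covCovOne_comm hA hx 1 2 0
  have c3 := hg.covCovOne_comm hA hx 2 0 1
  have b := fun a => hg.bianchi hx a 0 1 2
  have b0 := b 0
  have b1 := b 1
  have b2 := b 2
  generalize Real.sqrt (g x).det * ((g x)⁻¹).det = c
  simp only [Fin.sum_univ_three] at c1 c2 c3 ⊢
  simp [altSymbol_three]
  linear_combination 2 * c * (c1 + c2 + c3) - 2 * c * (A x 0 * b0 + A x 1 * b1 + A x 2 * b2)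

theorem MetricOn.starD_smooth (hg : MetricOn U g) (hdet : ∀ y ∈ U, 0 < (g y).det)
    {A : (Fin 3 → ℝ) → Fin 3 → ℝ} (hA : ∀ i, ContDiffOn ℝ ∞ (fun y => A y i) U) (i : Fin 3) :
    ContDiffOn ℝ ∞ (fun y => starD g A y i) U := by
  unfold starD
  exact contDiffOn_const.mul (ContDiffOn.sum fun k _ => ContDiffOn.sum fun l _ =>
    (hg.epsUp_smooth hdet i k l).mul
      ((pd_smooth (hA l) hg.isOpen k).sub (pd_smooth (hA k) hg.isOpen l)))

theorem MetricOn.covOne_add_mul (hg : MetricOn U g) {θ η : (Fin 3 → ℝ) → Fin 3 → ℝ}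
    (hθ : ∀ i, ContDiffOn ℝ ∞ (fun y => θ y i) U) (hη : ∀ i, ContDiffOn ℝ ∞ (fun y => η y i) U)
    (c : ℝ) (hx : x ∈ U) (i j : Fin 3) :
    covOne g (fun y p => θ y p + c * η y p) x i j = covOne g θ x i j + c * covOne g η x i j := by
  have d1 := differentiableAt_of_smooth (hθ j) hg.isOpen hx
  have d2 := differentiableAt_of_smooth (hη j) hg.isOpen hx
  simp only [covOne, Matrix.of_apply]
  rw [pd_add d1 (d2.const_mul c), pd_const_mul c d2]
  simp only [Fin.sum_univ_three]
  ring

theorem MetricOn.confKilling_add_mul (hg : MetricOn U g) {θ η : (Fin 3 → ℝ) → Fin 3 → ℝ}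
    (hθ : ∀ i, ContDiffOn ℝ ∞ (fun y => θ y i) U) (hη : ∀ i, ContDiffOn ℝ ∞ (fun y => η y i) U)
    (c : ℝ) (hx : x ∈ U) (i j : Fin 3) :
    confKilling g (fun y p => θ y p + c * η y p) x i j
      = confKilling g θ x i j + c * confKilling g η x i j := by
  simp only [confKilling, Matrix.of_apply, tr, hg.covOne_add_mul hθ hη c hx, Fin.sum_univ_three]
  ring

end Star

/-! ### First variation of the curvature of the cylinder -/

section CylVariation

variable {U : Set (Fin 3 → ℝ)} {g : (Fin 3 → ℝ) → Matrix (Fin 3) (Fin 3) ℝ}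
  {k : (Fin 4 → ℝ) → Matrix (Fin 4) (Fin 4) ℝ} {t : ℝ} {x : Fin 3 → ℝ}

/-- The `1`-form part at time `t` of a tensor on the cylinder. -/
def mixedPart (k : (Fin 4 → ℝ) → Matrix (Fin 4) (Fin 4) ℝ) (t : ℝ) (y : Fin 3 → ℝ)
    (p : Fin 3) : ℝ := k (cons4 t y) 0 p.succ

/-- The spatial part at time `t` of a tensor on the cylinder. -/
def spatialPart (k : (Fin 4 → ℝ) → Matrix (Fin 4) (Fin 4) ℝ) (t : ℝ) (y : Fin 3 → ℝ) :
    Matrix (Fin 3) (Fin 3) ℝ := Matrix.of fun p q => k (cons4 t y) p.succ q.succ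

/-- The time derivative of a tensor on the cylinder. -/
def timeDeriv (k : (Fin 4 → ℝ) → Matrix (Fin 4) (Fin 4) ℝ) (z : Fin 4 → ℝ) :
    Matrix (Fin 4) (Fin 4) ℝ := Matrix.of fun a b => pd 0 (fun y => k y a b) z

/-- The variation of `R_{ebcd}` on the cylinder in the direction `k`. -/
def cylRiemannVariation (g : (Fin 3 → ℝ) → Matrix (Fin 3) (Fin 3) ℝ)
    (k : (Fin 4 → ℝ) → Matrix (Fin 4) (Fin 4) ℝ) (z : Fin 4 → ℝ) (e b c d : Fin 4) : ℝ :=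
  lowerRiemannVariation (cylMetric g) k z e b c d
    + ∑ a, k z e a * riemannUp (cylMetric g) z a b c d

/-- The components of the variation of the curvature with two time indices. The curvature of the
cylinder has no such components, so only second derivatives of the direction occur. -/
theorem MetricOn.cylRiemannVariation_time (hg : MetricOn U g)
    (hk : ∀ a b, ContDiffOn ℝ ∞ (fun z => k z a b) (cylDomain U))
    (hs : ∀ z a b, k z a b = k z b a) (hx : x ∈ U) (i j : Fin 3) :
    cylRiemannVariation g k (cons4 t x) 0 j.succ 0 i.succ
      = (1 / 2) * (covOne g (mixedPart (timeDeriv k) t) x i j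
          + covOne g (mixedPart (timeDeriv k) t) x j i
          - spatialPart (timeDeriv (timeDeriv k)) t x i j
          - covOne g (fun y p => pd p (fun z => k (cons4 t z) 0 0) y) x i j) := by
  have hz : cons4 t x ∈ cylDomain U := hx
  have hm : (fun y p => pd 0 (fun z => k z p.succ 0) (cons4 t y))
      = mixedPart (timeDeriv k) t := by
    funext y p
    simp only [mixedPart, timeDeriv, Matrix.of_apply, hs _ (Fin.succ p) 0]
  unfold cylRiemannVariation lowerRiemannVariation
  simp only [hg.cyl_riemannUp_zero_third hz, mul_zero, Finset.sum_const_zero, add_zero]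
  rw [hg.cyl.covCovTwo_symm (fun z _ => hs z) hz i.succ 0 j.succ 0,
    hg.cyl_covCovTwo_time_space hk hx, hg.cyl_covCovTwo_time_space hk hx,
    hg.cyl_covCovTwo_time hz, hg.cyl_covCovTwo_hessian hk hx, hm]
  simp only [spatialPart, timeDeriv, Matrix.of_apply]
  ring

/-- The components of the variation of the curvature with one time index: `½ ∇_j (dα)_{lm}` and the
antisymmetrization of `∇ḣ`. -/
theorem MetricOn.cylRiemannVariation_mixed (hg : MetricOn U g)
    (hk : ∀ a b, ContDiffOn ℝ ∞ (fun z => k z a b) (cylDomain U))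
    (hs : ∀ z a b, k z a b = k z b a) (hx : x ∈ U) (j l m : Fin 3) :
    cylRiemannVariation g k (cons4 t x) 0 j.succ l.succ m.succ
      = (1 / 2) * (covCovOne g (mixedPart k t) x j l m - covCovOne g (mixedPart k t) x j m l)
        - (1 / 2) * (covTwo g (spatialPart (timeDeriv k) t) x l m j
          - covTwo g (spatialPart (timeDeriv k) t) x m l j) := by
  have hz : cons4 t x ∈ cylDomain U := hx
  have hm : (fun y p => k (cons4 t y) (Fin.succ p) 0) = mixedPart k t := by
    funext y p
    rw [mixedPart, hs]
  have hA : ∀ i, ContDiffOn ℝ ∞ (fun y => mixedPart k t y i) U :=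
    fun i => smooth_comp_cons4 (hk 0 i.succ) t
  -- `∇_l ∇_m α_j - ∇_m ∇_l α_j` is a curvature term (`c1`), while `∇_l ∇_j α_m` and `∇_m ∇_j α_l` are
  -- commuted into `∇_j ∇_l α_m` and `∇_j ∇_m α_l` (`c2`, `c3`). By the Bianchi identity (`e2`) the
  -- curvature terms cancel against the zeroth-order term of the variation.
  have c1 := hg.covCovOne_comm hA hx l m j
  have c2 := hg.covCovOne_comm hA hx l j m
  have c3 := hg.covCovOne_comm hA hx m j l
  have e1 : ∑ a, k (cons4 t x) 0 a * riemannUp (cylMetric g) (cons4 t x) a j.succ l.succ m.succ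
      = ∑ a, riemannUp g x a j l m * mixedPart k t x a := by
    rw [Fin.sum_univ_succ, hg.cyl_riemannUp_zero hz, mul_zero, zero_add]
    exact Finset.sum_congr rfl fun a _ => by rw [hg.cyl_riemannUp_succ hx, mixedPart]; ring
  have e2 : ∑ a, riemannUp g x a m l j * mixedPart k t x a
      = ∑ a, riemannUp g x a l m j * mixedPart k t x a
        + ∑ a, riemannUp g x a j l m * mixedPart k t x a := by
    rw [← Finset.sum_add_distrib]
    refine Finset.sum_congr rfl fun a _ => ?_
    have := hg.bianchi hx a j l m
    rw [riemannUp_antisymm a m j l] at this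
    linear_combination -mixedPart k t x a * this
  unfold cylRiemannVariation lowerRiemannVariation
  rw [e1]
  simp only [hg.cyl_covCovTwo_mixed hk hx, hg.cyl_covCovTwo_space_time hk hx, hm]
  have hd : (fun y => Matrix.of fun p q => pd 0 (fun z => k z (Fin.succ p) (Fin.succ q))
      (cons4 t y)) = spatialPart (timeDeriv k) t := rfl
  rw [hd]
  linear_combination (1 / 2) * c1 + (1 / 2) * c2 - (1 / 2) * c3 - (1 / 2) * e2

/-- The spatial components of the variation of the curvature are the variation of the curvature of the
cross-section, because the product connection is trivial in the time direction. -/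
theorem MetricOn.cylRiemannVariation_spatial (hg : MetricOn U g)
    (hk : ∀ a b, ContDiffOn ℝ ∞ (fun z => k z a b) (cylDomain U)) (hx : x ∈ U)
    (i j l m : Fin 3) :
    cylRiemannVariation g k (cons4 t x) i.succ j.succ l.succ m.succ
      = lowerRiemannVariation g (spatialPart k t) x i j l m
        + ∑ a, spatialPart k t x i a * riemannUp g x a j l m := by
  have hz : cons4 t x ∈ cylDomain U := hx
  unfold cylRiemannVariation lowerRiemannVariation
  rw [Fin.sum_univ_succ, hg.cyl_riemannUp_zero hz, mul_zero, zero_add]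
  simp only [hg.cyl_covCovTwo_spatial hk hx, hg.cyl_riemannUp_succ hx]
  rfl

variable {κ : ℝ}

/-- The Ricci tensor of the cylinder is `2κ g`, where `g` is extended by zero: `cylMatrix 0` is `dt²`,
so that `cylMatrix g - cylMatrix 0` is this extension. -/
theorem MetricOn.cyl_ricci (hg : MetricOn U g) (hκ : ConstCurvOn U g κ) (hx : x ∈ U)
    (b d : Fin 4) :
    ricci (cylMetric g) (cons4 t x) b d = 2 * κ * (cylMatrix (g x) b d - cylMatrix 0 b d) := by
  have hz : cons4 t x ∈ cylDomain U := hx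
  have h3 := fun b d => hg.ricci_const hκ hx b d
  simp only [ricci, Matrix.of_apply] at h3 ⊢
  rw [Fin.sum_univ_succ, hg.cyl_riemannUp_zero hz, zero_add]
  refine Fin.cases ?_ (fun b => ?_) b <;> refine Fin.cases ?_ (fun d => ?_) d
  · simp [hg.cyl_riemannUp_zero_second hz]
  · simp [hg.cyl_riemannUp_zero_second hz]
  · simp [hg.cyl_riemannUp_zero_fourth hz]
  · simp [hg.cyl_riemannUp_succ hx, h3]

/-- The trace of a `2`-tensor on the cylinder. -/
theorem MetricOn.cyl_tr (hg : MetricOn U g) (hx : x ∈ U) (T : Fin 4 → Fin 4 → ℝ) :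
    ∑ a, ∑ b, (cylMetric g (cons4 t x))⁻¹ a b * T a b
      = T 0 0 + ∑ a, ∑ b, (g x)⁻¹ a b * T a.succ b.succ := by
  rw [show cylMetric g (cons4 t x) = cylMatrix (g x) from rfl, cylMatrix_inv (hg.det_ne _ hx)]
  simp [Fin.sum_univ_succ (n := 3)]

theorem MetricOn.cyl_scalar (hg : MetricOn U g) (hκ : ConstCurvOn U g κ) (hx : x ∈ U) :
    scalar (cylMetric g) (cons4 t x) = 6 * κ := by
  have h := hg.scalar_const hκ hx
  unfold scalar tr at h ⊢
  rw [hg.cyl_tr hx (fun a b => ricci (cylMetric g) (cons4 t x) a b)]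
  simp only [hg.ricci_const hκ hx] at h
  simp only [hg.cyl_ricci hκ hx]
  simp [← h]

theorem MetricOn.cyl_riemann (hg : MetricOn U g) (hκ : ConstCurvOn U g κ) (hx : x ∈ U)
    (a b c d : Fin 4) :
    riemann (cylMetric g) (cons4 t x) a b c d
      = (κ / 2) * kulkarniNomizu (cylMatrix (g x) - cylMatrix 0) (cylMatrix (g x) - cylMatrix 0)
          a b c d := by
  have hz : cons4 t x ∈ cylDomain U := hx
  have h3 := hκ x hx
  simp only [riemann] at h3 ⊢
  rw [Fin.sum_univ_succ, hg.cyl_riemannUp_zero hz, mul_zero, zero_add]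
  unfold kulkarniNomizu
  refine Fin.cases ?_ (fun b => ?_) b
  · refine Fin.cases ?_ (fun a => ?_) a <;> refine Fin.cases ?_ (fun c => ?_) c <;>
      refine Fin.cases ?_ (fun d => ?_) d <;> simp [hg.cyl_riemannUp_zero_second hz]
  refine Fin.cases ?_ (fun c => ?_) c
  · refine Fin.cases ?_ (fun a => ?_) a <;> simp [hg.cyl_riemannUp_zero_third hz]
  refine Fin.cases ?_ (fun d => ?_) d
  · refine Fin.cases ?_ (fun a => ?_) a <;> simp [hg.cyl_riemannUp_zero_fourth hz]
  refine Fin.cases ?_ (fun a => ?_) a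
  · simp
  · simp [hg.cyl_riemannUp_succ hx, h3]
    ring

theorem MetricOn.cyl_tracelessRicci (hg : MetricOn U g) (hκ : ConstCurvOn U g κ) (hx : x ∈ U) :
    tracelessRicci (cylMetric g) (cons4 t x)
      = (κ / 2) • cylMatrix (g x) - (2 * κ) • cylMatrix 0 := by
  ext a b
  simp only [tracelessRicci, Matrix.sub_apply, Matrix.smul_apply, smul_eq_mul,
    hg.cyl_scalar hκ hx, hg.cyl_ricci hκ hx, show cylMetric g (cons4 t x) = cylMatrix (g x) from rfl]
  push_cast
  ring

/-- The cylinder over a space of constant curvature is conformally flat. -/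
theorem MetricOn.cyl_weyl (hg : MetricOn U g) (hκ : ConstCurvOn U g κ) (hx : x ∈ U)
    (a b c d : Fin 4) : weyl (cylMetric g) (cons4 t x) a b c d = 0 := by
  have hz : ∀ a b c d, kulkarniNomizu (cylMatrix 0) (cylMatrix 0) a b c d = 0 := by
    intro a b c d
    unfold kulkarniNomizu
    refine Fin.cases ?_ (fun a => ?_) a <;> refine Fin.cases ?_ (fun b => ?_) b <;>
      refine Fin.cases ?_ (fun c => ?_) c <;> refine Fin.cases ?_ (fun d => ?_) d <;> simp
  have h0 := hz a b c d
  unfold weyl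
  rw [hg.cyl_riemann hκ hx, hg.cyl_scalar hκ hx, hg.cyl_tracelessRicci hκ hx]
  simp only [kulkarniNomizu, Matrix.sub_apply, Matrix.smul_apply, smul_eq_mul, cylMetric,
    Fin.tail_cons] at h0 ⊢
  linear_combination (κ / 2) * h0

end CylVariation

/-! ### The anti-self-dual part of the variation -/

section WeylVariation

variable {U : Set (Fin 3 → ℝ)} {g : (Fin 3 → ℝ) → Matrix (Fin 3) (Fin 3) ℝ}
  {k : (Fin 4 → ℝ) → Matrix (Fin 4) (Fin 4) ℝ} {t : ℝ} {x : Fin 3 → ℝ} {κ : ℝ}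

/-- The Ricci contraction of the spatial part of the variation of the curvature. It differs from the
variation of the Ricci tensor since the index is raised with the unvaried metric. -/
theorem MetricOn.sum_cylRiemannVariation_spatial (hg : MetricOn U g) (hκ : ConstCurvOn U g κ)
    (hk : ∀ a b, ContDiffOn ℝ ∞ (fun z => k z a b) (cylDomain U))
    (hs : ∀ z a b, k z a b = k z b a) (hx : x ∈ U) (j i : Fin 3) :
    ∑ a, ∑ c, (g x)⁻¹ a c * cylRiemannVariation g k (cons4 t x) a.succ j.succ c.succ i.succ
      = ricciVariation g (spatialPart k t) x j i
        + κ * (tr (g x) (spatialPart k t x) * g x j i - spatialPart k t x j i) := by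
  have hH : spatialPart k t x j i = spatialPart k t x i j := hs _ _ _
  have h1 := hg.sum_inv_mul_right hx (fun a => spatialPart k t x a i) j
  have h3 := hg.sum_inv_swap hx (fun e a => lowerRiemannVariation g (spatialPart k t) x e j a i)
  have h4 : ∀ a c, ∑ m, spatialPart k t x a m * riemannUp g x m j c i
      = κ * (spatialPart k t x a c * g x j i - spatialPart k t x a i * g x c j) := by
    intro a c
    simp only [hg.riemannUp_const hκ hx, hg.symm x hx c j]
    simp only [mul_sub, Finset.sum_sub_distrib, ite_mul, one_mul, zero_mul, mul_ite, mul_zero,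
      Finset.sum_ite_eq', Finset.mem_univ, if_true]
    ring
  simp only [hg.cylRiemannVariation_spatial hk hx, h4, ricciVariation, tr]
  rw [h3]
  simp only [Fin.sum_univ_three] at h1 ⊢
  linear_combination -κ * h1

/-- The trace of the variation of the Ricci tensor of the cylinder. -/
theorem MetricOn.cyl_tr_ricciVariation (hg : MetricOn U g)
    (hk : ∀ a b, ContDiffOn ℝ ∞ (fun z => k z a b) (cylDomain U))
    (hP : CurvSymm (cylRiemannVariation g k (cons4 t x))) (hx : x ∈ U) :
    ∑ a, ∑ b, (cylMetric g (cons4 t x))⁻¹ a b * ricciVariation (cylMetric g) k (cons4 t x) a b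
      = 2 * ∑ a, ∑ b, (g x)⁻¹ a b * cylRiemannVariation g k (cons4 t x) 0 a.succ 0 b.succ
        + ∑ a, ∑ b, (g x)⁻¹ a b * ricciVariation g (spatialPart k t) x a b := by
  have hz : cons4 t x ∈ cylDomain U := hx
  have h0 : lowerRiemannVariation (cylMetric g) k (cons4 t x) 0 0 0 0 = 0 := by
    unfold lowerRiemannVariation
    ring
  have h1 : ∀ a e : Fin 3, lowerRiemannVariation (cylMetric g) k (cons4 t x) e.succ 0 a.succ 0
      = cylRiemannVariation g k (cons4 t x) 0 e.succ 0 a.succ := by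
    intro a e
    rw [hP.left, hP.right, neg_neg, cylRiemannVariation]
    simp [hg.cyl_riemannUp_zero_second hz]
  have h2 : ∀ b d : Fin 3, lowerRiemannVariation (cylMetric g) k (cons4 t x) 0 b.succ 0 d.succ
      = cylRiemannVariation g k (cons4 t x) 0 b.succ 0 d.succ := by
    intro b d
    rw [cylRiemannVariation]
    simp [hg.cyl_riemannUp_zero_third hz]
  have h3 : ∀ e b a d : Fin 3,
      lowerRiemannVariation (cylMetric g) k (cons4 t x) e.succ b.succ a.succ d.succ
        = lowerRiemannVariation g (spatialPart k t) x e b a d := by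
    intro e b a d
    unfold lowerRiemannVariation
    simp only [hg.cyl_covCovTwo_spatial hk hx]
    rfl
  have h4 : ∀ b d : Fin 4, ricciVariation (cylMetric g) k (cons4 t x) b d
      = lowerRiemannVariation (cylMetric g) k (cons4 t x) 0 b 0 d
        + ∑ a, ∑ e, (g x)⁻¹ a e
          * lowerRiemannVariation (cylMetric g) k (cons4 t x) e.succ b a.succ d :=
    fun b d => hg.cyl_tr hx
      (fun a e => lowerRiemannVariation (cylMetric g) k (cons4 t x) e b a d)
  rw [hg.cyl_tr hx (fun a b => ricciVariation (cylMetric g) k (cons4 t x) a b)]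
  simp only [h4, h0, h1, h2, h3]
  rw [hg.sum_inv_swap hx (fun e a => cylRiemannVariation g k (cons4 t x) 0 e.succ 0 a.succ)]
  simp only [mul_add, Finset.sum_add_distrib, ricciVariation]
  ring

/-- The variation of the scalar curvature of the cylinder. -/
theorem MetricOn.cyl_scalarVariation (hg : MetricOn U g) (hκ : ConstCurvOn U g κ) (hx : x ∈ U) :
    scalarVariation (cylMetric g) k (cons4 t x)
      = ∑ a, ∑ b, (cylMetric g (cons4 t x))⁻¹ a b
          * ricciVariation (cylMetric g) k (cons4 t x) a b
        - 2 * κ * tr (g x) (spatialPart k t x) := by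
  have h1 : ∑ i, ∑ j, (∑ a, ∑ b, (cylMetric g (cons4 t x))⁻¹ i a * k (cons4 t x) a b
        * (cylMetric g (cons4 t x))⁻¹ b j) * ricci (cylMetric g) (cons4 t x) i j
      = 2 * κ * tr (g x) (spatialPart k t x) := by
    have h2 : ∀ i a : Fin 3, (g x)⁻¹ i a = (g x)⁻¹ a i := fun i a => hg.inv_symm hx i a
    have h3 : ∀ a b : Fin 3, ∑ i, ∑ j, (g x)⁻¹ i a * (g x)⁻¹ b j * g x i j = (g x)⁻¹ a b := by
      intro a b
      have := hg.sum_inv_mul hx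
      calc ∑ i, ∑ j, (g x)⁻¹ i a * (g x)⁻¹ b j * g x i j
          = ∑ j, (g x)⁻¹ b j * ∑ i, (g x)⁻¹ a i * g x i j := by
            rw [Finset.sum_comm]
            refine Finset.sum_congr rfl fun j _ => ?_
            rw [Finset.mul_sum]
            refine Finset.sum_congr rfl fun i _ => ?_
            rw [h2 i a]
            ring
        _ = (g x)⁻¹ a b := by simp [this, h2 a b]
    simp only [hg.cyl_ricci hκ hx]
    rw [show cylMetric g (cons4 t x) = cylMatrix (g x) from rfl, cylMatrix_inv (hg.det_ne _ hx)]
    simp only [Fin.sum_univ_succ (n := 3), cylMatrix_zero_zero, cylMatrix_zero_succ,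
      cylMatrix_succ_zero, cylMatrix_succ_succ, Matrix.zero_apply, sub_self, sub_zero, mul_zero,
      zero_mul, Finset.sum_const_zero, add_zero, zero_add, tr]
    calc _ = ∑ a, ∑ b, 2 * κ * ((∑ i, ∑ j, (g x)⁻¹ i a * (g x)⁻¹ b j * g x i j)
            * spatialPart k t x a b) := by
          simp only [Fin.sum_univ_three, spatialPart, Matrix.of_apply, h2 1 0, h2 2 0, h2 2 1]
          ring
      _ = _ := by simp only [h3, Finset.mul_sum]
  unfold scalarVariation
  simp only [Finset.sum_sub_distrib, h1]

/-- The anti-self-dual components of the variation of the curvature tensor: the time, mixed and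
spatial components of the variation, in this order, where the mixed ones are contracted once and the
spatial ones twice with the volume form. -/
theorem MetricOn.asdComponents_cylRiemannVariation (hg : MetricOn U g)
    (hdet : ∀ y ∈ U, 0 < (g y).det) (hκ : ConstCurvOn U g κ)
    (hk : ∀ a b, ContDiffOn ℝ ∞ (fun z => k z a b) (cylDomain U))
    (hs : ∀ z a b, k z a b = k z b a)
    (hP : CurvSymm (cylRiemannVariation g k (cons4 t x))) (hx : x ∈ U) (i j : Fin 3) :
    asdComponents (g x) (cylRiemannVariation g k (cons4 t x)) i j
      = cylRiemannVariation g k (cons4 t x) 0 j.succ 0 i.succ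
        - (1 / 2) * (covOne g (starD g (mixedPart k t)) x i j
          + covOne g (starD g (mixedPart k t)) x j i)
        + (1 / 2) * dslash g (spatialPart (timeDeriv k) t) x i j
        + (1 / 2) * (∑ a, ∑ b, (g x)⁻¹ a b * ricciVariation g (spatialPart k t) x a b) * g x i j
        - ricciVariation g (spatialPart k t) x i j + κ * spatialPart k t x i j := by
  have hA : ∀ i, ContDiffOn ℝ ∞ (fun y => mixedPart k t y i) U :=
    fun i => smooth_comp_cons4 (hk 0 i.succ) t
  have hH : ∀ i j, ContDiffOn ℝ ∞ (fun y => spatialPart k t y i j) U :=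
    fun i j => smooth_comp_cons4 (hk i.succ j.succ) t
  have hHs : ∀ y ∈ U, ∀ i j, spatialPart k t y i j = spatialPart k t y j i :=
    fun _ _ _ _ => hs _ _ _
  have hgs := hg.symm x hx
  have hd := hdet x hx
  have hricS : ∀ b d, ricciVariation g (spatialPart k t) x b d
      = ricciVariation g (spatialPart k t) x d b := by
    intro b d
    have hu : ContDiffOn ℝ ∞ (fun z => tr (g z) (spatialPart k t z)) U := hg.tr_smooth hH
    rw [hg.ricciVariation_const hκ hH hHs hx, hg.ricciVariation_const hκ hH hHs hx,
      hg.hessian_symm hu hx d b, hHs x hx b d, hgs b d,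
      show roughLaplacian g (spatialPart k t) x b d = roughLaplacian g (spatialPart k t) x d b by
        simp only [roughLaplacian, Matrix.of_apply, hg.covCovTwo_symm hHs hx _ _ b d]]
    ring
  have hPs : CurvSymm (fun a b c d : Fin 3 =>
      cylRiemannVariation g k (cons4 t x) a.succ b.succ c.succ d.succ) :=
    ⟨fun _ _ _ _ => hP.left _ _ _ _, fun _ _ _ _ => hP.right _ _ _ _,
      fun _ _ _ _ => hP.pair _ _ _ _⟩
  -- The volume form is parallel, so its contraction with `∇dα` is `∇(*dα)`.
  have hmix : ∀ i j : Fin 3, ∑ l, ∑ m, epsUp (g x) i l m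
        * cylRiemannVariation g k (cons4 t x) 0 j.succ l.succ m.succ
      = covOne g (starD g (mixedPart k t)) x j i
        - (1 / 2) * ∑ l, ∑ m, epsUp (g x) i l m * (covTwo g (spatialPart (timeDeriv k) t) x l m j
          - covTwo g (spatialPart (timeDeriv k) t) x m l j) := by
    intro i j
    simp only [hg.cylRiemannVariation_mixed hk hs hx, hg.covOne_starD hdet hA hx, Finset.mul_sum,
      ← Finset.sum_sub_distrib]
    exact Finset.sum_congr rfl fun _ _ => Finset.sum_congr rfl fun _ _ => by ring
  have hsp := eps_eps_curv hgs hd hPs j i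
  simp only [hg.sum_cylRiemannVariation_spatial hκ hk hs hx] at hsp
  have htr : ∑ b, ∑ d, (g x)⁻¹ b d * (ricciVariation g (spatialPart k t) x b d
        + κ * (tr (g x) (spatialPart k t x) * g x b d - spatialPart k t x b d))
      = ∑ b, ∑ d, (g x)⁻¹ b d * ricciVariation g (spatialPart k t) x b d
        + 2 * κ * tr (g x) (spatialPart k t x) := by
    have h3 := hg.tr_metric hx
    have h4 := hg.sum_inv_swap hx (fun a b => g x a b)
    rw [h3] at h4
    have h5 : tr (g x) (spatialPart k t x) = ∑ b, ∑ d, (g x)⁻¹ b d * spatialPart k t x b d := rfl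
    generalize tr (g x) (spatialPart k t x) = τ at *
    simp only [Fin.sum_univ_three] at h4 h5 ⊢
    linear_combination -κ * τ * h4 + κ * h5
  rw [htr] at hsp
  rw [asdComponents_eq hgs hd hP, hmix, hmix, hsp, hricS j i, hHs x hx j i, hgs j i]
  simp only [dslash, Matrix.of_apply]
  ring

/-- The variation of the Weyl tensor of a four-dimensional metric `G` in the direction `k`, where
`P` is the variation of its curvature tensor. -/
def weylVariation (G : (Fin 4 → ℝ) → Matrix (Fin 4) (Fin 4) ℝ)
    (k : (Fin 4 → ℝ) → Matrix (Fin 4) (Fin 4) ℝ) (P : Fin 4 → Fin 4 → Fin 4 → Fin 4 → ℝ)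
    (z : Fin 4 → ℝ) (a b c d : Fin 4) : ℝ :=
  P a b c d
    - (1 / 2) * (kulkarniNomizu (Matrix.of fun a b => ricciVariation G k z a b
        - (1 / 4) * (scalarVariation G k z * G z a b + scalar G z * k z a b)) (G z) a b c d
      + kulkarniNomizu (tracelessRicci G z) (k z) a b c d)
    - (1 / 24) * (scalarVariation G k z * kulkarniNomizu (G z) (G z) a b c d
      + scalar G z * (kulkarniNomizu (k z) (G z) a b c d + kulkarniNomizu (G z) (k z) a b c d))

theorem MetricFamily.hasDerivAt_weyl {Ω : Set (ℝ × (Fin 4 → ℝ))}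
    {G : ℝ → (Fin 4 → ℝ) → Matrix (Fin 4) (Fin 4) ℝ} (hG : MetricFamily Ω G) {z : Fin 4 → ℝ}
    (hz : z ∈ slice Ω 0) (a b c d : Fin 4) :
    HasDerivAt (fun s => weyl (G s) z a b c d)
      (weylVariation (G 0) (velocity G) (fun e b c d =>
        lowerRiemannVariation (G 0) (velocity G) z e b c d
          + ∑ a, velocity G z e a * riemannUp (G 0) z a b c d) z a b c d) 0 := by
  have hE : ∀ a b, HasDerivAt (fun s => tracelessRicci (G s) z a b) _ 0 :=
    fun a b => hG.hasDerivAt_tracelessRicci hz a b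
  have hg : ∀ a b, HasDerivAt (fun s => G s z a b) (velocity G z a b) 0 :=
    fun a b => hG.hasDerivAt hz a b
  have hR := hG.hasDerivAt_scalar hz
  have hK1 : HasDerivAt (fun s => kulkarniNomizu (tracelessRicci (G s) z) (G s z) a b c d) _ 0 :=
    ((((hE a c).mul (hg b d)).add ((hE b d).mul (hg a c))).sub ((hE a d).mul (hg b c))).sub
      ((hE b c).mul (hg a d))
  have hK2 : HasDerivAt (fun s => kulkarniNomizu (G s z) (G s z) a b c d) _ 0 :=
    ((((hg a c).mul (hg b d)).add ((hg b d).mul (hg a c))).sub ((hg a d).mul (hg b c))).sub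
      ((hg b c).mul (hg a d))
  refine (((hG.hasDerivAt_riemann hz a b c d).sub (hK1.const_mul (1 / 2))).sub
    ((hR.div_const 24).mul hK2)).congr_deriv ?_
  simp only [weylVariation, kulkarniNomizu, Matrix.of_apply]
  push_cast
  ring

/-- The variation of the curvature inherits the symmetries of the curvature tensors of the family. -/
theorem MetricFamily.curvSymm_variation {n : ℕ} {Ω : Set (ℝ × (Fin n → ℝ))}
    {G : ℝ → (Fin n → ℝ) → Matrix (Fin n) (Fin n) ℝ} (hG : MetricFamily Ω G) {z : Fin n → ℝ}
    (hz : z ∈ slice Ω 0) :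
    CurvSymm (fun e b c d => lowerRiemannVariation (G 0) (velocity G) z e b c d
      + ∑ a, velocity G z e a * riemannUp (G 0) z a b c d) := by
  have hD := hG.hasDerivAt_riemann hz
  have hev := hG.eventually_mem hz
  refine ⟨fun a b c d => ?_, fun a b c d => ?_, fun a b c d => ?_⟩
  · refine (hD a b c d).unique ((hD b a c d).neg.congr_of_eventuallyEq ?_)
    filter_upwards [hev] with s hs using (hG.metricOn s).riemann_antisymm_left hs a b c d
  · refine (hD a b c d).unique ((hD a b d c).neg.congr_of_eventuallyEq ?_)
    filter_upwards with s using riemann_antisymm_right a b c d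
  · refine (hD a b c d).unique ((hD c d a b).congr_of_eventuallyEq ?_)
    filter_upwards [hev] with s hs using (hG.metricOn s).riemann_pair_symm hs a b c d

theorem MetricOn.ricci_symm {n : ℕ} {V : Set (Fin n → ℝ)}
    {G : (Fin n → ℝ) → Matrix (Fin n) (Fin n) ℝ} (hG : MetricOn V G) {z : Fin n → ℝ} (hz : z ∈ V)
    (b d : Fin n) : ricci G z b d = ricci G z d b := by
  have h1 : ∀ b d, ricci G z b d = ∑ a, ∑ e, (G z)⁻¹ a e * riemann G z e b a d := by
    intro b d
    simp only [ricci, Matrix.of_apply]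
    refine Finset.sum_congr rfl fun a _ => ?_
    calc riemannUp G z a b a d
        = ∑ f, (∑ e, (G z)⁻¹ a e * G z e f) * riemannUp G z f b a d := by
          simp [hG.sum_inv_mul hz]
      _ = _ := by
          simp only [riemann, Finset.mul_sum, Finset.sum_mul]
          rw [Finset.sum_comm]
          exact Finset.sum_congr rfl fun _ _ => Finset.sum_congr rfl fun _ _ => by ring
  rw [h1, h1, Finset.sum_comm]
  refine Finset.sum_congr rfl fun a _ => Finset.sum_congr rfl fun e _ => ?_
  rw [hG.riemann_pair_symm hz, hG.inv_symm hz]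

theorem MetricFamily.ricciVariation_symm {n : ℕ} {Ω : Set (ℝ × (Fin n → ℝ))}
    {G : ℝ → (Fin n → ℝ) → Matrix (Fin n) (Fin n) ℝ} (hG : MetricFamily Ω G) {z : Fin n → ℝ}
    (hz : z ∈ slice Ω 0) (b d : Fin n) :
    ricciVariation (G 0) (velocity G) z b d = ricciVariation (G 0) (velocity G) z d b := by
  refine (hG.hasDerivAt_ricci hz b d).unique
    ((hG.hasDerivAt_ricci hz d b).congr_of_eventuallyEq ?_)
  filter_upwards [hG.eventually_mem hz] with s hs using (hG.metricOn s).ricci_symm hs b d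

/-- The anti-self-dual components of the variation of the Weyl tensor of the cylinder, in a
direction that is traceless at the given point. -/
theorem MetricOn.asdComponents_weylVariation (hg : MetricOn U g)
    (hdet : ∀ y ∈ U, 0 < (g y).det) (hκ : ConstCurvOn U g κ)
    (hs : ∀ z a b, k z a b = k z b a)
    (htr : k (cons4 t x) 0 0 + tr (g x) (spatialPart k t x) = 0)
    (hric : ∀ a b, ricciVariation (cylMetric g) k (cons4 t x) a b
      = ricciVariation (cylMetric g) k (cons4 t x) b a) (hx : x ∈ U) (i j : Fin 3) :
    asdComponents (g x) (weylVariation (cylMetric g) k (cylRiemannVariation g k (cons4 t x))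
        (cons4 t x)) i j
      = asdComponents (g x) (cylRiemannVariation g k (cons4 t x)) i j
        + κ * spatialPart k t x i j - κ * tr (g x) (spatialPart k t x) * g x i j
        - (1 / 6) * scalarVariation (cylMetric g) k (cons4 t x) * g x i j := by
  have hgs := hg.symm x hx
  have hd := hdet x hx
  have hgx : cylMetric g (cons4 t x) = cylMatrix (g x) := rfl
  have hg4 : ∀ a b, cylMatrix (g x) a b = cylMatrix (g x) b a :=
    fun a b => hg.cyl.symm (cons4 t x) hx a b
  set z := cons4 t x with hz
  set S := scalarVariation (cylMetric g) k z with hS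
  set E : Matrix (Fin 4) (Fin 4) ℝ := Matrix.of fun a b => ricciVariation (cylMetric g) k z a b
    - (1 / 4) * (S * cylMetric g z a b + scalar (cylMetric g) z * k z a b) with hE
  have hEs : ∀ a b, E a b = E b a := by
    intro a b
    simp only [hE, Matrix.of_apply, hric a b, hgx, hg4 a b, hs z a b]
  have hT1 := hg.cyl_tr (t := t) hx (fun a b => ricciVariation (cylMetric g) k z a b)
  have hT2 := hg.cyl_scalarVariation (k := k) (t := t) hκ hx
  rw [← hz, ← hS] at hT2
  rw [← hz] at hT1
  have h3 : ∑ a, ∑ b, (g x)⁻¹ a b * g x a b = 3 := by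
    rw [← hg.sum_inv_swap hx (fun a b => g x a b)]
    exact hg.tr_metric hx
  have htrE : E 0 0 + ∑ a, ∑ b, (g x)⁻¹ a b * E a.succ b.succ
      = 2 * κ * tr (g x) (spatialPart k t x) := by
    rw [hT1] at hT2
    simp only [hE, Matrix.of_apply, hg.cyl_scalar hκ hx, hz, cylMatrix_zero_zero,
      cylMatrix_succ_succ, tr, spatialPart, show tail4 (cons4 t x) = x from rfl] at hT2 htr ⊢
    simp only [Fin.sum_univ_three] at hT2 htr h3 ⊢
    linear_combination -hT2 - (S / 4) * h3 - (3 * κ / 2) * htr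
  -- Here `R = 6κ` and the traceless Ricci tensor is `(κ/2) (dt² + g) - 2κ dt²`, so every product in
  -- the variation has the background metric or `dt²` as a factor.
  have hW : weylVariation (cylMetric g) k (cylRiemannVariation g k z) z
      = fun a b c d => ((((cylRiemannVariation g k z a b c d
          + (-(1 / 2)) * kulkarniNomizu E (cylMatrix (g x)) a b c d)
          + (-(3 * κ / 4)) * kulkarniNomizu (k z) (cylMatrix (g x)) a b c d)
          + κ * kulkarniNomizu (cylMatrix 0) (k z) a b c d)
          + (-(S / 24)) * kulkarniNomizu (cylMatrix (g x)) (cylMatrix (g x)) a b c d) := by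
    funext a b c d
    simp only [weylVariation]
    rw [← hS, ← hE, hz, hg.cyl_tracelessRicci hκ hx, hg.cyl_scalar hκ hx, hgx]
    simp only [kulkarniNomizu, Matrix.sub_apply, Matrix.smul_apply, smul_eq_mul]
    ring
  rw [hW, asdComponents_add_mul, asdComponents_add_mul, asdComponents_add_mul,
    asdComponents_add_mul, asdComponents_kulkarniNomizu_metric hgs hd hEs,
    asdComponents_kulkarniNomizu_metric hgs hd (hs z), asdComponents_kulkarniNomizu_metric hgs hd hg4,
    asdComponents_kulkarniNomizu_dt hgs hd (hs z), htrE,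
    show k z 0 0 + ∑ a, ∑ b, (g x)⁻¹ a b * k z a.succ b.succ = 0 from htr]
  simp only [cylMatrix_zero_zero, cylMatrix_succ_succ, h3]
  rw [show k z i.succ j.succ = spatialPart k t x i j from rfl]
  ring

/-- The anti-self-dual components of the variation of the Weyl tensor of the cylinder, in terms of
the linearized traceless Ricci tensor of the cross-section. -/
theorem MetricOn.asdComponents_weylVariation_eq (hg : MetricOn U g)
    (hdet : ∀ y ∈ U, 0 < (g y).det) (hκ : ConstCurvOn U g κ)
    (hk : ∀ a b, ContDiffOn ℝ ∞ (fun z => k z a b) (cylDomain U))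
    (hs : ∀ z a b, k z a b = k z b a)
    (htr : k (cons4 t x) 0 0 + tr (g x) (spatialPart k t x) = 0)
    (hP : CurvSymm (cylRiemannVariation g k (cons4 t x)))
    (hric : ∀ a b, ricciVariation (cylMetric g) k (cons4 t x) a b
      = ricciVariation (cylMetric g) k (cons4 t x) b a) (hx : x ∈ U) (i j : Fin 3) :
    asdComponents (g x) (weylVariation (cylMetric g) k (cylRiemannVariation g k (cons4 t x))
        (cons4 t x)) i j
      = (1 / 2) * confKilling g (fun y p => -(1 / 2) * pd p (fun y => k (cons4 t y) 0 0) y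
            + mixedPart (timeDeriv k) t y p - starD g (mixedPart k t) y p) x i j
        - (1 / 2) * tf (g x) (spatialPart (timeDeriv (timeDeriv k)) t x) i j
        + (1 / 2) * dslash g (spatialPart (timeDeriv k) t) x i j
        - linTracelessRicci g (spatialPart k t) x i j := by
  have hk' : ∀ a b, ContDiffOn ℝ ∞ (fun z => timeDeriv k z a b) (cylDomain U) :=
    fun a b => pd_smooth (hk a b) (isOpen_cylDomain hg.isOpen) 0
  have hf : ∀ p, ContDiffOn ℝ ∞ (fun y => pd p (fun y => k (cons4 t y) 0 0) y) U :=
    fun p => pd_smooth (smooth_comp_cons4 (hk 0 0) t) hg.isOpen p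
  have hA : ∀ i, ContDiffOn ℝ ∞ (fun y => mixedPart k t y i) U :=
    fun i => smooth_comp_cons4 (hk 0 i.succ) t
  have hA' : ∀ i, ContDiffOn ℝ ∞ (fun y => mixedPart (timeDeriv k) t y i) U :=
    fun i => smooth_comp_cons4 (hk' 0 i.succ) t
  have hH : ∀ i j, ContDiffOn ℝ ∞ (fun y => spatialPart k t y i j) U :=
    fun i j => smooth_comp_cons4 (hk i.succ j.succ) t
  have hHs : ∀ y ∈ U, ∀ i j, spatialPart k t y i j = spatialPart k t y j i :=
    fun _ _ _ _ => hs _ _ _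
  have hS := hg.starD_smooth hdet hA
  have hconf : confKilling g (fun y p => -(1 / 2) * pd p (fun y => k (cons4 t y) 0 0) y
        + mixedPart (timeDeriv k) t y p - starD g (mixedPart k t) y p) x i j
      = confKilling g (mixedPart (timeDeriv k) t) x i j
        + (-(1 / 2)) * confKilling g (fun y p => pd p (fun y => k (cons4 t y) 0 0) y) x i j
        + (-1) * confKilling g (starD g (mixedPart k t)) x i j := by
    rw [← hg.confKilling_add_mul hA' hf (-(1 / 2)) hx,
      ← hg.confKilling_add_mul (fun i => (hA' i).add (contDiffOn_const.mul (hf i))) hS (-1) hx]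
    congr 1
    funext y p
    ring
  have ht0 := hg.tr_covOne_starD hdet hA hx
  have htt : ∑ a, ∑ b, (g x)⁻¹ a b * cylRiemannVariation g k (cons4 t x) 0 a.succ 0 b.succ
      = tr (g x) (covOne g (mixedPart (timeDeriv k) t) x)
        - (1 / 2) * tr (g x) (spatialPart (timeDeriv (timeDeriv k)) t x)
        - (1 / 2) * tr (g x) (covOne g (fun y p => pd p (fun y => k (cons4 t y) 0 0) y) x) := by
    simp only [hg.cylRiemannVariation_time hk hs hx, tr]
    have h1 := hg.sum_inv_swap hx (fun a b => covOne g (mixedPart (timeDeriv k) t) x a b)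
    have h2 := hg.sum_inv_swap hx (fun a b => spatialPart (timeDeriv (timeDeriv k)) t x a b)
    have h3 := hg.sum_inv_swap hx
      (fun a b => covOne g (fun y p => pd p (fun y => k (cons4 t y) 0 0) y) x a b)
    simp only [Fin.sum_univ_three] at h1 h2 h3 ⊢
    linear_combination (1 / 2) * h1 - (1 / 2) * h2 - (1 / 2) * h3
  rw [hg.asdComponents_weylVariation hdet hκ hs htr hric hx,
    hg.asdComponents_cylRiemannVariation hdet hκ hk hs hP hx, hg.cyl_scalarVariation hκ hx,
    hg.cyl_tr_ricciVariation hk hP hx, hg.linTracelessRicci_const hκ hH hHs hx, hconf, htt,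
    hg.cylRiemannVariation_time hk hs hx]
  have hh := hg.hessian_symm (smooth_comp_cons4 (hk 0 0) t) hx i j
  simp only [confKilling, tf, Matrix.of_apply, Matrix.sub_apply, Matrix.smul_apply, smul_eq_mul, ht0]
  push_cast
  linear_combination -(1 / 4) * hh

/-- The variation of the anti-self-dual Weyl tensor of the cylinder along a family of metrics with
velocity traceless at the given point. -/
theorem MetricFamily.hasDerivAt_weylMinus_cyl {Ω : Set (ℝ × (Fin 4 → ℝ))}
    {G : ℝ → (Fin 4 → ℝ) → Matrix (Fin 4) (Fin 4) ℝ} (hG : MetricFamily Ω G)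
    (hΩ : slice Ω 0 = cylDomain U) (hG0 : G 0 = cylMetric g) (hg : MetricOn U g)
    (hdet : ∀ y ∈ U, 0 < (g y).det) (hκ : ConstCurvOn U g κ)
    (hs : ∀ z a b, velocity G z a b = velocity G z b a) (hx : x ∈ U)
    (htr : velocity G (cons4 t x) 0 0 + tr (g x) (spatialPart (velocity G) t x) = 0)
    (i j : Fin 3) :
    HasDerivAt (fun s => asdComponents (g x) (weylMinus (G s) (cons4 t x)) i j)
      ((1 / 2) * confKilling g (fun y p => -(1 / 2) * pd p (fun y => velocity G (cons4 t y) 0 0) y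
            + mixedPart (timeDeriv (velocity G)) t y p
            - starD g (mixedPart (velocity G) t) y p) x i j
        - (1 / 2) * tf (g x) (spatialPart (timeDeriv (timeDeriv (velocity G))) t x) i j
        + (1 / 2) * dslash g (spatialPart (timeDeriv (velocity G)) t) x i j
        - linTracelessRicci g (spatialPart (velocity G) t) x i j) 0 := by
  have hz : cons4 t x ∈ slice Ω 0 := by rw [hΩ]; exact hx
  have hk : ∀ a b, ContDiffOn ℝ ∞ (fun z => velocity G z a b) (cylDomain U) := by
    rw [← hΩ]
    exact hG.velocity_smooth
  have hG0z : G 0 (cons4 t x) = cylMatrix (g x) := by rw [hG0]; rfl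
  have hP := hG.curvSymm_variation hz
  have hric := hG.ricciVariation_symm hz
  rw [hG0] at hP hric
  rw [← hg.asdComponents_weylVariation_eq hdet hκ hk hs htr hP hric hx,
    ← asdComponents_asdProjBoth (hg.symm x hx) (hdet x hx), ← hG0, ← hG0z]
  have hσ : DifferentiableAt ℝ (fun s => Real.sqrt (G s (cons4 t x)).det) 0 := by
    have h1 : DifferentiableAt ℝ (fun s => (G s (cons4 t x)).det) 0 := by
      simp only [Matrix.det_apply]
      refine DifferentiableAt.fun_sum fun σ _ => DifferentiableAt.const_smul ?_ _
      exact DifferentiableAt.fun_finsetProd fun a _ => (hG.hasDerivAt hz _ _).differentiableAt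
    refine h1.sqrt ?_
    rw [hG0z, cylMatrix_det]
    exact (hdet x hx).ne'
  have hQ : cylRiemannVariation g (velocity G) (cons4 t x) = fun e b c d =>
      lowerRiemannVariation (G 0) (velocity G) (cons4 t x) e b c d
        + ∑ a, velocity G (cons4 t x) e a * riemannUp (G 0) (cons4 t x) a b c d := by
    rw [hG0]
    rfl
  rw [hQ]
  have hW : ∀ a b c d, HasDerivAt (fun s => weylMinus (G s) (cons4 t x) a b c d) _ 0 :=
    fun a b c d => hasDerivAt_asdProjBoth (G := fun s => G s (cons4 t x))
      (P := fun s => weyl (G s) (cons4 t x))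
      (fun a b => (hG.hasDerivAt_inv hz a b).differentiableAt) hσ
      (fun a b c d => by rw [hG0]; exact hg.cyl_weyl hκ hx a b c d)
      (fun a b c d => hG.hasDerivAt_weyl hz a b c d) a b c d
  simp only [asdComponents, curvForm, Matrix.of_apply]
  refine HasDerivAt.const_mul _ (HasDerivAt.fun_sum fun a _ => HasDerivAt.fun_sum fun b _ =>
    HasDerivAt.fun_sum fun c _ => HasDerivAt.fun_sum fun d _ => ?_)
  exact ((hW a b c d).mul_const _).mul_const _

end WeylVariation

/-! ### Locality of the operators -/

section Congr

theorem covOne_congr {n : ℕ} {U : Set (Fin n → ℝ)}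
    {g : (Fin n → ℝ) → Matrix (Fin n) (Fin n) ℝ} {x : Fin n → ℝ} (hU : IsOpen U) (hx : x ∈ U)
    {θ η : (Fin n → ℝ) → Fin n → ℝ} (h : ∀ y ∈ U, θ y = η y) : covOne g θ x = covOne g η x := by
  ext i j
  simp only [covOne, Matrix.of_apply, h x hx]
  rw [pd_congr hU hx (fun y hy => congrFun (h y hy) j) i]

theorem confKilling_congr {n : ℕ} {U : Set (Fin n → ℝ)}
    {g : (Fin n → ℝ) → Matrix (Fin n) (Fin n) ℝ} {x : Fin n → ℝ} (hU : IsOpen U) (hx : x ∈ U)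
    {θ η : (Fin n → ℝ) → Fin n → ℝ} (h : ∀ y ∈ U, θ y = η y) :
    confKilling g θ x = confKilling g η x := by
  unfold confKilling
  rw [covOne_congr hU hx h]

theorem dslash_congr {U : Set (Fin 3 → ℝ)} {g h k : (Fin 3 → ℝ) → Matrix (Fin 3) (Fin 3) ℝ}
    {x : Fin 3 → ℝ} (hU : IsOpen U) (hx : x ∈ U) (hk : ∀ y ∈ U, h y = k y) :
    dslash g h x = dslash g k x := by
  have h1 : covTwo g h x = covTwo g k x := by
    funext l i j
    simp only [covTwo, hk x hx]
    rw [pd_congr hU hx (fun y hy => congrFun (congrFun (hk y hy) i) j) l]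
  unfold dslash
  rw [h1]

end Congr

/-- The passage from the formula with `E'(h)` to the formula with the rough Laplacian. -/
theorem MetricOn.confKilling_sub_linTracelessRicci {U : Set (Fin 3 → ℝ)}
    {g h : (Fin 3 → ℝ) → Matrix (Fin 3) (Fin 3) ℝ} {x : Fin 3 → ℝ} {κ : ℝ} (hg : MetricOn U g)
    (hκ : ConstCurvOn U g κ) (hh : ∀ i j, ContDiffOn ℝ ∞ (fun y => h y i j) U)
    (hs : ∀ y ∈ U, ∀ i j, h y i j = h y j i) {θ : (Fin 3 → ℝ) → Fin 3 → ℝ}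
    (hθ : ∀ i, ContDiffOn ℝ ∞ (fun y => θ y i) U) (hx : x ∈ U) (i j : Fin 3) :
    (1 / 2) * confKilling g θ x i j - linTracelessRicci g h x i j
      = (1 / 2) * confKilling g (fun y p => θ y p - divTwo g h y p
            + (1 / 2) * pd p (fun u => tr (g u) (h u)) y) x i j
        - κ * tf (g x) (h x) i j
        + (1 / 2) * roughLaplacian g (fun y => tf (g y) (h y)) x i j := by
  have hdiv : ∀ p, ContDiffOn ℝ ∞ (fun y => divTwo g h y p) U := fun p =>
    ContDiffOn.sum fun a _ => ContDiffOn.sum fun b _ =>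
      (smooth_inv hg.smooth hg.det_ne a b).mul (hg.covTwo_smooth hh a b p)
  have htr : ∀ p, ContDiffOn ℝ ∞ (fun y => pd p (fun u => tr (g u) (h u)) y) U :=
    fun p => pd_smooth (hg.tr_smooth hh) hg.isOpen p
  have h1 : confKilling g (fun y p => θ y p - divTwo g h y p
        + (1 / 2) * pd p (fun u => tr (g u) (h u)) y) x i j
      = confKilling g θ x i j + (-1) * confKilling g (divTwo g h) x i j
        + (1 / 2) * confKilling g (fun y p => pd p (fun u => tr (g u) (h u)) y) x i j := by
    rw [← hg.confKilling_add_mul hθ hdiv (-1) hx,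
      ← hg.confKilling_add_mul (fun p => (hθ p).add (contDiffOn_const.mul (hdiv p))) htr (1 / 2) hx]
    congr 1
    funext y p
    ring
  rw [h1, hg.linTracelessRicci_eq_laplacian hκ hh hs hx]
  ring

/-! ### Components in a chart -/

section Chart

theorem isOpen_chartDomain {Y : Type*} [TopologicalSpace Y] (e : OpenPartialHomeomorph Y E3) :
    IsOpen (chartDomain e) :=
  e.open_target.preimage (PiLp.continuous_toLp 2 _)

variable {Y : Type*} [TopologicalSpace Y] [ChartedSpace E3 Y]

/-- The coordinate frame is the image of the standard basis under the differential of the inverse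
chart. -/
theorem sum_smul_frame (e : OpenPartialHomeomorph Y E3) (x : Fin 3 → ℝ) (c : Fin 3 → ℝ) :
    ∑ i, c i • frame e x i
      = mfderiv (𝓡 3) (𝓡 3) e.symm (WithLp.toLp 2 x) (WithLp.toLp 2 c : E3) := by
  have h : (WithLp.toLp 2 c : E3) = ∑ i, c i • EuclideanSpace.single i (1 : ℝ) := by
    ext j
    simp [Finset.sum_apply, Pi.single_apply]
  simp only [frame]
  rw [h]
  erw [map_sum]
  refine Finset.sum_congr rfl fun i _ => ?_
  erw [map_smul]

/-- The matrix of a metric in a chart has positive determinant: the differential of the inverse chart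
is injective, so the coordinate frame is a basis and the matrix is positive definite. -/
theorem compTwo_det_pos [IsManifold (𝓡 3) ∞ Y] {e : OpenPartialHomeomorph Y E3}
    (he : e ∈ atlas E3 Y) (g : MetricY Y) {x : Fin 3 → ℝ} (hx : x ∈ chartDomain e) :
    0 < (compTwo e g.inner x).det := by
  refine Matrix.PosDef.det_pos ?_
  rw [Matrix.posDef_iff_dotProduct_mulVec]
  refine ⟨?_, fun c hc => ?_⟩
  · ext i j
    simp [compTwo, g.symm (pt e x) (frame e x i)]
  have h1 : star c ⬝ᵥ (compTwo e g.inner x).mulVec c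
      = g.inner (pt e x) (∑ i, c i • frame e x i) (∑ i, c i • frame e x i) := by
    simp only [map_sum, map_smul, _root_.sum_apply, _root_.smul_apply,
      Matrix.mulVec, dotProduct, compTwo, Matrix.of_apply, Finset.mul_sum, smul_eq_mul,
      Pi.star_apply, star_trivial]
    rw [Finset.sum_comm]
    exact Finset.sum_congr rfl fun _ _ => Finset.sum_congr rfl fun _ _ => by ring
  rw [h1]
  refine g.pos _ _ ?_
  rw [sum_smul_frame]
  intro h0
  have hd := (mdifferentiable_of_mem_atlas (I := 𝓡 3) he).symm
  refine hc ?_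
  have := hd.mfderiv_injective (x := WithLp.toLp 2 x) hx (h0.trans (map_zero _).symm)
  exact (WithLp.toLp_injective 2) this

theorem compTwo_symm [IsManifold (𝓡 3) ∞ Y] (e : OpenPartialHomeomorph Y E3) (g : MetricY Y)
    (x : Fin 3 → ℝ) (i j : Fin 3) : compTwo e g.inner x i j = compTwo e g.inner x j i :=
  g.symm _ _ _

theorem cylComp_symm [IsManifold (𝓡 3) ∞ Y] (e : OpenPartialHomeomorph Y E3) (G : MetricM Y)
    (z : Fin 4 → ℝ) (a b : Fin 4) : cylComp e G.inner z a b = cylComp e G.inner z b a :=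
  G.symm _ _ _

theorem cylComp_of_isProductMetric [IsManifold (𝓡 3) ∞ Y] (e : OpenPartialHomeomorph Y E3)
    {G : MetricM Y} {g : MetricY Y} (hG : IsProductMetric G g) :
    cylComp e G.inner = cylMetric (compTwo e g.inner) := by
  funext z
  ext a b
  refine Fin.cases ?_ (fun i => ?_) a <;> refine Fin.cases ?_ (fun j => ?_) b
  · exact (hG _ _ 1 1 0 0).trans (by simp)
  · exact (hG _ _ 1 0 0 _).trans (by simp)
  · exact (hG _ _ 0 1 _ 0).trans (by simp)
  · exact (hG _ _ 0 0 _ _).trans (by simp [compTwo])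

/-- The components in a chart of a path of metrics on the cylinder form a family of metrics. -/
theorem IsPathM.metricFamily [IsManifold (𝓡 3) ∞ Y] {G : ℝ → MetricM Y} {δ : ℝ}
    (hG : IsPathM G δ) {e : OpenPartialHomeomorph Y E3} (he : e ∈ atlas E3 Y) :
    MetricFamily {q ∈ Set.Ioo (-δ) δ ×ˢ cylDomain (chartDomain e) |
      (cylComp e (G q.1).inner q.2).det ≠ 0} (fun s => cylComp e (G s).inner) :=
  metricFamily_of_smooth (G := fun s => cylComp e (G s).inner)
    (isOpen_cylDomain (isOpen_chartDomain e)) isOpen_Ioo (hG.2 e he)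
    fun s _ y _ => cylComp_symm e (G s) y

/-- The components of the base metric of a path of metrics through `dt² + g` are smooth. -/
theorem metricOn_compTwo [IsManifold (𝓡 3) ∞ Y] {G : ℝ → MetricM Y} {δ : ℝ}
    (hG : IsPathM G δ) {g : MetricY Y} (hG0 : IsProductMetric (G 0) g)
    {e : OpenPartialHomeomorph Y E3} (he : e ∈ atlas E3 Y) :
    MetricOn (chartDomain e) (compTwo e g.inner) where
  isOpen := isOpen_chartDomain e
  smooth i j := by
    have h1 : ContDiff ℝ ∞ (fun y : Fin 3 → ℝ => ((0 : ℝ), cons4 0 y)) :=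
      contDiff_const.prodMk (contDiff_cons4 0)
    have h2 := (hG.2 e he i.succ j.succ).comp h1.contDiffOn (s := chartDomain e)
      fun y hy => ⟨⟨neg_lt_zero.2 hG.1, hG.1⟩, hy⟩
    refine h2.congr fun y _ => ?_
    simp only [Function.comp_apply]
    rw [cylComp_of_isProductMetric e hG0]
    rfl
  symm y _ := compTwo_symm e g y
  det_ne _ hy := (compTwo_det_pos he g hy).ne'

section Velocity

variable [IsManifold (𝓡 3) ∞ Y] {G : ℝ → MetricM Y} {h00 : ℝ → Y → ℝ}
  {α : ℝ → ∀ y : Y, TangentSpace (𝓡 3) y →L[ℝ] ℝ}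
  {h : ℝ → ∀ y : Y, TangentSpace (𝓡 3) y →L[ℝ] TangentSpace (𝓡 3) y →L[ℝ] ℝ}

theorem velocity_cylComp_zero_zero
    (hG : ∀ (t : ℝ) (y : Y) (a b : ℝ) (v w : TangentSpace (𝓡 3) y),
      HasDerivAt (fun s => (G s).inner (t, y) (cylVec t y a v) (cylVec t y b w))
        (cylForm (h00 t y) (α t y) (h t y) a v b w) 0)
    (e : OpenPartialHomeomorph Y E3) (z : Fin 4 → ℝ) :
    velocity (fun s => cylComp e (G s).inner) z 0 0 = h00 (z 0) (pt e (tail4 z)) :=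
  (hG _ _ 1 1 0 0).deriv.trans (by simp [cylForm])

theorem velocity_cylComp_zero_succ
    (hG : ∀ (t : ℝ) (y : Y) (a b : ℝ) (v w : TangentSpace (𝓡 3) y),
      HasDerivAt (fun s => (G s).inner (t, y) (cylVec t y a v) (cylVec t y b w))
        (cylForm (h00 t y) (α t y) (h t y) a v b w) 0)
    (e : OpenPartialHomeomorph Y E3) (z : Fin 4 → ℝ) (i : Fin 3) :
    velocity (fun s => cylComp e (G s).inner) z 0 i.succ = compOne e (α (z 0)) (tail4 z) i :=
  (hG _ _ 1 0 0 _).deriv.trans (by simp [cylForm, compOne])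

theorem velocity_cylComp_succ_succ
    (hG : ∀ (t : ℝ) (y : Y) (a b : ℝ) (v w : TangentSpace (𝓡 3) y),
      HasDerivAt (fun s => (G s).inner (t, y) (cylVec t y a v) (cylVec t y b w))
        (cylForm (h00 t y) (α t y) (h t y) a v b w) 0)
    (e : OpenPartialHomeomorph Y E3) (z : Fin 4 → ℝ) (i j : Fin 3) :
    velocity (fun s => cylComp e (G s).inner) z i.succ j.succ
      = compTwo e (h (z 0)) (tail4 z) i j :=
  (hG _ _ 0 0 _ _).deriv.trans (by simp [cylForm, compTwo])

theorem velocity_cylComp_symm (G : ℝ → MetricM Y) (e : OpenPartialHomeomorph Y E3)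
    (z : Fin 4 → ℝ) (a b : Fin 4) :
    velocity (fun s => cylComp e (G s).inner) z a b
      = velocity (fun s => cylComp e (G s).inner) z b a := by
  simp only [velocity, Matrix.of_apply, vel, fun s => cylComp_symm e (G s) z a b]

end Velocity

end Chart

end Cyl

end

theorem theorem3p1 {Y : Type*} [TopologicalSpace Y] [ChartedSpace Cyl.E3 Y]
    [IsManifold (𝓡 3) ∞ Y] (hY : Cyl.OrientedAtlas Y)
    -- the cross-section metric, of constant curvature
    (gY : Cyl.MetricY Y) (κ : ℝ) (hκ : Cyl.HasConstCurvature gY κ)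
    -- the tensor field `{h₀₀, α, h}` on `ℝ × Y`
    (h00 : ℝ → Y → ℝ) (α : ℝ → ∀ y : Y, TangentSpace (𝓡 3) y →L[ℝ] ℝ)
    (h : ℝ → ∀ y : Y, TangentSpace (𝓡 3) y →L[ℝ] TangentSpace (𝓡 3) y →L[ℝ] ℝ)
    -- it is traceless with respect to `dt² + g_Y`
    (htr : ∀ e ∈ atlas Cyl.E3 Y, ∀ t : ℝ, ∀ x ∈ Cyl.chartDomain e,
      h00 t (Cyl.pt e x) + Cyl.tr (Cyl.compTwo e gY.inner x) (Cyl.compTwo e (h t) x) = 0)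
    -- a smooth path of metrics on `ℝ × Y` through `dt² + g_Y` with velocity `{h₀₀, α, h}`
    (G : ℝ → Cyl.MetricM Y) (δ : ℝ) (hG : Cyl.IsPathM G δ)
    (hG0 : Cyl.IsProductMetric (G 0) gY)
    (hG' : ∀ (t : ℝ) (y : Y) (a b : ℝ) (v w : TangentSpace (𝓡 3) y),
      HasDerivAt (fun s => (G s).inner (t, y) (Cyl.cylVec t y a v) (Cyl.cylVec t y b w))
        (Cyl.cylForm (h00 t y) (α t y) (h t y) a v b w) 0) :
    ∀ e ∈ atlas Cyl.E3 Y, ∀ t : ℝ, ∀ x ∈ Cyl.chartDomain e, ∀ i j : Fin 3,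
      -- components in the chart `e`, and their time derivatives
      let g := Cyl.compTwo e gY.inner
      let f : (Fin 3 → ℝ) → ℝ := fun y => h00 t (Cyl.pt e y)
      let A : (Fin 3 → ℝ) → Fin 3 → ℝ := Cyl.compOne e (α t)
      let A' : (Fin 3 → ℝ) → Fin 3 → ℝ := fun y k => deriv (fun s => Cyl.compOne e (α s) y k) t
      let H : (Fin 3 → ℝ) → Matrix (Fin 3) (Fin 3) ℝ := Cyl.compTwo e (h t)
      let H' : (Fin 3 → ℝ) → Matrix (Fin 3) (Fin 3) ℝ :=
        fun y => Matrix.of fun k l => deriv (fun s => Cyl.compTwo e (h s) y k l) t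
      let H'' : (Fin 3 → ℝ) → Matrix (Fin 3) (Fin 3) ℝ :=
        fun y => Matrix.of fun k l => iteratedDeriv 2 (fun s => Cyl.compTwo e (h s) y k l) t
      -- the component `(i, j)` of `W⁻`, as a section of `S²(T*Y)`, along the path of metrics
      let Wij : ℝ → ℝ := fun s =>
        Cyl.asdComponents (g x) (Cyl.weylMinus (Cyl.cylComp e (G s).inner) (Fin.cons t x)) i j
      -- `E'(h)` is the derivative of the traceless Ricci tensor along every path of metrics
      -- on `Y` through `g_Y` with velocity `h`
      (∀ (k : ℝ → Cyl.MetricY Y) (δ' : ℝ), Cyl.IsPathY k δ' → k 0 = gY →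
        (∀ (y : Y) (v w : TangentSpace (𝓡 3) y),
          HasDerivAt (fun s => (k s).inner y v w) (h t y v w) 0) →
        HasDerivAt (fun s => Cyl.tracelessRicci (Cyl.compTwo e (k s).inner) x i j)
          (Cyl.linTracelessRicci g H x i j) 0) ∧
      -- first formula, in terms of `E'(h)`
      HasDerivAt Wij
        ((1 / 2) * Cyl.confKilling g
            (fun y k => -(1 / 2) * Cyl.pd k f y + A' y k - Cyl.starD g A y k) x i j
          - (1 / 2) * Cyl.tf (g x) (H'' x) i j + (1 / 2) * Cyl.dslash g H' x i j
          - Cyl.linTracelessRicci g H x i j) 0 ∧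
      -- second formula
      HasDerivAt Wij
        ((1 / 2) * Cyl.confKilling g
            (fun y k => -(1 / 2) * Cyl.pd k f y - Cyl.divTwo g H y k + A' y k
              - Cyl.starD g A y k + (1 / 2) * Cyl.pd k (fun u => Cyl.tr (g u) (H u)) y) x i j
          - (1 / 2) * Cyl.tf (g x) (H'' x) i j - κ * Cyl.tf (g x) (H x) i j
          + (1 / 2) * Cyl.dslash g H' x i j
          + (1 / 2) * Cyl.roughLaplacian g (fun y => Cyl.tf (g y) (H y)) x i j) 0 := by
  intro e he t x hx i j
  dsimp only
  have hU := Cyl.isOpen_chartDomain e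
  have hg := Cyl.metricOn_compTwo hG hG0 he
  have hdet : ∀ y ∈ Cyl.chartDomain e, 0 < (Cyl.compTwo e gY.inner y).det :=
    fun y hy => Cyl.compTwo_det_pos he gY hy
  have hκ' : Cyl.ConstCurvOn (Cyl.chartDomain e) (Cyl.compTwo e gY.inner) κ := hκ e he
  have hF := hG.metricFamily he
  have hΩ : Cyl.slice {q ∈ Set.Ioo (-δ) δ ×ˢ Cyl.cylDomain (Cyl.chartDomain e) |
      (Cyl.cylComp e (G q.1).inner q.2).det ≠ 0} 0 = Cyl.cylDomain (Cyl.chartDomain e) := by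
    ext z
    refine ⟨fun hz => hz.1.2, fun hz => ⟨⟨⟨neg_lt_zero.2 hG.1, hG.1⟩, hz⟩, ?_⟩⟩
    simp only [Cyl.cylComp_of_isProductMetric e hG0]
    exact hg.cyl.det_ne z hz
  have hk : ∀ a b, ContDiffOn ℝ ∞
      (fun z => Cyl.velocity (fun s => Cyl.cylComp e (G s).inner) z a b)
      (Cyl.cylDomain (Cyl.chartDomain e)) := by
    rw [← hΩ]
    exact hF.velocity_smooth
  have h0 := Cyl.velocity_cylComp_zero_zero hG' e
  have h1 := Cyl.velocity_cylComp_zero_succ hG' e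
  have h2 := Cyl.velocity_cylComp_succ_succ hG' e
  have hks := Cyl.velocity_cylComp_symm G e
  have hW := fun htr => hF.hasDerivAt_weylMinus_cyl hΩ (Cyl.cylComp_of_isProductMetric e hG0) hg hdet
    hκ' hks (t := t) hx htr i j
  generalize Cyl.velocity (fun s => Cyl.cylComp e (G s).inner) = k at *
  -- The components of the velocity are known everywhere, but partial derivatives agree with `deriv`
  -- in the time variable only over the domain of the chart, where `k` is differentiable. The
  -- operators are local, so that this suffices.
  have hf : (fun y => k (Cyl.cons4 t y) 0 0) = fun y => h00 t (Cyl.pt e y) :=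
    funext fun y => h0 (Cyl.cons4 t y)
  have hA : Cyl.mixedPart k t = Cyl.compOne e (α t) :=
    funext fun y => funext fun p => h1 (Cyl.cons4 t y) p
  have hH : Cyl.spatialPart k t = Cyl.compTwo e (h t) :=
    funext fun y => Matrix.ext fun p q => h2 (Cyl.cons4 t y) p q
  have hk' : ∀ a b, ContDiffOn ℝ ∞ (fun z => Cyl.timeDeriv k z a b)
      (Cyl.cylDomain (Cyl.chartDomain e)) :=
    fun a b => Cyl.pd_smooth (hk a b) (Cyl.isOpen_cylDomain hU) 0
  have hd : ∀ s, ∀ y ∈ Cyl.chartDomain e, ∀ a b, Cyl.timeDeriv k (Cyl.cons4 s y) a b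
      = deriv (fun s => k (Cyl.cons4 s y) a b) s := fun s y hy a b =>
    Cyl.pd_zero (Cyl.differentiableAt_of_smooth (hk a b) (Cyl.isOpen_cylDomain hU) hy)
  have hd' : ∀ s, ∀ y ∈ Cyl.chartDomain e, ∀ a b,
      Cyl.timeDeriv (Cyl.timeDeriv k) (Cyl.cons4 s y) a b
        = deriv (fun s => Cyl.timeDeriv k (Cyl.cons4 s y) a b) s := fun s y hy a b =>
    Cyl.pd_zero (Cyl.differentiableAt_of_smooth (hk' a b) (Cyl.isOpen_cylDomain hU) hy)
  have hA' : ∀ y ∈ Cyl.chartDomain e, ∀ p, Cyl.mixedPart (Cyl.timeDeriv k) t y p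
      = deriv (fun s => Cyl.compOne e (α s) y p) t := by
    intro y hy p
    rw [Cyl.mixedPart, hd t y hy]
    congr 1
    exact funext fun s => h1 (Cyl.cons4 s y) p
  have hH' : ∀ s, ∀ y ∈ Cyl.chartDomain e, ∀ p q, Cyl.timeDeriv k (Cyl.cons4 s y) p.succ q.succ
      = deriv (fun s => Cyl.compTwo e (h s) y p q) s := by
    intro s y hy p q
    rw [hd s y hy]
    congr 1
    exact funext fun s => h2 (Cyl.cons4 s y) p q
  have hH2 : Cyl.spatialPart (Cyl.timeDeriv (Cyl.timeDeriv k)) t x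
      = Matrix.of fun p q => iteratedDeriv 2 (fun s => Cyl.compTwo e (h s) x p q) t := by
    ext p q
    rw [Cyl.spatialPart, Matrix.of_apply, Matrix.of_apply, hd' t x hx, iteratedDeriv_succ,
      iteratedDeriv_one]
    congr 1
    exact funext fun s => hH' s x hx p q
  have hW1 := hW (by rw [h0, hH]; exact htr e he t x hx)
  rw [hf, hA, hH, hH2, Cyl.dslash_congr hU hx
      (h := Cyl.spatialPart (Cyl.timeDeriv k) t) (k := fun y => Matrix.of fun p q =>
      deriv (fun s => Cyl.compTwo e (h s) y p q) t)
      fun y hy => Matrix.ext fun p q => hH' t y hy p q] at hW1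
  have hHsm : ∀ p q, ContDiffOn ℝ ∞ (fun y => Cyl.compTwo e (h t) y p q) (Cyl.chartDomain e) := by
    rw [← hH]
    exact fun p q => Cyl.smooth_comp_cons4 (hk p.succ q.succ) t
  have hHs : ∀ y ∈ Cyl.chartDomain e, ∀ p q, Cyl.compTwo e (h t) y p q = Cyl.compTwo e (h t) y q p := by
    rw [← hH]
    exact fun y _ p q => hks _ _ _
  have hθ : ∀ p, ContDiffOn ℝ ∞ (fun y => -(1 / 2) * Cyl.pd p (fun y => h00 t (Cyl.pt e y)) y
      + Cyl.mixedPart (Cyl.timeDeriv k) t y p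
      - Cyl.starD (Cyl.compTwo e gY.inner) (Cyl.compOne e (α t)) y p) (Cyl.chartDomain e) := by
    intro p
    rw [← hf, ← hA]
    exact ((contDiffOn_const.mul (Cyl.pd_smooth (Cyl.smooth_comp_cons4 (hk 0 0) t) hU p)).add
      (Cyl.smooth_comp_cons4 (hk' 0 p.succ) t)).sub
      (hg.starD_smooth hdet (fun p => Cyl.smooth_comp_cons4 (hk 0 p.succ) t) p)
  refine ⟨fun K δ₁ hK hK0 hKv => ?_, ?_, ?_⟩
  · have h3 := Cyl.hasDerivAt_tracelessRicci_of_path (K := fun s => Cyl.compTwo e (K s).inner) hU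
      isOpen_Ioo ⟨neg_lt_zero.2 hK.1, hK.1⟩ (hK.2 e he) (fun s _ y _ => Cyl.compTwo_symm e (K s) y)
      (fun y hy => (Cyl.compTwo_det_pos he (K 0) hy).ne') hx i j
    have h4 : Cyl.velocity (fun s => Cyl.compTwo e (K s).inner) = Cyl.compTwo e (h t) :=
      funext fun y => Matrix.ext fun p q => (hKv (Cyl.pt e y) _ _).deriv
    rwa [h4, hK0] at h3
  · refine hW1.congr_deriv ?_
    rw [Cyl.confKilling_congr hU hx fun y hy => funext fun p => ?_]
    rw [hA' y hy]
  · refine hW1.congr_deriv ?_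
    have h5 := hg.confKilling_sub_linTracelessRicci hκ' hHsm hHs hθ hx i j
    rw [Cyl.confKilling_congr hU hx (θ := fun y p =>
      -(1 / 2) * Cyl.pd p (fun y => h00 t (Cyl.pt e y)) y
        + Cyl.mixedPart (Cyl.timeDeriv k) t y p
        - Cyl.starD (Cyl.compTwo e gY.inner) (Cyl.compOne e (α t)) y p
        - Cyl.divTwo (Cyl.compTwo e gY.inner) (Cyl.compTwo e (h t)) y p
        + (1 / 2) * Cyl.pd p (fun u => Cyl.tr (Cyl.compTwo e gY.inner u)
          (Cyl.compTwo e (h t) u)) y) (η := fun y p =>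
      -(1 / 2) * Cyl.pd p (fun y => h00 t (Cyl.pt e y)) y
        - Cyl.divTwo (Cyl.compTwo e gY.inner) (Cyl.compTwo e (h t)) y p
        + deriv (fun s => Cyl.compOne e (α s) y p) t
        - Cyl.starD (Cyl.compTwo e gY.inner) (Cyl.compOne e (α t)) y p
        + (1 / 2) * Cyl.pd p (fun u => Cyl.tr (Cyl.compTwo e gY.inner u)
          (Cyl.compTwo e (h t) u)) y) fun y hy => funext fun p => by rw [hA' y hy]; ring] at h5
    linear_combination h5
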